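/- Let $q=p^d\equiv 1 \pmod 4$ with $p$ prime. We consider chiral abstract polytopes $\mathcal P$ of rank $4$ (the automorphism group has exactly two orbits on flags, and adjacent flags lie in different orbits) whose automorphism group is isomorphic to $\mathrm{PSL}(2,q)$. For a base flag $\Phi$ and $i=1,2,3$, let $\sigma_i$ be the automorphism of $\mathcal P$ that maps $\Phi$ to the $i$-adjacent flag of the $(i-1)$-adjacent flag of $\Phi$. We say that $\mathcal P$, with base flag $\Phi$, has non fixed point free parabolic subgroups if, for an identification of its automorphism group with $\mathrm{PSL}(2,q)$, each of the two subgroups $\langle\sigma_1,\sigma_2\rangle$ and $\langle\sigma_2,\sigma_3\rangle$ fixes at least one point of the projective line over $\mathbb F_q$. Call an integer $k$ admissible if $k>2$, $k\mid (q-1)/2$, and $k\nmid p^e-1$ and $k\nmid p^e+1$ for all integers $e$ with $1\le e<d$. Polytopes are counted up to isomorphism, with the two enantiomorphic forms of a chiral polytope counted separately; that is, one counts the pairs $(\mathcal P,\Phi)$ up to isomorphisms of polytopes that match the base flags. Then the chiral $4$-polytopes with automorphism group isomorphic to $\mathrm{PSL}(2,q)$ and with non fixed point free parabolic subgroups are classified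 as follows. 1. Each of them has (Schläfli) type $[k,k,k]$ for an admissible $k\equiv 0\pmod 4$, or type $[k/2,k,k/2]$ for an admissible $k\equiv 2\pmod 4$. (In particular, odd admissible $k$ do not contribute.) 2. For each admissible $k\equiv 0\pmod 4$ there are exactly $\varphi(k)/d$ of them of type $[k,k,k]$. 3. For each admissible $k\equiv 2\pmod 4$ there are exactly $\varphi(k)/d$ of them of type $[k/2,k,k/2]$. Here $\varphi$ is Euler's totient function. -/

import Mathlib

universe u v

open scoped LinearAlgebra.Projectivization

/-- With respect to a rank function, two flags are `i`-adjacent if they are distinct and have the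
same faces of every rank other than `i`. -/
def FlagAdj {α : Type u} [PartialOrder α] (rank : α → ℤ) (i : ℤ) (Φ Ψ : Flag α) : Prop :=
  Φ ≠ Ψ ∧ ∀ F : α, rank F ≠ i → (F ∈ Φ ↔ F ∈ Ψ)

/-- Abstract polytopes of rank `n`. -/
structure AbstractPolytope (n : ℕ) where
  /-- the faces -/
  Face : Type u
  [partialOrder : PartialOrder Face]
  /-- there are a least and a greatest face -/
  [boundedOrder : BoundedOrder Face]
  /-- the rank function, with values in `{-1, 0, …, n}` -/
  rank : Face → ℤ
  rank_strictMono : StrictMono rank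
  rank_mem : ∀ F, rank F ∈ Set.Icc (-1 : ℤ) n
  /-- every maximal chain has `n + 2` faces, one of each rank -/
  flag_rank : ∀ (Φ : Flag Face) (i : ℤ), i ∈ Set.Icc (-1 : ℤ) n → ∃! F, F ∈ Φ ∧ rank F = i
  /-- strong flag-connectedness: any two flags are joined by a sequence of successively adjacent
  flags, all of which contain the faces that the two flags have in common -/
  strongly_connected : ∀ Φ Ψ : Flag Face,
    Relation.ReflTransGen
      (fun A B : Flag Face => (∃ i, FlagAdj rank i A B) ∧ ∀ F, F ∈ Φ → F ∈ Ψ → F ∈ B) Φ Ψ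
  /-- the diamond condition -/
  diamond : ∀ J K : Face, J < K → rank J = rank K - 2 →
    {I : Face | J < I ∧ I < K ∧ rank I = rank K - 1}.ncard = 2

namespace AbstractPolytope

attribute [instance] AbstractPolytope.partialOrder AbstractPolytope.boundedOrder

variable {n : ℕ}

/-- The automorphism group. It acts on the flags pointwise. -/
abbrev Aut (P : AbstractPolytope.{u} n) : Type u := P.Face ≃o P.Face

/-- A polytope is chiral if its automorphism group has two orbits on flags, and adjacent flags lie
in different orbits. -/
def IsChiral (P : AbstractPolytope.{u} n) : Prop :=
  Nat.card (MulAction.orbitRel.Quotient P.Aut (Flag P.Face)) = 2 ∧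
    ∀ (i : ℤ) (Φ Ψ : Flag P.Face), FlagAdj P.rank i Φ Ψ → Ψ ∉ MulAction.orbit P.Aut Φ

/-- `σ` is the distinguished generator `σᵢ` with respect to the base flag `Φ`: it maps `Φ` to the
`i`-adjacent flag of the `(i - 1)`-adjacent flag of `Φ`. (Where the automorphisms `ρⱼ` mapping `Φ`
to its `j`-adjacent flag exist, this says `σ = ρᵢ₋₁ * ρᵢ`.) -/
def IsRotation (P : AbstractPolytope.{u} n) (Φ : Flag P.Face) (i : ℤ) (σ : P.Aut) : Prop :=
  ∃ Ψ : Flag P.Face, FlagAdj P.rank (i - 1) Φ Ψ ∧ FlagAdj P.rank i Ψ (σ • Φ)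

/-- All sections `G / F` with `rank F = i - 2` and `rank G = i + 1` are `m`-gons
(for `m > 0`), that is, they have exactly `m` faces of rank `i`. -/
def SectionsArePolygons (P : AbstractPolytope.{u} n) (i : ℤ) (m : ℕ) : Prop :=
  ∀ F G : P.Face, F < G → P.rank F = i - 2 → P.rank G = i + 1 →
    {H : P.Face | F < H ∧ H < G ∧ P.rank H = i}.ncard = m

/-- A polytope of rank 4 has (Schläfli) type `[a, b, c]`. -/
def HasType (P : AbstractPolytope.{u} 4) (a b c : ℕ) : Prop :=
  P.SectionsArePolygons 1 a ∧ P.SectionsArePolygons 2 b ∧ P.SectionsArePolygons 3 c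

/-- The automorphism group of the polytope `P` of rank 4 is isomorphic to `PSL(2, K)`, and for the
distinguished generators `σ₁, σ₂, σ₃` with respect to the base flag `Φ`, each of the parabolic
subgroups `⟨σ₁, σ₂⟩` and `⟨σ₂, σ₃⟩` fixes at least one point of the projective line over `K`. -/
def IsPSLWithFixedPoints (P : AbstractPolytope.{u} 4) (Φ : Flag P.Face) (K : Type v) [Field K] :
    Prop :=
  ∃ (f : P.Aut ≃* Matrix.ProjectiveSpecialLinearGroup (Fin 2) K) (σ₁ σ₂ σ₃ : P.Aut),
    P.IsRotation Φ 1 σ₁ ∧ P.IsRotation Φ 2 σ₂ ∧ P.IsRotation Φ 3 σ₃ ∧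
    (∃ x : ℙ K (Fin 2 → K), ∀ g ∈ Subgroup.closure {σ₁, σ₂}, f g • x = x) ∧
    (∃ y : ℙ K (Fin 2 → K), ∀ g ∈ Subgroup.closure {σ₂, σ₃}, f g • y = y)

end AbstractPolytope

/-- A polytope of rank `n` together with a base flag. -/
structure BasedPolytope (n : ℕ) where
  polytope : AbstractPolytope.{u} n
  base : Flag polytope.Face

namespace BasedPolytope

/-- Isomorphism of polytopes with base flag: an order isomorphism that matches the base flags.
A chiral polytope has exactly two isomorphism classes of base flags; they are its two
enantiomorphic forms. -/
instance setoid (n : ℕ) : Setoid (BasedPolytope.{u} n) where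
  r X Y := ∃ e : X.polytope.Face ≃o Y.polytope.Face, Flag.map e X.base = Y.base
  iseqv :=
    { refl := fun X => ⟨OrderIso.refl _, SetLike.coe_injective (by simp)⟩
      symm := by
        rintro X Y ⟨e, he⟩
        exact ⟨e.symm, by rw [← he, ← Flag.symm_map, Equiv.symm_apply_apply]⟩
      trans := by
        rintro X Y Z ⟨e, he⟩ ⟨f, hf⟩
        refine ⟨e.trans f, ?_⟩
        rw [← hf, ← he]
        exact SetLike.coe_injective (by simp [Set.image_image]) }

/-- Chiral 4-polytopes with automorphism group `PSL(2, K)` whose parabolic subgroups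
each fix a point of the projective line. -/
def IsChiralPSL (K : Type v) [Field K] (X : BasedPolytope.{u} 4) : Prop :=
  X.polytope.IsChiral ∧ X.polytope.IsPSLWithFixedPoints X.base K

/-- The number of the polytopes above that have type `[a, b, c]`, up to isomorphism, where the two
enantiomorphic forms of a chiral polytope are counted separately. -/
noncomputable def numChiralPSL (K : Type v) [Field K] (a b c : ℕ) : ℕ :=
  ((fun X : BasedPolytope.{u} 4 => Quotient.mk (setoid 4) X) ''
    {X | IsChiralPSL K X ∧ X.polytope.HasType a b c}).ncard

end BasedPolytope

/-- The integers `k > 2` with `k ∣ (p ^ d - 1) / 2` that divide none of the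
`p ^ e - 1` and `p ^ e + 1` for `1 ≤ e < d`. -/
def IsAdmissible (p d k : ℕ) : Prop :=
  2 < k ∧ k ∣ (p ^ d - 1) / 2 ∧
    ∀ e : ℕ, 1 ≤ e → e < d → ¬ k ∣ p ^ e - 1 ∧ ¬ k ∣ p ^ e + 1

/-!
Let `P` be a chiral polytope of rank 4 with base flag `Φ`, and write `Φⁱ` for the `i`-adjacent flag.
Since `Aut P` acts freely on the flags with the two orbits of `Φ` and `Φ¹`, there is a unique
automorphism `τᵢ` with `τᵢ Φ¹ = Φⁱ` for `0 ≤ i < 4`. Here `τ₁ = 1`, and the group is generated by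
`x = τ₀ = σ₁`, `y = τ₂⁻¹ = σ₂` and `t = τ₃ = σ₂σ₃`, which satisfy `t² = (xy)² = (xt)² = 1`. The
flags are the pairs `gΦ`, `gΦ¹` with `g ∈ Aut P`, and their adjacencies can be read off from `x`,
`y`, `t`. So `(P, Φ)` is determined up to isomorphism by the group with these three elements
(`IsChiral.exists_iso`, `IsChiral.exists_mulEquiv`); no automorphism of the group inverts all three,
as it would come from an automorphism of `P` that maps `Φ` to `Φ¹` (`IsChiral.not_inverts`); and
`⟨x, y⟩ ∩ ⟨y, t⟩ = ⟨y⟩` (`IsChiral.closure_inf_closure_le`). Conversely a triple with these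
properties (`IsChiralTriple`) belongs to a chiral polytope (`IsChiralTriple.exists_polytope`): the
pairs above, with the adjacencies prescribed by the triple, are the flags of a polytope
(`FlagSystem.polytope`), because in rank 4 the intersection property of the parabolic subgroups
reduces to the one just mentioned, `⟨σ₁⟩ ∩ ⟨σ₂⟩ = 1` and `⟨σ₂⟩ ∩ ⟨σ₃⟩ = 1`
(`AdjConn.inter_of_rank_four`).

Now let the group be `PSL(2, K)`, acting on the projective line. If `⟨x, y⟩` fixes a point and
`⟨y, t⟩` fixes a point, then these points are distinct and can be taken to be `∞` and `0`. The
relations then force, up to a scaling, `x : w ↦ -l⁻¹ w + 1`, `y : w ↦ l w` and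
`t : w ↦ w / ((1 + l⁻¹) w - 1)` for some `l ≠ 0` (`exists_normalForm`). The polytope is thus
governed by the single parameter `l`, which is a square because it is the determinant of a matrix
that represents `y`.

* If the three elements generate `PSL(2, K)`, then `l` generates the field `K`
  (`NormalForm.subfield_eq_top`), that is, the order `k` of `l` divides no `p ^ e - 1` with
  `1 ≤ e < d`. Conversely, if `l` generates `K`, then `⟨x, y⟩` contains all translations and
  `⟨y, t⟩` contains their transposes (`NormalForm.closure_eq_top`).
* If `l ^ p ^ e = l⁻¹`, then the Frobenius power, followed by a scaling, inverts the three
  generators (`NormalForm.exists_inverts`). Conversely, any automorphism of `PSL(2, K)` that maps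
  `x` to an upper triangular and `y` to a diagonal element acts on the translations, up to a factor,
  as a field automorphism, hence maps the parameter to a Frobenius conjugate
  (`NormalForm.exists_pow_eq`). So chirality means that `k > 2` and that `k` divides no `p ^ e + 1`
  with `1 ≤ e < d`.
* The map `w ↦ -w` belongs to both parabolic subgroups (`NormalForm.neg_mem`), so the intersection
  condition requires `-1 ∈ ⟨l⟩`, that is, `k` is even; and this suffices (`NormalForm.inf_le`).

Hence `k` is admissible and even, and the type is `[k', k, k']` with `k'` the order of `-l⁻¹`, the
multiplier of `σ₁` and of `σ₃`; this is `k` or `k / 2` according to `k` modulo `4`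
(`orderOf_neg_inv`). Two parameters give isomorphic based polytopes if and only if they are
Frobenius conjugate, and the conjugates of `l` are `d` distinct elements. So the `φ(k)` elements of
order `k` give `φ(k) / d` classes (`mul_numChiralPSL`).
-/

/-! ### Flags and their adjacent flags -/

namespace AbstractPolytope

variable {n : ℕ} (P : AbstractPolytope.{u} n)

/-- The face of rank `i` of a flag (the least face if `i` is not one of the ranks `-1, …, n`). -/
noncomputable def face (Φ : Flag P.Face) (i : ℤ) : P.Face :=
  if h : i ∈ Set.Icc (-1 : ℤ) n then (P.flag_rank Φ i h).choose else ⊥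

variable {P}

lemma face_mem (Φ : Flag P.Face) (i : ℤ) : P.face Φ i ∈ Φ := by
  unfold face
  split_ifs with h
  · exact (P.flag_rank Φ i h).choose_spec.1.1
  · exact Φ.bot_mem

lemma rank_face (Φ : Flag P.Face) {i : ℤ} (hi : i ∈ Set.Icc (-1 : ℤ) n) :
    P.rank (P.face Φ i) = i := by
  unfold face
  rw [dif_pos hi]
  exact (P.flag_rank Φ i hi).choose_spec.1.2

lemma face_eq {Φ : Flag P.Face} {F : P.Face} (hF : F ∈ Φ) : P.face Φ (P.rank F) = F :=
  (P.flag_rank Φ _ (P.rank_mem F)).unique ⟨face_mem Φ _, rank_face Φ (P.rank_mem F)⟩ ⟨hF, rfl⟩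

lemma mem_flag_iff {Φ : Flag P.Face} {F : P.Face} : F ∈ Φ ↔ P.face Φ (P.rank F) = F :=
  ⟨face_eq, fun h => h ▸ face_mem Φ _⟩

lemma face_lt_face (Φ : Flag P.Face) {i j : ℤ} (hi : i ∈ Set.Icc (-1 : ℤ) n)
    (hj : j ∈ Set.Icc (-1 : ℤ) n) (hij : i < j) : P.face Φ i < P.face Φ j := by
  rcases Φ.le_or_le (face_mem Φ i) (face_mem Φ j) with h | h
  · refine lt_of_le_of_ne h fun h' => ?_
    have := congrArg P.rank h'
    rw [rank_face Φ hi, rank_face Φ hj] at this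
    omega
  · have := P.rank_strictMono.monotone h
    rw [rank_face Φ hi, rank_face Φ hj] at this
    omega

lemma face_le_face (Φ : Flag P.Face) {i j : ℤ} (hi : i ∈ Set.Icc (-1 : ℤ) n)
    (hj : j ∈ Set.Icc (-1 : ℤ) n) (hij : i ≤ j) : P.face Φ i ≤ P.face Φ j := by
  rcases hij.eq_or_lt with rfl | h
  · exact le_rfl
  · exact (face_lt_face Φ hi hj h).le

lemma flag_ext {Φ Ψ : Flag P.Face}
    (h : ∀ i ∈ Set.Icc (-1 : ℤ) n, P.face Φ i = P.face Ψ i) : Φ = Ψ := by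
  refine SetLike.ext fun F => ?_
  rw [mem_flag_iff, mem_flag_iff, h _ (P.rank_mem F)]

lemma exists_flag_of_isChain {c : Set P.Face} (hc : IsChain (· ≤ ·) c) :
    ∃ Φ : Flag P.Face, c ⊆ Φ := by
  obtain ⟨M, hM, h⟩ := hc.exists_maxChain
  exact ⟨Flag.ofIsMaxChain M hM, h⟩

lemma exists_flag_of_le {F G : P.Face} (h : F ≤ G) : ∃ Φ : Flag P.Face, F ∈ Φ ∧ G ∈ Φ := by
  obtain ⟨Φ, hΦ⟩ := exists_flag_of_isChain (IsChain.pair (r := (· ≤ ·)) h)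
  exact ⟨Φ, hΦ (by simp), hΦ (by simp)⟩

lemma exists_flag_mem (F : P.Face) : ∃ Φ : Flag P.Face, F ∈ Φ :=
  (exists_flag_of_le le_rfl).imp fun _ h => h.1

/-- A sequence of faces, one of each rank, that is increasing, is a flag. -/
lemma exists_flag_of_seq (f : ℤ → P.Face)
    (hr : ∀ i ∈ Set.Icc (-1 : ℤ) n, P.rank (f i) = i)
    (hm : ∀ i ∈ Set.Icc (-1 : ℤ) n, i < n → f i ≤ f (i + 1)) :
    ∃ Φ : Flag P.Face, ∀ i ∈ Set.Icc (-1 : ℤ) n, P.face Φ i = f i := by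
  have hmono : ∀ (i : ℤ) (k : ℕ), i ∈ Set.Icc (-1 : ℤ) n → i + k ∈ Set.Icc (-1 : ℤ) n →
      f i ≤ f (i + k) := by
    intro i k hi
    induction k with
    | zero => simp
    | succ k ih =>
      intro hk
      simp only [Set.mem_Icc] at hk hi ih
      push_cast at hk ⊢
      refine (ih (by constructor <;> omega)).trans ?_
      rw [← add_assoc]
      exact hm _ (by constructor <;> omega) (by omega)
  have hc : IsChain (· ≤ ·) (f '' Set.Icc (-1 : ℤ) n) := by
    rintro _ ⟨i, hi, rfl⟩ _ ⟨j, hj, rfl⟩ -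
    rcases le_total i j with h | h
    · obtain ⟨k, rfl⟩ := Int.le.dest h
      exact Or.inl (hmono i k hi hj)
    · obtain ⟨k, rfl⟩ := Int.le.dest h
      exact Or.inr (hmono j k hj hi)
  obtain ⟨Φ, hΦ⟩ := exists_flag_of_isChain hc
  refine ⟨Φ, fun i hi => ?_⟩
  have := face_eq (hΦ ⟨i, hi, rfl⟩)
  rwa [hr i hi] at this

lemma flagAdj_iff_face {i : ℤ} {Φ Ψ : Flag P.Face} :
    FlagAdj P.rank i Φ Ψ ↔ i ∈ Set.Icc (-1 : ℤ) n ∧ P.face Φ i ≠ P.face Ψ i ∧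
      ∀ j ∈ Set.Icc (-1 : ℤ) n, j ≠ i → P.face Φ j = P.face Ψ j := by
  constructor
  · rintro ⟨hne, h⟩
    have key : ∀ j ∈ Set.Icc (-1 : ℤ) n, j ≠ i → P.face Φ j = P.face Ψ j := by
      intro j hj hji
      have hj' := rank_face Φ hj
      have := (h (P.face Φ j) (by rw [hj']; exact hji)).1 (face_mem Φ j)
      have := face_eq this
      rw [hj'] at this
      exact this.symm
    have hi : i ∈ Set.Icc (-1 : ℤ) n := by
      by_contra hi
      exact hne (flag_ext fun j hj => key j hj (by rintro rfl; exact hi hj))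
    refine ⟨hi, fun he => hne (flag_ext fun j hj => ?_), key⟩
    by_cases hji : j = i
    · rw [hji, he]
    · exact key j hj hji
  · rintro ⟨hi, hne, h⟩
    refine ⟨fun he => hne (by rw [he]), fun F hF => ?_⟩
    rw [mem_flag_iff, mem_flag_iff, h _ (P.rank_mem F) hF]

lemma face_bot (Φ : Flag P.Face) : P.face Φ (-1) = ⊥ := by
  have h : (-1 : ℤ) ∈ Set.Icc (-1 : ℤ) n := by constructor <;> omega
  by_contra hne
  have := P.rank_strictMono (bot_lt_iff_ne_bot.2 hne)
  rw [rank_face Φ h] at this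
  have := (P.rank_mem ⊥).1
  omega

lemma face_top (Φ : Flag P.Face) : P.face Φ n = ⊤ := by
  have h : (n : ℤ) ∈ Set.Icc (-1 : ℤ) n := by constructor <;> omega
  by_contra hne
  have := P.rank_strictMono (lt_top_iff_ne_top.2 hne)
  rw [rank_face Φ h] at this
  have := (P.rank_mem ⊤).2
  omega

lemma mem_Ico_of_flagAdj {i : ℤ} {Φ Ψ : Flag P.Face} (h : FlagAdj P.rank i Φ Ψ) :
    0 ≤ i ∧ i < n := by
  obtain ⟨hi, hne, -⟩ := flagAdj_iff_face.1 h
  obtain ⟨h1, h2⟩ := hi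
  constructor
  · by_contra h'
    obtain rfl : i = -1 := by omega
    exact hne (by rw [face_bot, face_bot])
  · by_contra h'
    obtain rfl : i = n := by omega
    exact hne (by rw [face_top, face_top])

/-- The faces strictly between the faces of rank `i - 1` and `i + 1` of a flag are two: the face of
rank `i` of the flag and another one. -/
lemma exists_opposite (Φ : Flag P.Face) {i : ℤ} (h0 : 0 ≤ i) (hn : i < n) :
    ∃ F : P.Face, F ≠ P.face Φ i ∧ ∀ I, (P.face Φ (i - 1) < I ∧ I < P.face Φ (i + 1) ∧
      P.rank I = i) ↔ (I = P.face Φ i ∨ I = F) := by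
  have h1 : i - 1 ∈ Set.Icc (-1 : ℤ) n := by constructor <;> omega
  have h2 : i + 1 ∈ Set.Icc (-1 : ℤ) n := by constructor <;> omega
  have h3 : i ∈ Set.Icc (-1 : ℤ) n := by constructor <;> omega
  have hd := P.diamond (P.face Φ (i - 1)) (P.face Φ (i + 1))
    (face_lt_face Φ h1 h2 (by omega)) (by rw [rank_face Φ h1, rank_face Φ h2]; omega)
  rw [rank_face Φ h2, show i + 1 - 1 = i by omega] at hd
  obtain ⟨a, b, hab, hs⟩ := Set.ncard_eq_two.1 hd
  have hm : ∀ I, (P.face Φ (i - 1) < I ∧ I < P.face Φ (i + 1) ∧ P.rank I = i) ↔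
      (I = a ∨ I = b) := by
    intro I
    have := Set.ext_iff.1 hs I
    simpa using this
  rcases (hm (P.face Φ i)).1 ⟨face_lt_face Φ h1 h3 (by omega), face_lt_face Φ h3 h2 (by omega),
    rank_face Φ h3⟩ with h | h
  · exact ⟨b, by rw [h]; exact hab.symm, by rw [h]; exact hm⟩
  · exact ⟨a, by rw [h]; exact hab, by rw [h]; exact fun I => (hm I).trans or_comm⟩

lemma existsUnique_flagAdj (Φ : Flag P.Face) {i : ℤ} (h0 : 0 ≤ i) (hn : i < n) :
    ∃! Ψ, FlagAdj P.rank i Φ Ψ := by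
  obtain ⟨F, hF, hI⟩ := exists_opposite Φ h0 hn
  have h3 : i ∈ Set.Icc (-1 : ℤ) n := by constructor <;> omega
  have hF' := (hI F).2 (Or.inr rfl)
  obtain ⟨Ψ, hΨ⟩ := exists_flag_of_seq (P := P) (fun j => if j = i then F else P.face Φ j)
    (fun j hj => by
      split_ifs with h
      · rw [h]; exact hF'.2.2
      · exact rank_face Φ hj)
    (fun j hj hjn => by
      have hj1 : j + 1 ∈ Set.Icc (-1 : ℤ) n := ⟨by have := hj.1; omega, by omega⟩
      split_ifs with h h' h'
      · omega
      · rw [h]; exact hF'.2.1.le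
      · have : j = i - 1 := by omega
        rw [this]; exact hF'.1.le
      · exact face_le_face Φ hj hj1 (by omega))
  refine ⟨Ψ, flagAdj_iff_face.2 ⟨h3, ?_, fun j hj hji => ?_⟩, fun Ψ' h => flag_ext fun j hj => ?_⟩
  · rw [hΨ i h3, if_pos rfl]; exact hF.symm
  · rw [hΨ j hj, if_neg hji]
  · obtain ⟨-, hne, hh⟩ := flagAdj_iff_face.1 h
    rw [hΨ j hj]
    split_ifs with hji
    · subst hji
      have h1 : j - 1 ∈ Set.Icc (-1 : ℤ) n := by constructor <;> omega
      have h2 : j + 1 ∈ Set.Icc (-1 : ℤ) n := by constructor <;> omega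
      refine ((hI (P.face Ψ' j)).1 ⟨?_, ?_, rank_face Ψ' hj⟩).resolve_left hne.symm
      · rw [hh _ h1 (by omega)]; exact face_lt_face Ψ' h1 hj (by omega)
      · rw [hh _ h2 (by omega)]; exact face_lt_face Ψ' hj h2 (by omega)
    · exact (hh j hj hji).symm

variable (P) in
open Classical in
/-- The `i`-adjacent flag of a flag (the flag itself if there is none). -/
noncomputable def adj (i : ℤ) (Φ : Flag P.Face) : Flag P.Face :=
  if h : 0 ≤ i ∧ i < n then (existsUnique_flagAdj Φ h.1 h.2).choose else Φ

lemma flagAdj_adj {i : ℤ} (h0 : 0 ≤ i) (hn : i < n) (Φ : Flag P.Face) :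
    FlagAdj P.rank i Φ (P.adj i Φ) := by
  unfold adj
  rw [dif_pos ⟨h0, hn⟩]
  exact (existsUnique_flagAdj Φ h0 hn).choose_spec.1

lemma eq_adj_of_flagAdj {i : ℤ} {Φ Ψ : Flag P.Face} (h : FlagAdj P.rank i Φ Ψ) :
    Ψ = P.adj i Φ := by
  obtain ⟨h0, hn⟩ := mem_Ico_of_flagAdj h
  exact (existsUnique_flagAdj Φ h0 hn).unique h (flagAdj_adj h0 hn Φ)

lemma flagAdj_symm {i : ℤ} {Φ Ψ : Flag P.Face} (h : FlagAdj P.rank i Φ Ψ) :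
    FlagAdj P.rank i Ψ Φ :=
  ⟨h.1.symm, fun F hF => (h.2 F hF).symm⟩

lemma adj_adj (i : ℤ) (Φ : Flag P.Face) : P.adj i (P.adj i Φ) = Φ := by
  by_cases h : 0 ≤ i ∧ i < n
  · exact (eq_adj_of_flagAdj (flagAdj_symm (flagAdj_adj h.1 h.2 Φ))).symm
  · simp [adj, dif_neg h]

lemma face_adj_of_ne {i j : ℤ} (hij : j ≠ i) (Φ : Flag P.Face) :
    P.face (P.adj i Φ) j = P.face Φ j := by
  by_cases h : 0 ≤ i ∧ i < n
  · by_cases hj : j ∈ Set.Icc (-1 : ℤ) n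
    · exact ((flagAdj_iff_face.1 (flagAdj_adj h.1 h.2 Φ)).2.2 j hj hij).symm
    · simp only [face, dif_neg hj]
  · simp [adj, dif_neg h]

lemma face_adj_ne {i : ℤ} (h0 : 0 ≤ i) (hn : i < n) (Φ : Flag P.Face) :
    P.face (P.adj i Φ) i ≠ P.face Φ i :=
  (flagAdj_iff_face.1 (flagAdj_adj h0 hn Φ)).2.1.symm

/-- Two flags with the same faces of rank `i - 1`, `i` and `i + 1` have `i`-adjacent flags with the
same face of rank `i`. -/
lemma face_adj_congr {i : ℤ} {Φ Ψ : Flag P.Face}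
    (h1 : P.face Φ (i - 1) = P.face Ψ (i - 1)) (h2 : P.face Φ i = P.face Ψ i)
    (h3 : P.face Φ (i + 1) = P.face Ψ (i + 1)) :
    P.face (P.adj i Φ) i = P.face (P.adj i Ψ) i := by
  by_cases h : 0 ≤ i ∧ i < n
  · obtain ⟨h0, hn⟩ := h
    obtain ⟨F, hF, hI⟩ := exists_opposite Φ h0 hn
    have hi : i ∈ Set.Icc (-1 : ℤ) n := by constructor <;> omega
    have hi1 : i - 1 ∈ Set.Icc (-1 : ℤ) n := by constructor <;> omega
    have hi2 : i + 1 ∈ Set.Icc (-1 : ℤ) n := by constructor <;> omega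
    have key : ∀ Ω : Flag P.Face, P.face Φ (i - 1) = P.face Ω (i - 1) → P.face Φ i = P.face Ω i →
        P.face Φ (i + 1) = P.face Ω (i + 1) → P.face (P.adj i Ω) i = F := by
      intro Ω g1 g2 g3
      refine ((hI _).1 ⟨?_, ?_, rank_face _ hi⟩).resolve_left ?_
      · rw [g1, ← face_adj_of_ne (show i - 1 ≠ i by omega) Ω]
        exact face_lt_face _ hi1 hi (by omega)
      · rw [g3, ← face_adj_of_ne (show i + 1 ≠ i by omega) Ω]
        exact face_lt_face _ hi hi2 (by omega)
      · rw [g2]; exact face_adj_ne h0 hn Ω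
    rw [key Φ rfl rfl rfl, key Ψ h1 h2 h3]
  · simpa [adj, dif_neg h] using h2

lemma adj_comm {i j : ℤ} (hij : i + 1 < j) (Φ : Flag P.Face) :
    P.adj i (P.adj j Φ) = P.adj j (P.adj i Φ) := by
  refine flag_ext fun l _ => ?_
  by_cases hi : l = i
  · subst hi
    rw [face_adj_of_ne (show l ≠ j by omega) (P.adj l Φ)]
    apply face_adj_congr <;> exact face_adj_of_ne (by omega) _
  · rw [face_adj_of_ne hi]
    by_cases hj : l = j
    · subst hj
      apply face_adj_congr <;> exact (face_adj_of_ne (by omega) _).symm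
    · rw [face_adj_of_ne hj, face_adj_of_ne hj, face_adj_of_ne hi]

/-- Strong connectivity: two flags that share the faces with ranks in `A` are joined by successive
adjacencies of ranks outside `A`. -/
lemma reflTransGen_adj (A : Set ℤ) {Φ Ψ : Flag P.Face}
    (h : ∀ i ∈ A, P.face Φ i = P.face Ψ i) :
    Relation.ReflTransGen
      (fun X Y => ∃ i : ℤ, 0 ≤ i ∧ i < n ∧ i ∉ A ∧ Y = P.adj i X) Φ Ψ := by
  have hc := P.strongly_connected Φ Ψ
  -- the flags on the path keep all faces with ranks in `A`
  have key : ∀ X, Relation.ReflTransGen (fun A B : Flag P.Face =>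
      (∃ i, FlagAdj P.rank i A B) ∧ ∀ F, F ∈ Φ → F ∈ Ψ → F ∈ B) Φ X →
      Relation.ReflTransGen (fun X Y => ∃ i : ℤ, 0 ≤ i ∧ i < n ∧ i ∉ A ∧ Y = P.adj i X) Φ X ∧
      ∀ i ∈ A, i ∈ Set.Icc (-1 : ℤ) n → P.face X i = P.face Φ i := by
    intro X hX
    induction hX with
    | refl => exact ⟨.refl, fun _ _ _ => rfl⟩
    | @tail X Y _ hXY ih =>
      obtain ⟨⟨i, hi⟩, hF⟩ := hXY
      have hY : ∀ j ∈ A, j ∈ Set.Icc (-1 : ℤ) n → P.face Y j = P.face Φ j := by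
        intro j hj hj'
        have := face_eq (hF (P.face Φ j) (face_mem Φ j) (h j hj ▸ face_mem Ψ j))
        rwa [rank_face Φ hj'] at this
      refine ⟨ih.1.tail ⟨i, (mem_Ico_of_flagAdj hi).1, (mem_Ico_of_flagAdj hi).2, fun hiA => ?_,
        eq_adj_of_flagAdj hi⟩, hY⟩
      have hi' := flagAdj_iff_face.1 hi
      exact hi'.2.1 (by rw [hY i hiA hi'.1, ih.2 i hiA hi'.1])
  exact (key Ψ hc).1

/-! ### Isomorphisms and flags -/

section Iso

variable {Q : AbstractPolytope.{v} n}

lemma rank_le_rank_map (e : P.Face ≃o Q.Face) (F : P.Face) : P.rank F ≤ Q.rank (e F) := by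
  obtain ⟨Φ, hΦ⟩ := exists_flag_mem F
  have key : ∀ k : ℕ, (-1 : ℤ) + k ∈ Set.Icc (-1 : ℤ) n →
      (-1 : ℤ) + k ≤ Q.rank (e (P.face Φ (-1 + k))) := by
    intro k
    induction k with
    | zero => intro _; simpa using (Q.rank_mem _).1
    | succ k ih =>
      intro hk
      have hk' : (-1 : ℤ) + k ∈ Set.Icc (-1 : ℤ) n := by
        simp only [Set.mem_Icc] at hk ⊢; push_cast at hk; omega
      have := Q.rank_strictMono (e.strictMono (face_lt_face Φ hk' hk (by push_cast; omega)))
      have := ih hk'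
      push_cast at *
      omega
  have hr := P.rank_mem F
  obtain ⟨k, hk⟩ := Int.le.dest hr.1
  have := key k (by rw [hk]; exact hr)
  rwa [hk, face_eq hΦ] at this

@[simp]
lemma rank_map (e : P.Face ≃o Q.Face) (F : P.Face) : Q.rank (e F) = P.rank F := by
  refine le_antisymm ?_ (rank_le_rank_map e F)
  simpa using rank_le_rank_map e.symm (e F)

lemma mem_map_flag (e : P.Face ≃o Q.Face) {Φ : Flag P.Face} {F : P.Face} :
    e F ∈ Flag.map e Φ ↔ F ∈ Φ := by
  rw [← SetLike.mem_coe, Flag.coe_map]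
  simp

lemma face_map (e : P.Face ≃o Q.Face) (Φ : Flag P.Face) {i : ℤ}
    (hi : i ∈ Set.Icc (-1 : ℤ) n) : Q.face (Flag.map e Φ) i = e (P.face Φ i) := by
  have := face_eq ((mem_map_flag e).2 (face_mem Φ i))
  rwa [rank_map, rank_face Φ hi] at this

lemma map_adj (e : P.Face ≃o Q.Face) (i : ℤ) (Φ : Flag P.Face) :
    Flag.map e (P.adj i Φ) = Q.adj i (Flag.map e Φ) := by
  by_cases h : 0 ≤ i ∧ i < n
  · refine eq_adj_of_flagAdj (flagAdj_iff_face.2 ?_)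
    obtain ⟨hi, hne, hh⟩ := flagAdj_iff_face.1 (flagAdj_adj h.1 h.2 Φ)
    refine ⟨hi, ?_, fun j hj hji => ?_⟩
    · rw [face_map e _ hi, face_map e _ hi]
      exact fun h => hne (e.injective h)
    · rw [face_map e _ hj, face_map e _ hj, hh j hj hji]
  · simp [adj, dif_neg h]

/-- An isomorphism is determined by the image of one flag. -/
lemma iso_ext {e f : P.Face ≃o Q.Face} {Φ : Flag P.Face} (h : Flag.map e Φ = Flag.map f Φ) :
    e = f := by
  have key : ∀ Ψ : Flag P.Face, Flag.map e Ψ = Flag.map f Ψ := by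
    intro Ψ
    have := reflTransGen_adj (P := P) ∅ (Φ := Φ) (Ψ := Ψ) (by simp)
    induction this with
    | refl => exact h
    | tail _ hXY ih =>
      obtain ⟨i, -, -, -, rfl⟩ := hXY
      rw [map_adj, map_adj, ih]
  ext F
  obtain ⟨Ψ, hΨ⟩ := exists_flag_mem F
  have hr := P.rank_mem F
  rw [← face_eq hΨ, ← face_map e Ψ hr, ← face_map f Ψ hr, key]

/-- A map of flags that commutes with adjacency maps flags with a common face of rank `i` to flags
with a common face of rank `i`. -/
lemma face_congr_of_comm {β : Flag P.Face → Flag Q.Face}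
    (hβ : ∀ i Φ, β (P.adj i Φ) = Q.adj i (β Φ)) {i : ℤ} {Φ Ψ : Flag P.Face}
    (h : P.face Φ i = P.face Ψ i) : Q.face (β Φ) i = Q.face (β Ψ) i := by
  have := reflTransGen_adj (P := P) {i} (Φ := Φ) (Ψ := Ψ) (by simpa using h)
  clear h
  induction this with
  | refl => rfl
  | tail _ hXY ih =>
    obtain ⟨j, -, -, hj, rfl⟩ := hXY
    rw [ih, hβ, face_adj_of_ne]
    rintro rfl
    exact hj rfl

/-- A bijection of the flags that commutes with adjacency is induced by an isomorphism. -/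
theorem exists_iso_of_flagEquiv (β : Flag P.Face ≃ Flag Q.Face)
    (hβ : ∀ i Φ, β (P.adj i Φ) = Q.adj i (β Φ)) :
    ∃ e : P.Face ≃o Q.Face, ∀ Φ, Flag.map e Φ = β Φ := by
  have hβ' : ∀ i Φ, β.symm (Q.adj i Φ) = P.adj i (β.symm Φ) := by
    intro i Φ
    rw [Equiv.symm_apply_eq, hβ, Equiv.apply_symm_apply]
  choose f hf using fun F : P.Face => exists_flag_mem F
  choose g hg using fun F : Q.Face => exists_flag_mem F
  let φ : P.Face → Q.Face := fun F => Q.face (β (f F)) (P.rank F)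
  let ψ : Q.Face → P.Face := fun F => P.face (β.symm (g F)) (Q.rank F)
  have hφ : ∀ F Φ, F ∈ Φ → φ F = Q.face (β Φ) (P.rank F) := fun F Φ h =>
    face_congr_of_comm hβ (by rw [face_eq h, face_eq (hf F)])
  have hψ : ∀ F Φ, F ∈ Φ → ψ F = P.face (β.symm Φ) (Q.rank F) := fun F Φ h =>
    face_congr_of_comm hβ' (by rw [face_eq h, face_eq (hg F)])
  have hrφ : ∀ F, Q.rank (φ F) = P.rank F := fun F => rank_face _ (P.rank_mem F)
  have hrψ : ∀ F, P.rank (ψ F) = Q.rank F := fun F => rank_face _ (Q.rank_mem F)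
  have mφ : Monotone φ := by
    intro F G h
    obtain ⟨Φ, hF, hG⟩ := exists_flag_of_le h
    rw [hφ F Φ hF, hφ G Φ hG]
    exact face_le_face _ (P.rank_mem F) (P.rank_mem G) (P.rank_strictMono.monotone h)
  have mψ : Monotone ψ := by
    intro F G h
    obtain ⟨Φ, hF, hG⟩ := exists_flag_of_le h
    rw [hψ F Φ hF, hψ G Φ hG]
    exact face_le_face _ (Q.rank_mem F) (Q.rank_mem G) (Q.rank_strictMono.monotone h)
  have l : Function.LeftInverse ψ φ := by
    intro F
    rw [hψ (φ F) (β (f F)) (face_mem _ _), Equiv.symm_apply_apply, hrφ, face_eq (hf F)]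
  have r : Function.RightInverse ψ φ := by
    intro F
    rw [hφ (ψ F) (β.symm (g F)) (face_mem _ _), Equiv.apply_symm_apply, hrψ, face_eq (hg F)]
  let e : P.Face ≃o Q.Face := Equiv.toOrderIso ⟨φ, ψ, l, r⟩ mφ mψ
  refine ⟨e, fun Φ => flag_ext fun i hi => ?_⟩
  rw [face_map e Φ hi]
  change φ (P.face Φ i) = _
  rw [hφ _ Φ (face_mem _ _), rank_face Φ hi]

end Iso

end AbstractPolytope

/-! ### Rotations of chiral polytopes -/

namespace AbstractPolytope

section Rotation

variable {n : ℕ} {P : AbstractPolytope.{u} n}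

lemma smul_flag_def (γ : P.Aut) (Φ : Flag P.Face) : γ • Φ = Flag.map γ Φ := rfl

lemma smul_adj (γ : P.Aut) (i : ℤ) (Φ : Flag P.Face) : γ • P.adj i Φ = P.adj i (γ • Φ) :=
  map_adj γ i Φ

lemma face_smul (γ : P.Aut) (Φ : Flag P.Face) {i : ℤ} (hi : i ∈ Set.Icc (-1 : ℤ) n) :
    P.face (γ • Φ) i = γ (P.face Φ i) :=
  face_map γ Φ hi

/-- The automorphism group acts freely on the flags. -/
lemma smul_flag_cancel {γ δ : P.Aut} {Φ : Flag P.Face} (h : γ • Φ = δ • Φ) : γ = δ :=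
  iso_ext h

lemma isRotation_iff_smul {Φ : Flag P.Face} {i : ℤ} (h1 : 1 ≤ i) (hn : i < n) {σ : P.Aut} :
    P.IsRotation Φ i σ ↔ σ • Φ = P.adj i (P.adj (i - 1) Φ) := by
  constructor
  · rintro ⟨Ψ, h, h'⟩
    rw [eq_adj_of_flagAdj h', eq_adj_of_flagAdj h]
  · intro h
    exact ⟨P.adj (i - 1) Φ, flagAdj_adj (by omega) (by omega) Φ,
      h ▸ flagAdj_adj (by omega) hn _⟩

lemma face_smul_of_isRotation {Φ : Flag P.Face} {i j : ℤ} (h1 : 1 ≤ i) (hn : i < n) {σ : P.Aut}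
    (hσ : P.IsRotation Φ i σ) (hj : j ∈ Set.Icc (-1 : ℤ) n) (hij : j ≠ i) (hij' : j ≠ i - 1) :
    σ (P.face Φ j) = P.face Φ j := by
  rw [← face_smul σ Φ hj, (isRotation_iff_smul h1 hn).1 hσ, face_adj_of_ne hij,
    face_adj_of_ne hij']

/-- A flag that has the same faces as the base flag except in the ranks `i - 1` and `i` is one of
the flags `σᵢʲΦ` or the `(i - 1)`-adjacent flag of one of them. -/
lemma exists_zpow_smul_of_face_eq {Φ Ψ : Flag P.Face} {i : ℤ} (h1 : 1 ≤ i) (hn : i < n)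
    {σ : P.Aut} (hσ : P.IsRotation Φ i σ)
    (h : ∀ j, j ≠ i → j ≠ i - 1 → P.face Φ j = P.face Ψ j) :
    ∃ m : ℤ, Ψ = σ ^ m • Φ ∨ Ψ = P.adj (i - 1) (σ ^ m • Φ) := by
  have hσ' := (isRotation_iff_smul h1 hn).1 hσ
  have := reflTransGen_adj (P := P) {j | j ≠ i ∧ j ≠ i - 1} (Φ := Φ) (Ψ := Ψ)
    (fun j hj => h j hj.1 hj.2)
  clear h
  induction this with
  | refl => exact ⟨0, Or.inl (by simp)⟩
  | tail _ hXY ih =>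
    obtain ⟨j, -, -, hj, rfl⟩ := hXY
    obtain ⟨m, hm⟩ := ih
    have hj' : j = i ∨ j = i - 1 := by
      by_contra hc
      exact hj (not_or.1 hc)
    rcases hj' with rfl | rfl
    · rcases hm with rfl | rfl
      · refine ⟨m - 1, Or.inr ?_⟩
        have : σ ^ m • Φ = P.adj j (P.adj (j - 1) (σ ^ (m - 1) • Φ)) := by
          rw [← smul_adj, ← smul_adj, ← hσ', smul_smul, ← zpow_add_one, sub_add_cancel]
        rw [this, adj_adj]
      · refine ⟨m + 1, Or.inl ?_⟩
        rw [← smul_adj, ← smul_adj, ← hσ', smul_smul, ← zpow_add_one]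
    · rcases hm with rfl | rfl
      · exact ⟨m, Or.inr rfl⟩
      · exact ⟨m, Or.inl (adj_adj _ _)⟩

end Rotation

variable {P : AbstractPolytope.{u} 4}

lemma IsChiral.smul_ne_smul_adj (hP : P.IsChiral) (Φ : Flag P.Face) {i : ℤ} (h0 : 0 ≤ i)
    (h4 : i < 4) (γ δ : P.Aut) : γ • Φ ≠ δ • P.adj i Φ := by
  intro h
  refine hP.2 i Φ _ (flagAdj_adj h0 h4 Φ) ⟨δ⁻¹ * γ, ?_⟩
  change (δ⁻¹ * γ) • Φ = _
  rw [mul_smul, h, inv_smul_smul]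

lemma IsChiral.exists_smul (hP : P.IsChiral) (Φ Ψ : Flag P.Face) :
    ∃ γ : P.Aut, Ψ = γ • Φ ∨ Ψ = γ • P.adj 1 Φ := by
  let q : Flag P.Face → MulAction.orbitRel.Quotient P.Aut (Flag P.Face) := Quotient.mk _
  have hq : ∀ X Y, q X = q Y → ∃ γ : P.Aut, X = γ • Y := fun X Y h => by
    obtain ⟨γ, hγ⟩ := (MulAction.orbitRel_apply.1 (Quotient.exact h))
    exact ⟨γ, hγ.symm⟩
  have hne : q Φ ≠ q (P.adj 1 Φ) := fun h => by
    obtain ⟨γ, hγ⟩ := hq _ _ h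
    exact hP.smul_ne_smul_adj Φ (i := 1) (by norm_num) (by norm_num) 1 γ (by simpa using hγ)
  obtain ⟨a, b, -, hab⟩ := Nat.card_eq_two_iff.1 hP.1
  have hm : ∀ x, x = a ∨ x = b := fun x => by
    have : x ∈ ({a, b} : Set _) := hab ▸ Set.mem_univ x
    simpa using this
  by_cases h : q Ψ = q Φ
  · obtain ⟨γ, hγ⟩ := hq _ _ h
    exact ⟨γ, Or.inl hγ⟩
  · have : q Ψ = q (P.adj 1 Φ) := by
      rcases hm (q Ψ) with h1 | h1 <;> rcases hm (q Φ) with h2 | h2 <;>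
        rcases hm (q (P.adj 1 Φ)) with h3 | h3 <;> simp_all
    obtain ⟨γ, hγ⟩ := hq _ _ this
    exact ⟨γ, Or.inr hγ⟩

lemma IsChiral.exists_smul_adj (hP : P.IsChiral) (Φ : Flag P.Face) {i : ℤ} (h0 : 0 ≤ i)
    (h4 : i < 4) : ∃ γ : P.Aut, γ • P.adj 1 Φ = P.adj i Φ := by
  obtain ⟨γ, h | h⟩ := hP.exists_smul Φ (P.adj i Φ)
  · exact absurd (by simpa using h.symm) (hP.smul_ne_smul_adj Φ h0 h4 γ 1)
  · exact ⟨γ, h.symm⟩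

open Classical in
/-- The automorphism `τᵢ` that maps the `1`-adjacent flag of the base flag `Φ` of a chiral polytope
to the `i`-adjacent flag of `Φ`. (Where the automorphisms `ρⱼ` mapping `Φ` to its `j`-adjacent flag
exist, this is `ρᵢ * ρ₁`.) -/
noncomputable def tau (Φ : Flag P.Face) (i : ℤ) : P.Aut :=
  if h : ∃ γ : P.Aut, γ • P.adj 1 Φ = P.adj i Φ then h.choose else 1

section Tau

variable (hP : P.IsChiral) (Φ : Flag P.Face)
include hP

lemma IsChiral.tau_smul {i : ℤ} (h0 : 0 ≤ i) (h4 : i < 4) :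
    tau Φ i • P.adj 1 Φ = P.adj i Φ := by
  unfold tau
  rw [dif_pos (hP.exists_smul_adj Φ h0 h4)]
  exact (hP.exists_smul_adj Φ h0 h4).choose_spec

lemma IsChiral.eq_tau {i : ℤ} (h0 : 0 ≤ i) (h4 : i < 4) {γ : P.Aut}
    (h : γ • P.adj 1 Φ = P.adj i Φ) : γ = tau Φ i :=
  smul_flag_cancel (h.trans (hP.tau_smul Φ h0 h4).symm)

lemma IsChiral.tau_one : tau Φ 1 = 1 :=
  (hP.eq_tau Φ (by norm_num) (by norm_num) (one_smul _ _)).symm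

lemma IsChiral.adj_smul {i : ℤ} (h0 : 0 ≤ i) (h4 : i < 4) (γ : P.Aut) :
    P.adj i (γ • Φ) = (γ * tau Φ i) • P.adj 1 Φ := by
  rw [mul_smul, hP.tau_smul Φ h0 h4, smul_adj]

lemma IsChiral.adj_smul_adj {i : ℤ} (h0 : 0 ≤ i) (h4 : i < 4) (γ : P.Aut) :
    P.adj i (γ • P.adj 1 Φ) = (γ * (tau Φ i)⁻¹) • Φ := by
  have h : P.adj 1 Φ = (tau Φ i)⁻¹ • P.adj i Φ :=
    eq_inv_smul_iff.2 (hP.tau_smul Φ h0 h4)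
  rw [h, smul_smul, ← smul_adj, adj_adj]

lemma IsChiral.isRotation_iff {i : ℤ} (h1 : 1 ≤ i) (h4 : i < 4) {σ : P.Aut} :
    P.IsRotation Φ i σ ↔ σ = tau Φ (i - 1) * (tau Φ i)⁻¹ := by
  rw [isRotation_iff_smul h1 h4]
  have : P.adj i (P.adj (i - 1) Φ) = (tau Φ (i - 1) * (tau Φ i)⁻¹) • Φ := by
    rw [← hP.adj_smul_adj Φ (by omega) h4, hP.tau_smul Φ (by omega) (by omega)]
  rw [this]
  exact ⟨smul_flag_cancel, fun h => by rw [h]⟩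

/-- Since the adjacencies of ranks `i` and `j` commute for `i + 1 < j`, the automorphism
`τᵢτⱼ⁻¹` is its own inverse. -/
lemma IsChiral.tau_mul_tau_inv_sq {i j : ℤ} (h0 : 0 ≤ i) (hij : i + 1 < j) (h4 : j < 4) :
    tau Φ i * (tau Φ j)⁻¹ = tau Φ j * (tau Φ i)⁻¹ := by
  refine smul_flag_cancel (Φ := Φ) ?_
  rw [← hP.adj_smul_adj Φ (by omega) h4, ← hP.adj_smul_adj Φ h0 (by omega),
    hP.tau_smul Φ (by omega) (by omega), hP.tau_smul Φ (by omega) (by omega), adj_comm hij]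

/-- Passing from the base flag to its `1`-adjacent flag inverts the elements `τᵢ`. -/
lemma IsChiral.tau_adj_one {i : ℤ} (h0 : 0 ≤ i) (h4 : i < 4) :
    tau (P.adj 1 Φ) i = (tau Φ i)⁻¹ := by
  refine (hP.eq_tau (P.adj 1 Φ) h0 h4 ?_).symm
  have := hP.adj_smul_adj Φ h0 h4 1
  rw [one_smul, one_mul] at this
  rw [adj_adj, this]

/-- An automorphism that fixes the faces of the base flag with ranks in `A` is a product of the
`τᵢ` with `i ∉ A`. -/
lemma IsChiral.mem_of_fixes (A : Set ℤ) (H : Subgroup P.Aut)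
    (hH : ∀ i : ℤ, 0 ≤ i → i < 4 → i ∉ A → tau Φ i ∈ H) {γ : P.Aut}
    (hγ : ∀ i ∈ A, P.face Φ i = P.face (γ • Φ) i) : γ ∈ H := by
  have := reflTransGen_adj A hγ
  have key : ∀ Ψ, Relation.ReflTransGen
      (fun X Y => ∃ i : ℤ, 0 ≤ i ∧ i < (4 : ℕ) ∧ i ∉ A ∧ Y = P.adj i X) Φ Ψ →
      ∃ δ ∈ H, Ψ = δ • Φ ∨ Ψ = δ • P.adj 1 Φ := by
    intro Ψ h
    induction h with
    | refl => exact ⟨1, H.one_mem, Or.inl (by simp)⟩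
    | tail _ hXY ih =>
      obtain ⟨i, h0, h4, hiA, rfl⟩ := hXY
      obtain ⟨δ, hδ, rfl | rfl⟩ := ih
      · exact ⟨_, H.mul_mem hδ (hH i h0 h4 hiA), Or.inr (hP.adj_smul Φ h0 h4 δ)⟩
      · exact ⟨_, H.mul_mem hδ (H.inv_mem (hH i h0 h4 hiA)), Or.inl (hP.adj_smul_adj Φ h0 h4 δ)⟩
  obtain ⟨δ, hδ, h | h⟩ := key _ this
  · rwa [smul_flag_cancel h]
  · exact absurd h (hP.smul_ne_smul_adj Φ (by norm_num) (by norm_num) _ _)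

lemma IsChiral.eq_top_of_tau_mem (H : Subgroup P.Aut)
    (hH : ∀ i : ℤ, 0 ≤ i → i < 4 → tau Φ i ∈ H) : H = ⊤ :=
  (Subgroup.eq_top_iff' H).2 fun _ =>
    hP.mem_of_fixes Φ ∅ H (fun i h0 h4 _ => hH i h0 h4) (by simp)

/-- The intersection condition for the parabolic subgroups of the facet and the vertex-figure. -/
lemma IsChiral.closure_inf_closure_le {σ₁ σ₂ σ₃ : P.Aut} (h1 : P.IsRotation Φ 1 σ₁)
    (h2 : P.IsRotation Φ 2 σ₂) (h3 : P.IsRotation Φ 3 σ₃) :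
    Subgroup.closure {σ₁, σ₂} ⊓ Subgroup.closure {σ₂, σ₃} ≤ Subgroup.zpowers σ₂ := by
  rintro γ ⟨hγ, hγ'⟩
  have fix : ∀ (j : ℤ) (s : Set P.Aut), (∀ g ∈ s, g (P.face Φ j) = P.face Φ j) →
      ∀ g ∈ Subgroup.closure s, g (P.face Φ j) = P.face Φ j := by
    intro j s hs g hg
    have : Subgroup.closure s ≤ MulAction.stabilizer P.Aut (P.face Φ j) :=
      (Subgroup.closure_le _).2 fun g hg => hs g hg
    exact this hg
  have m0 : (0 : ℤ) ∈ Set.Icc (-1 : ℤ) (4 : ℕ) := by constructor <;> norm_num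
  have m3 : (3 : ℤ) ∈ Set.Icc (-1 : ℤ) (4 : ℕ) := by constructor <;> norm_num
  have e3 : γ (P.face Φ 3) = P.face Φ 3 := by
    refine fix 3 _ ?_ γ hγ
    rintro g (rfl | rfl)
    · exact face_smul_of_isRotation (by norm_num) (by norm_num) h1 m3 (by norm_num) (by norm_num)
    · exact face_smul_of_isRotation (by norm_num) (by norm_num) h2 m3 (by norm_num) (by norm_num)
  have e0 : γ (P.face Φ 0) = P.face Φ 0 := by
    refine fix 0 _ ?_ γ hγ'
    rintro g (rfl | rfl)
    · exact face_smul_of_isRotation (by norm_num) (by norm_num) h2 m0 (by norm_num) (by norm_num)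
    · exact face_smul_of_isRotation (by norm_num) (by norm_num) h3 m0 (by norm_num) (by norm_num)
  refine hP.mem_of_fixes Φ {0, 3} _ (fun i hi0 hi4 hi => ?_) ?_
  · have hs : σ₂ = (tau Φ 2)⁻¹ := by
      have := (hP.isRotation_iff Φ (by norm_num) (by norm_num)).1 h2
      norm_num at this
      rw [this, hP.tau_one, one_mul]
    have : i = 1 ∨ i = 2 := by
      have : i ≠ 0 := fun h => hi (Or.inl h)
      have : i ≠ 3 := fun h => hi (Or.inr h)
      omega
    rcases this with rfl | rfl
    · rw [hP.tau_one]; exact Subgroup.one_mem _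
    · rw [← inv_inv (tau Φ 2), ← hs]
      exact Subgroup.inv_mem _ (Subgroup.mem_zpowers σ₂)
  · rintro i (rfl | rfl)
    · rw [face_smul γ Φ m0, e0]
    · rw [face_smul γ Φ m3, e3]

/-- The flags of a chiral polytope, parametrized by the group and the two flag orbits. -/
noncomputable def IsChiral.flagEquiv : P.Aut × Bool ≃ Flag P.Face :=
  Equiv.ofBijective (fun x => x.1 • bif x.2 then P.adj 1 Φ else Φ) (by
    constructor
    · rintro ⟨γ, _ | _⟩ ⟨δ, _ | _⟩ h
      · exact Prod.ext (smul_flag_cancel h) rfl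
      · exact absurd h (hP.smul_ne_smul_adj Φ (by norm_num) (by norm_num) _ _)
      · exact absurd h.symm (hP.smul_ne_smul_adj Φ (by norm_num) (by norm_num) _ _)
      · exact Prod.ext (smul_flag_cancel h) rfl
    · intro Ψ
      obtain ⟨γ, h | h⟩ := hP.exists_smul Φ Ψ
      · exact ⟨(γ, false), h.symm⟩
      · exact ⟨(γ, true), h.symm⟩)

end Tau

/-- A chiral polytope with a base flag is determined by its automorphism group together with the
elements `τᵢ`. -/
theorem IsChiral.exists_iso {Q : AbstractPolytope.{u} 4} (hP : P.IsChiral) (hQ : Q.IsChiral)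
    (Φ : Flag P.Face) (Ψ : Flag Q.Face) (α : P.Aut ≃* Q.Aut)
    (hα : ∀ i : ℤ, 0 ≤ i → i < 4 → α (tau Φ i) = tau Ψ i) :
    ∃ e : P.Face ≃o Q.Face, Flag.map e Φ = Ψ := by
  let β : Flag P.Face ≃ Flag Q.Face := (hP.flagEquiv Φ).symm.trans
    ((Equiv.prodCongr α.toEquiv (Equiv.refl Bool)).trans (hQ.flagEquiv Ψ))
  have h0 : ∀ γ : P.Aut, β (γ • Φ) = α γ • Ψ := by
    intro γ
    have : γ • Φ = hP.flagEquiv Φ (γ, false) := rfl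
    rw [this]
    simp only [β, Equiv.trans_apply, Equiv.symm_apply_apply]
    rfl
  have h1 : ∀ γ : P.Aut, β (γ • P.adj 1 Φ) = α γ • Q.adj 1 Ψ := by
    intro γ
    have : γ • P.adj 1 Φ = hP.flagEquiv Φ (γ, true) := rfl
    rw [this]
    simp only [β, Equiv.trans_apply, Equiv.symm_apply_apply]
    rfl
  obtain ⟨e, he⟩ := exists_iso_of_flagEquiv β (fun i X => by
    by_cases hi : 0 ≤ i ∧ i < 4
    · obtain ⟨γ, rfl | rfl⟩ := hP.exists_smul Φ X
      · rw [hP.adj_smul Φ hi.1 hi.2, h0, h1, hQ.adj_smul Ψ hi.1 hi.2, map_mul, hα i hi.1 hi.2]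
      · rw [hP.adj_smul_adj Φ hi.1 hi.2, h0, h1, hQ.adj_smul_adj Ψ hi.1 hi.2, map_mul, map_inv,
          hα i hi.1 hi.2]
    · have : ¬ (0 ≤ i ∧ i < ((4 : ℕ) : ℤ)) := by simpa using hi
      simp only [adj, dif_neg this])
  refine ⟨e, ?_⟩
  have := h0 1
  rw [one_smul, map_one, one_smul] at this
  rw [he, this]

/-- No automorphism of the group of a chiral polytope inverts all `τᵢ`: it would identify the
polytope based at `Φ` with the polytope based at the `1`-adjacent flag. -/
theorem IsChiral.not_inverts (hP : P.IsChiral) (Φ : Flag P.Face) (α : P.Aut ≃* P.Aut) :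
    ¬ ∀ i : ℤ, 0 ≤ i → i < 4 → α (tau Φ i) = (tau Φ i)⁻¹ := by
  intro h
  obtain ⟨e, he⟩ := hP.exists_iso hP Φ (P.adj 1 Φ) α (fun i h0 h4 => by
    rw [h i h0 h4, hP.tau_adj_one Φ h0 h4])
  exact hP.smul_ne_smul_adj Φ (i := 1) (by norm_num) (by norm_num) e 1 (by rw [one_smul]; exact he)

/-- An isomorphism of chiral polytopes with base flag induces an isomorphism of the automorphism
groups that matches the elements `τᵢ`. -/
theorem IsChiral.exists_mulEquiv {Q : AbstractPolytope.{u} 4} (hP : P.IsChiral) (hQ : Q.IsChiral)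
    {Φ : Flag P.Face} {Ψ : Flag Q.Face} (e : P.Face ≃o Q.Face) (he : Flag.map e Φ = Ψ) :
    ∃ α : P.Aut ≃* Q.Aut, ∀ i : ℤ, 0 ≤ i → i < 4 → α (tau Φ i) = tau Ψ i := by
  let α : P.Aut ≃* Q.Aut :=
    { toFun := fun γ => (e.symm.trans γ).trans e
      invFun := fun γ => (e.trans γ).trans e.symm
      left_inv := fun γ => by ext; simp
      right_inv := fun γ => by ext; simp
      map_mul' := fun γ δ => by ext; simp }
  refine ⟨α, fun i h0 h4 => hQ.eq_tau Ψ h0 h4 ?_⟩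
  have key : ∀ (γ : P.Aut) (X : Flag P.Face), α γ • Flag.map e X = Flag.map e (γ • X) := by
    intro γ X
    refine SetLike.coe_injective ?_
    rw [smul_flag_def, smul_flag_def, Flag.coe_map, Flag.coe_map, Flag.coe_map, Flag.coe_map,
      Set.image_image, Set.image_image]
    simp [α]
  rw [← he, ← map_adj, key, hP.tau_smul Φ h0 h4, map_adj]

/-- The sections of rank 2 of a chiral polytope are polygons, the size being the order of the
rotation. -/
theorem IsChiral.sectionsArePolygons (hP : P.IsChiral) (Φ : Flag P.Face) {i : ℤ} (h1 : 1 ≤ i)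
    (h4 : i < 4) {σ : P.Aut} (hσ : P.IsRotation Φ i σ) :
    P.SectionsArePolygons i (orderOf σ) := by
  have m0 : i - 2 ∈ Set.Icc (-1 : ℤ) (4 : ℕ) := by constructor <;> push_cast <;> omega
  have m1 : i - 1 ∈ Set.Icc (-1 : ℤ) (4 : ℕ) := by constructor <;> push_cast <;> omega
  have m2 : i ∈ Set.Icc (-1 : ℤ) (4 : ℕ) := by constructor <;> push_cast <;> omega
  have m3 : i + 1 ∈ Set.Icc (-1 : ℤ) (4 : ℕ) := by constructor <;> push_cast <;> omega
  have hfix : ∀ (g : Subgroup.zpowers σ) (j : ℤ), j ∈ Set.Icc (-1 : ℤ) (4 : ℕ) → j ≠ i →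
      j ≠ i - 1 → (g : P.Aut) (P.face Φ j) = P.face Φ j := by
    rintro ⟨g, hg⟩ j hj h h'
    have : Subgroup.zpowers σ ≤ MulAction.stabilizer P.Aut (P.face Φ j) :=
      (Subgroup.zpowers_le).2 (face_smul_of_isRotation h1 h4 hσ hj h h')
    exact this hg
  have base : {H : P.Face | P.face Φ (i - 2) < H ∧ H < P.face Φ (i + 1) ∧ P.rank H = i}.ncard
      = orderOf σ := by
    let f : Subgroup.zpowers σ → P.Face := fun g => (g : P.Aut) (P.face Φ i)
    have hf : Function.Injective f := by
      intro g g' hgg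
      -- the quotient of the two elements fixes all faces of `Φ` except possibly one
      have hh : ((g'⁻¹ * g : Subgroup.zpowers σ) : P.Aut) (P.face Φ i) = P.face Φ i := by
        have : (g : P.Aut) (P.face Φ i) = (g' : P.Aut) (P.face Φ i) := hgg
        rw [Subgroup.coe_mul, RelIso.mul_apply, this, ← RelIso.mul_apply, ← Subgroup.coe_mul,
          inv_mul_cancel]
        rfl
      have hall : ∀ j ∈ Set.Icc (-1 : ℤ) (4 : ℕ), j ≠ i - 1 →
          P.face Φ j = P.face (((g'⁻¹ * g : Subgroup.zpowers σ) : P.Aut) • Φ) j := by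
        intro j hj hji
        rw [face_smul _ Φ hj]
        by_cases h : j = i
        · rw [h, hh]
        · rw [hfix _ j hj h hji]
      have : ((g'⁻¹ * g : Subgroup.zpowers σ) : P.Aut) • Φ = (1 : P.Aut) • Φ := by
        by_contra hne
        rw [one_smul] at hne
        have hadj : FlagAdj P.rank (i - 1) Φ
            (((g'⁻¹ * g : Subgroup.zpowers σ) : P.Aut) • Φ) :=
          flagAdj_iff_face.2 ⟨m1, fun h => hne (flag_ext fun j hj => by
            by_cases hji : j = i - 1
            · rw [hji, h]
            · rw [hall j hj hji]), hall⟩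
        exact hP.2 _ _ _ hadj ⟨_, rfl⟩
      have := smul_flag_cancel this
      have h2 : g'⁻¹ * g = 1 := Subtype.ext this
      exact (inv_mul_eq_one.1 h2).symm
    have hr : {H : P.Face | P.face Φ (i - 2) < H ∧ H < P.face Φ (i + 1) ∧ P.rank H = i}
        = Set.range f := by
      ext H
      constructor
      · rintro ⟨l, u, r⟩
        have hc : IsChain (· ≤ ·) (insert H
            {F | F ∈ Φ ∧ (P.rank F ≤ i - 2 ∨ i + 1 ≤ P.rank F)}) := by
          refine IsChain.insert (Φ.chain_le.mono fun F hF => hF.1) ?_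
          rintro F ⟨hF, h | h⟩ -
          · right
            rw [← face_eq hF]
            exact (face_le_face Φ (P.rank_mem F) m0 h).trans l.le
          · left
            rw [← face_eq hF]
            exact u.le.trans (face_le_face Φ m3 (P.rank_mem F) h)
        obtain ⟨Ψ, hΨ⟩ := exists_flag_of_isChain hc
        have hH : P.face Ψ i = H := by
          have := face_eq (hΨ (Set.mem_insert _ _))
          rwa [r] at this
        have hag : ∀ j, j ≠ i → j ≠ i - 1 → P.face Φ j = P.face Ψ j := by
          intro j h h'
          by_cases hj : j ∈ Set.Icc (-1 : ℤ) (4 : ℕ)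
          · have hrj := rank_face Φ hj
            have := face_eq (hΨ (Set.mem_insert_of_mem _
              (show P.face Φ j ∈ {F | F ∈ Φ ∧ (P.rank F ≤ i - 2 ∨ i + 1 ≤ P.rank F)} from
                ⟨face_mem Φ j, by rw [hrj]; omega⟩)))
            rw [hrj] at this
            exact this.symm
          · simp only [face, dif_neg hj]
        obtain ⟨m, hm⟩ := exists_zpow_smul_of_face_eq h1 h4 hσ hag
        refine ⟨⟨σ ^ m, m, rfl⟩, ?_⟩
        change (σ ^ m) (P.face Φ i) = H
        rw [← hH, ← face_smul _ Φ m2]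
        rcases hm with rfl | rfl
        · rfl
        · rw [face_adj_of_ne (by omega)]
      · rintro ⟨g, rfl⟩
        refine ⟨?_, ?_, ?_⟩
        · rw [← hfix g (i - 2) m0 (by omega) (by omega)]
          exact (g : P.Aut).strictMono (face_lt_face Φ m0 m2 (by omega))
        · rw [← hfix g (i + 1) m3 (by omega) (by omega)]
          exact (g : P.Aut).strictMono (face_lt_face Φ m2 m3 (by omega))
        · change P.rank ((g : P.Aut) _) = i
          rw [rank_map, rank_face Φ m2]
    rw [hr, ← Nat.card_coe_set_eq, Nat.card_range_of_injective hf, Nat.card_zpowers]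
  intro F G hFG hF hG
  obtain ⟨Ψ, hFΨ, hGΨ⟩ := exists_flag_of_le hFG.le
  obtain ⟨γ, hγ⟩ : ∃ γ : P.Aut, Ψ = γ • Φ ∨ Ψ = γ • P.adj i Φ := by
    obtain ⟨γ, h | h⟩ := hP.exists_smul Φ Ψ
    · exact ⟨γ, Or.inl h⟩
    · refine ⟨γ * (tau Φ i)⁻¹, Or.inr ?_⟩
      rw [h, ← hP.tau_smul Φ (by omega) h4, smul_smul, inv_mul_cancel_right]
  have hface : ∀ j ∈ Set.Icc (-1 : ℤ) (4 : ℕ), j ≠ i → P.face Ψ j = γ (P.face Φ j) := by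
    intro j hj hji
    rcases hγ with rfl | rfl
    · exact face_smul γ Φ hj
    · rw [face_smul γ _ hj, face_adj_of_ne hji]
  have eF : F = γ (P.face Φ (i - 2)) := by
    rw [← hface _ m0 (by omega), ← hF, face_eq hFΨ]
  have eG : G = γ (P.face Φ (i + 1)) := by
    rw [← hface _ m3 (by omega), ← hG, face_eq hGΨ]
  rw [← base, ← Set.ncard_image_of_injective {H : P.Face | P.face Φ (i - 2) < H ∧
    H < P.face Φ (i + 1) ∧ P.rank H = i} γ.injective]
  congr 1
  ext H
  constructor
  · rintro ⟨l, u, r⟩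
    refine ⟨γ.symm H, ⟨?_, ?_, ?_⟩, by simp⟩
    · rw [OrderIso.lt_symm_apply, ← eF]; exact l
    · rw [OrderIso.symm_apply_lt, ← eG]; exact u
    · rw [rank_map, r]
  · rintro ⟨H, ⟨l, u, r⟩, rfl⟩
    exact ⟨eF ▸ γ.strictMono l, eG ▸ γ.strictMono u, by rw [rank_map, r]⟩

lemma SectionsArePolygons.unique {i : ℤ} (h1 : 1 ≤ i) (h4 : i < 4) {a b : ℕ} (Φ : Flag P.Face)
    (ha : P.SectionsArePolygons i a) (hb : P.SectionsArePolygons i b) : a = b := by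
  have m0 : i - 2 ∈ Set.Icc (-1 : ℤ) (4 : ℕ) := by constructor <;> push_cast <;> omega
  have m3 : i + 1 ∈ Set.Icc (-1 : ℤ) (4 : ℕ) := by constructor <;> push_cast <;> omega
  have h := face_lt_face Φ m0 m3 (by omega)
  rw [← ha _ _ h (rank_face Φ m0) (rank_face Φ m3), hb _ _ h (rank_face Φ m0) (rank_face Φ m3)]

end AbstractPolytope

/-! ### Polytopes from flag systems -/

/-- `u` and `v` are joined by a path of steps `w ↦ r i w` with `0 ≤ i < n` and `i ∈ J`. -/
def AdjConn {Ω : Type u} (n : ℕ) (r : ℤ → Ω → Ω) (J : Set ℤ) : Ω → Ω → Prop :=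
  Relation.ReflTransGen fun u v => ∃ i : ℤ, 0 ≤ i ∧ i < n ∧ i ∈ J ∧ v = r i u

/-- The combinatorial structure of the set of flags of a polytope of rank `n`: involutions `r i`
without fixed points for `0 ≤ i < n` (passing to the `i`-adjacent flag), such that `r i` and `r j`
commute for `|i - j| ≥ 2`, subject to the intersection property. -/
structure FlagSystem (n : ℕ) (Ω : Type u) where
  /-- passing to the `i`-adjacent flag; only the values for `0 ≤ i < n` matter -/
  r : ℤ → Ω → Ω
  r_r : ∀ (i : ℤ) (u : Ω), 0 ≤ i → i < n → r i (r i u) = u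
  r_comm : ∀ (i j : ℤ) (u : Ω), 0 ≤ i → i + 1 < j → j < n → r i (r j u) = r j (r i u)
  r_ne : ∀ (i : ℤ) (u : Ω), 0 ≤ i → i < n → r i u ≠ u
  inter : ∀ (A : Set ℤ) (u v : Ω), (∀ a ∈ A, AdjConn n r {a}ᶜ u v) → AdjConn n r Aᶜ u v

namespace AdjConn

variable {Ω : Type u} {n : ℕ} {r : ℤ → Ω → Ω} {J J' : Set ℤ} {u v w : Ω}

lemma refl (J : Set ℤ) (u : Ω) : AdjConn n r J u u := Relation.ReflTransGen.refl

lemma trans (h : AdjConn n r J u v) (h' : AdjConn n r J v w) : AdjConn n r J u w :=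
  Relation.ReflTransGen.trans h h'

lemma mono (hJ : J ⊆ J') (h : AdjConn n r J u v) : AdjConn n r J' u v :=
  Relation.ReflTransGen.mono (fun _ _ ⟨i, h0, h1, hi, h⟩ => ⟨i, h0, h1, hJ hi, h⟩) _ _ h

lemma single {i : ℤ} (h0 : 0 ≤ i) (hn : i < n) (hi : i ∈ J) (u : Ω) : AdjConn n r J u (r i u) :=
  Relation.ReflTransGen.single ⟨i, h0, hn, hi, rfl⟩

lemma symm (hr : ∀ (i : ℤ) (u : Ω), 0 ≤ i → i < n → r i (r i u) = u) (h : AdjConn n r J u v) :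
    AdjConn n r J v u := by
  induction h with
  | refl => exact .refl _ _
  | @tail x _ _ hs ih =>
    obtain ⟨i, h0, hn, hi, rfl⟩ := hs
    refine AdjConn.trans ?_ ih
    have := AdjConn.single (r := r) h0 hn hi (r i x)
    rwa [hr i _ h0 hn] at this

/-- A path avoiding `b` can be reordered so that the steps above `b` come before those below. -/
lemma factor (hc : ∀ (i j : ℤ) (u : Ω), 0 ≤ i → i + 1 < j → j < n → r i (r j u) = r j (r i u))
    {b : ℤ} (h : AdjConn n r {b}ᶜ u v) :
    ∃ w, AdjConn n r (Set.Ioi b) u w ∧ AdjConn n r (Set.Iio b) w v := by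
  have step : ∀ (j : ℤ) (x y : Ω), 0 ≤ j → j < n → b < j → AdjConn n r (Set.Iio b) x y →
      AdjConn n r (Set.Iio b) (r j x) (r j y) := by
    intro j x y h0 hn hj h
    induction h with
    | refl => exact .refl _ _
    | tail _ hs ih =>
      obtain ⟨i, i0, _, hi, rfl⟩ := hs
      have hi' : i < b := hi
      refine ih.trans ?_
      rw [← hc i j _ i0 (by omega) hn]
      exact AdjConn.single i0 (by omega) hi _
  induction h with
  | refl => exact ⟨u, .refl _ _, .refl _ _⟩
  | tail _ hs ih =>
    obtain ⟨j, h0, hn, hj, rfl⟩ := hs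
    obtain ⟨w, h1, h2⟩ := ih
    rcases lt_or_gt_of_ne (show j ≠ b from hj) with h | h
    · exact ⟨w, h1, h2.trans (AdjConn.single h0 hn h _)⟩
    · exact ⟨r j w, h1.trans (AdjConn.single h0 hn h _), step j _ _ h0 hn h h2⟩

end AdjConn

namespace FlagSystem

variable {Ω : Type u} {n : ℕ} (S : FlagSystem n Ω) {J : Set ℤ} {u v w : Ω}

lemma conn_symm (h : AdjConn n S.r J u v) : AdjConn n S.r J v u :=
  h.symm S.r_r

/-- The equivalence relation whose classes are the faces of rank `a`: the flags in a class are
joined by adjacencies of ranks other than `a`. -/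
def setoid (a : ℤ) : Setoid Ω where
  r := AdjConn n S.r {a}ᶜ
  iseqv := ⟨fun _ => .refl _ _, fun h => S.conn_symm h, fun h h' => h.trans h'⟩

/-- The faces of the polytope of a flag system: a rank and a class of flags. -/
def Face : Type u := Σ a : Set.Icc (-1 : ℤ) n, Quotient (S.setoid a)

/-- The face of rank `a` of a flag. -/
def faceAt (u : Ω) (a : Set.Icc (-1 : ℤ) n) : S.Face := ⟨a, Quotient.mk _ u⟩

lemma faceAt_eq_iff {a b : Set.Icc (-1 : ℤ) n} :
    S.faceAt u a = S.faceAt v b ↔ a = b ∧ AdjConn n S.r {(a : ℤ)}ᶜ u v := by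
  constructor
  · intro h
    obtain rfl : a = b := congrArg Sigma.fst h
    refine ⟨rfl, ?_⟩
    have := eq_of_heq (Sigma.ext_iff.1 h).2
    exact (Quotient.exact (s := S.setoid a) this :)
  · rintro ⟨rfl, h⟩
    exact Sigma.ext rfl (heq_of_eq (Quotient.sound (s := S.setoid a) h))

lemma exists_faceAt (F : S.Face) : ∃ u, F = S.faceAt u F.1 := by
  obtain ⟨a, c⟩ := F
  obtain ⟨u, rfl⟩ := Quotient.exists_rep c
  exact ⟨u, rfl⟩

/-- Incidence: two faces are incident if they belong to a common flag. -/
instance : LE S.Face where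
  le F G := F.1 ≤ G.1 ∧ ∃ u, F = S.faceAt u F.1 ∧ G = S.faceAt u G.1

lemma faceAt_le {a b : Set.Icc (-1 : ℤ) n} (h : a ≤ b) (u : Ω) : S.faceAt u a ≤ S.faceAt u b :=
  ⟨h, u, rfl, rfl⟩

/-- If the flags `u` and `v` share the face of rank `b`, then some flag agrees with `u` up to
rank `b` and with `v` from rank `b` on. -/
lemma exists_common {b : Set.Icc (-1 : ℤ) n} (h : S.faceAt u b = S.faceAt v b) :
    ∃ w, (∀ a ≤ b, S.faceAt w a = S.faceAt u a) ∧ ∀ a ≥ b, S.faceAt w a = S.faceAt v a := by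
  obtain ⟨w, h1, h2⟩ := (S.faceAt_eq_iff.1 h).2.factor S.r_comm
  refine ⟨w, fun a ha => S.faceAt_eq_iff.2 ⟨rfl, S.conn_symm (h1.mono fun x hx => ?_)⟩,
    fun a ha => S.faceAt_eq_iff.2 ⟨rfl, h2.mono fun x hx => ?_⟩⟩
  · have : (a : ℤ) ≤ b := ha
    have : (b : ℤ) < x := hx
    exact fun h => by have : x = a := h; omega
  · have : (b : ℤ) ≤ a := ha
    have : x < (b : ℤ) := hx
    exact fun h => by have : x = a := h; omega

lemma exists_common₃ {F G H : S.Face} (h : F ≤ G) (h' : G ≤ H) :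
    ∃ w, F = S.faceAt w F.1 ∧ G = S.faceAt w G.1 ∧ H = S.faceAt w H.1 := by
  obtain ⟨h1, u, hF, hG⟩ := h
  obtain ⟨h2, v, hG', hH⟩ := h'
  obtain ⟨w, hu, hv⟩ := S.exists_common (hG.symm.trans hG')
  exact ⟨w, by rw [hu _ h1, ← hF], by rw [hu _ le_rfl, ← hG], by rw [hv _ h2, ← hH]⟩

instance : PartialOrder S.Face where
  le_refl F := by
    obtain ⟨u, hu⟩ := S.exists_faceAt F
    exact ⟨le_rfl, u, hu, hu⟩
  le_trans F G H h h' := by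
    obtain ⟨w, hF, -, hH⟩ := S.exists_common₃ h h'
    exact ⟨h.1.trans h'.1, w, hF, hH⟩
  le_antisymm F G h h' := by
    obtain ⟨u, hF, hG⟩ := h.2
    rw [hF, hG, le_antisymm h.1 h'.1]

lemma conn_compl_of_notMem {a : ℤ} (ha : ¬ (0 ≤ a ∧ a < n)) (u v : Ω) :
    AdjConn n S.r {a}ᶜ u v := by
  have h := S.inter ∅ u v (by simp)
  refine Relation.ReflTransGen.mono ?_ _ _ h
  rintro x y ⟨i, h0, hn, -, rfl⟩
  refine ⟨i, h0, hn, ?_, rfl⟩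
  rintro rfl
  exact ha ⟨h0, hn⟩

noncomputable instance [Nonempty Ω] : BoundedOrder S.Face where
  bot := S.faceAt (Classical.arbitrary Ω) ⟨-1, by constructor <;> omega⟩
  top := S.faceAt (Classical.arbitrary Ω) ⟨n, by constructor <;> omega⟩
  bot_le F := by
    obtain ⟨u, hu⟩ := S.exists_faceAt F
    exact ⟨F.1.2.1, u, S.faceAt_eq_iff.2 ⟨rfl, S.conn_compl_of_notMem (by simp) _ _⟩, hu⟩
  le_top F := by
    obtain ⟨u, hu⟩ := S.exists_faceAt F
    exact ⟨F.1.2.2, u, hu, S.faceAt_eq_iff.2 ⟨rfl, S.conn_compl_of_notMem (by simp) _ _⟩⟩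

/-- The faces of a chain lie in a common flag. -/
lemma exists_flag_of_chain [Nonempty Ω] {c : Set S.Face} (hc : IsChain (· ≤ ·) c)
    (htop : ⊤ ∈ c) : ∃ u, ∀ F ∈ c, F = S.faceAt u F.1 := by
  -- by induction on the rank of `F`, using the predecessor of `F` in the chain
  have key : ∀ (k : ℕ) (F : S.Face), F ∈ c → (F.1 : ℤ) < k →
      ∃ u, ∀ G ∈ c, G ≤ F → G = S.faceAt u G.1 := by
    intro k
    induction k with
    | zero =>
      intro F _ hF
      obtain ⟨u, hu⟩ := S.exists_faceAt F
      refine ⟨u, fun G _ hGF => ?_⟩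
      have h1 := hGF.1
      have h2 : G.1 = F.1 := le_antisymm h1 (Subtype.coe_le_coe.1 (by
        have := G.1.2.1; push_cast at hF; omega))
      have : G = F := by
        obtain ⟨x, hx, hx'⟩ := hGF.2
        rw [hx, hx', h2]
      rw [this]; exact hu
    | succ k ih =>
      intro F hFc hF
      by_cases hex : ∃ G ∈ c, G < F
      · have hfin : ((fun G : S.Face => G.1) '' {G | G ∈ c ∧ G < F}).Finite :=
          Set.toFinite _
        obtain ⟨_, ⟨G, ⟨hGc, hGF⟩, rfl⟩, hmax⟩ := hfin.exists_maximal
          (by obtain ⟨G, h⟩ := hex; exact ⟨G.1, G, h, rfl⟩)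
        have hlt : (G.1 : ℤ) < F.1 := by
          refine lt_of_le_of_ne hGF.le.1 fun h => hGF.ne ?_
          obtain ⟨x, hx, hx'⟩ := hGF.le.2
          rw [hx, hx', Subtype.ext h]
        obtain ⟨u, hu⟩ := ih G hGc (by push_cast at hF; omega)
        obtain ⟨-, v, hGv, hFv⟩ := hGF.le
        obtain ⟨w, hwu, hwv⟩ := S.exists_common ((hu G hGc le_rfl).symm.trans hGv)
        refine ⟨w, fun H hHc hHF => ?_⟩
        rcases eq_or_lt_of_le hHF with rfl | hlt'
        · rw [hwv _ hGF.le.1]; exact hFv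
        · have hHG : H ≤ G := by
            rcases hc.total hHc hGc with h | h
            · exact h
            · have h1 : H.1 = G.1 := le_antisymm (hmax ⟨H, ⟨hHc, hlt'⟩, rfl⟩ h.1) h.1
              refine le_of_eq ?_
              obtain ⟨x, hx, hx'⟩ := h.2
              rw [hx, hx', h1]
          rw [hwu _ hHG.1]; exact hu H hHc hHG
      · obtain ⟨u, hu⟩ := S.exists_faceAt F
        refine ⟨u, fun G hGc hGF => ?_⟩
        rcases eq_or_lt_of_le hGF with rfl | h
        · exact hu
        · exact absurd ⟨G, hGc, h⟩ hex
  obtain ⟨u, hu⟩ := key (n + 1) ⊤ htop (by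
    have := (⊤ : S.Face).1.2.2
    push_cast
    omega)
  exact ⟨u, fun F hF => hu F hF le_top⟩

lemma rank_strictMono : StrictMono fun F : S.Face => (F.1 : ℤ) := by
  intro F G h
  refine lt_of_le_of_ne h.le.1 fun h' => h.ne ?_
  obtain ⟨x, hx, hx'⟩ := h.le.2
  rw [hx, hx', Subtype.ext h']

/-- The flag of the polytope that belongs to an element of a flag system. -/
def flagOf (u : Ω) : Flag S.Face :=
  Flag.ofIsMaxChain (Set.range (S.faceAt u)) (by
    constructor
    · rintro _ ⟨a, rfl⟩ _ ⟨b, rfl⟩ -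
      rcases le_total a b with h | h
      · exact Or.inl (S.faceAt_le h u)
      · exact Or.inr (S.faceAt_le h u)
    · intro t ht h
      refine h.antisymm fun F hF => ⟨F.1, ?_⟩
      by_contra hne
      rcases ht (h ⟨F.1, rfl⟩ : S.faceAt u F.1 ∈ t) hF hne with h' | h'
      · have h3 : S.faceAt u F.1 < F := lt_of_le_of_ne h' hne
        exact absurd (S.rank_strictMono h3) (lt_irrefl (F.1 : ℤ))
      · have h3 : F < S.faceAt u F.1 := lt_of_le_of_ne h' (Ne.symm hne)
        exact absurd (S.rank_strictMono h3) (lt_irrefl (F.1 : ℤ)))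

lemma mem_flagOf {F : S.Face} : F ∈ S.flagOf u ↔ F = S.faceAt u F.1 := by
  constructor
  · rintro ⟨a, rfl⟩
    rfl
  · intro h
    exact ⟨F.1, h.symm⟩

lemma flagOf_surjective [Nonempty Ω] : Function.Surjective S.flagOf := by
  intro Φ
  obtain ⟨u, hu⟩ := S.exists_flag_of_chain Φ.chain_le Φ.top_mem
  refine ⟨u, SetLike.coe_injective (Φ.max_chain' (S.flagOf u).chain_le fun F hF => ?_).symm⟩
  exact S.mem_flagOf.2 (hu F hF)

lemma flagOf_injective : Function.Injective S.flagOf := by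
  intro u v h
  have := S.inter Set.univ u v fun a _ => by
    by_cases ha : 0 ≤ a ∧ a < n
    · have hm : S.faceAt u ⟨a, by constructor <;> omega⟩ ∈ S.flagOf v :=
        h ▸ (S.mem_flagOf.2 rfl : S.faceAt u ⟨a, by constructor <;> omega⟩ ∈ S.flagOf u)
      exact (S.faceAt_eq_iff.1 (S.mem_flagOf.1 hm)).2
    · exact S.conn_compl_of_notMem ha u v
  rw [Set.compl_univ] at this
  induction this with
  | refl => rfl
  | tail _ hs _ =>
    obtain ⟨i, -, -, hi, -⟩ := hs
    exact absurd hi (Set.notMem_empty i)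

lemma faceAt_r_of_ne {i : ℤ} (h0 : 0 ≤ i) (hn : i < n) {a : Set.Icc (-1 : ℤ) n}
    (h : (a : ℤ) ≠ i) (u : Ω) : S.faceAt (S.r i u) a = S.faceAt u a :=
  S.faceAt_eq_iff.2 ⟨rfl, S.conn_symm (AdjConn.single h0 hn
    (show i ∈ ({(a : ℤ)}ᶜ : Set ℤ) from fun h' => h (Eq.symm h')) u)⟩

lemma faceAt_r_ne {i : ℤ} (h0 : 0 ≤ i) (hn : i < n) (u : Ω) :
    S.faceAt (S.r i u) ⟨i, by constructor <;> omega⟩ ≠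
      S.faceAt u ⟨i, by constructor <;> omega⟩ := by
  intro h
  refine S.r_ne i u h0 hn (S.flagOf_injective (SetLike.ext fun F => ?_))
  rw [mem_flagOf, mem_flagOf]
  by_cases hF : (F.1 : ℤ) = i
  · have : F.1 = ⟨i, by constructor <;> omega⟩ := Subtype.ext hF
    rw [this, h]
  · rw [S.faceAt_r_of_ne h0 hn hF]

lemma flagAdj_flagOf {i : ℤ} (h0 : 0 ≤ i) (hn : i < n) (u : Ω) :
    FlagAdj (fun F : S.Face => (F.1 : ℤ)) i (S.flagOf u) (S.flagOf (S.r i u)) := by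
  refine ⟨fun h => S.r_ne i u h0 hn (S.flagOf_injective h.symm), fun F hF => ?_⟩
  rw [mem_flagOf, mem_flagOf, S.faceAt_r_of_ne h0 hn hF]

/-- The polytope of a flag system. -/
noncomputable def polytope [Nonempty Ω] : AbstractPolytope.{u} n where
  Face := S.Face
  rank F := F.1
  rank_strictMono := S.rank_strictMono
  rank_mem F := F.1.2
  flag_rank Φ i hi := by
    obtain ⟨u, rfl⟩ := S.flagOf_surjective Φ
    refine ⟨S.faceAt u ⟨i, hi⟩, ⟨S.mem_flagOf.2 rfl, rfl⟩, ?_⟩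
    rintro F ⟨hF, rfl⟩
    exact S.mem_flagOf.1 hF
  strongly_connected Φ Ψ := by
    obtain ⟨u, rfl⟩ := S.flagOf_surjective Φ
    obtain ⟨v, rfl⟩ := S.flagOf_surjective Ψ
    let A : Set ℤ := {a | AdjConn n S.r {a}ᶜ u v}
    have h := S.inter A u v fun a ha => ha
    have key : ∀ w, AdjConn n S.r Aᶜ u w → Relation.ReflTransGen
        (fun X Y : Flag S.Face => (∃ i, FlagAdj (fun F : S.Face => (F.1 : ℤ)) i X Y) ∧
          ∀ F, F ∈ S.flagOf u → F ∈ S.flagOf v → F ∈ Y) (S.flagOf u) (S.flagOf w) := by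
      intro w hw
      induction hw with
      | refl => exact .refl
      | @tail x y hx hs ih =>
        obtain ⟨i, h0, hn, hi, rfl⟩ := hs
        refine ih.tail ⟨⟨i, S.flagAdj_flagOf h0 hn x⟩, fun F hF hF' => ?_⟩
        rw [mem_flagOf] at hF hF' ⊢
        have hFA : (F.1 : ℤ) ∈ A := (S.faceAt_eq_iff.1 (hF.symm.trans hF')).2
        have hux : AdjConn n S.r Aᶜ u (S.r i x) :=
          AdjConn.trans hx (AdjConn.single h0 hn hi x)
        rw [hF]
        exact S.faceAt_eq_iff.2 ⟨rfl, hux.mono (Set.compl_subset_compl.2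
          (Set.singleton_subset_iff.2 hFA))⟩
    exact key v h
  diamond J K hJK hr := by
    obtain ⟨b, hb⟩ : ∃ b : ℤ, b = (K.1 : ℤ) - 1 := ⟨_, rfl⟩
    have hJ1 := J.1.2.1
    have hK2 := K.1.2.2
    change (J.1 : ℤ) = K.1 - 2 at hr
    have h0 : 0 ≤ b := by omega
    have hn : b < n := by omega
    obtain ⟨hle, u, hJ, hK⟩ := hJK.le
    have m : b ∈ Set.Icc (-1 : ℤ) n := by constructor <;> omega
    have hne := S.faceAt_r_ne h0 hn u
    rw [Set.ncard_eq_two]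
    refine ⟨S.faceAt u ⟨b, m⟩, S.faceAt (S.r b u) ⟨b, m⟩, hne.symm, ?_⟩
    have hbetween : ∀ x, J = S.faceAt x J.1 → K = S.faceAt x K.1 →
        J < S.faceAt x ⟨b, m⟩ ∧ S.faceAt x ⟨b, m⟩ < K := by
      intro x hx hx'
      constructor
      · refine lt_of_le_of_ne ?_ fun h => ?_
        · rw [hx]
          exact S.faceAt_le (Subtype.coe_le_coe.1 (by change (J.1 : ℤ) ≤ b; omega)) x
        · have : (J.1 : ℤ) = b := congrArg (fun F : S.Face => (F.1 : ℤ)) h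
          omega
      · refine lt_of_le_of_ne ?_ fun h => ?_
        · rw [hx']
          exact S.faceAt_le (Subtype.coe_le_coe.1 (by change b ≤ (K.1 : ℤ); omega)) x
        · have : b = (K.1 : ℤ) := congrArg (fun F : S.Face => (F.1 : ℤ)) h
          omega
    ext I
    constructor
    · rintro ⟨hJI, hIK, hI⟩
      obtain ⟨v, hJv, hIv, hKv⟩ := S.exists_common₃ hJI.le hIK.le
      have hI1 : I.1 = ⟨b, m⟩ := Subtype.ext (hI.trans hb.symm)
      have hc := S.inter {b - 1, b + 1} u v (by
        rintro a (rfl | rfl)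
        · have := (S.faceAt_eq_iff.1 (hJ.symm.trans hJv)).2
          rwa [show (J.1 : ℤ) = b - 1 by omega] at this
        · have := (S.faceAt_eq_iff.1 (hK.symm.trans hKv)).2
          rwa [show (K.1 : ℤ) = b + 1 by omega] at this)
      -- all steps of the path other than `r b` commute with `r b` and keep the face of rank `b`
      have key : ∀ w, AdjConn n S.r {b - 1, b + 1}ᶜ u w →
          AdjConn n S.r {b - 1, b, b + 1}ᶜ u w ∨
            AdjConn n S.r {b - 1, b, b + 1}ᶜ (S.r b u) w := by
        have comm : ∀ x y, AdjConn n S.r {b - 1, b, b + 1}ᶜ x y →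
            AdjConn n S.r {b - 1, b, b + 1}ᶜ (S.r b x) (S.r b y) := by
          intro x y h
          induction h with
          | refl => exact .refl _ _
          | tail _ hs ih =>
            obtain ⟨i, i0, i1, hi, rfl⟩ := hs
            have hi' : i ≠ b - 1 ∧ i ≠ b ∧ i ≠ b + 1 := by
              simpa [not_or] using hi
            refine AdjConn.trans ih ?_
            rcases lt_or_gt_of_ne hi'.2.1 with h | h
            · rw [← S.r_comm i b _ i0 (by omega) hn]
              exact AdjConn.single i0 i1 hi _
            · rw [S.r_comm b i _ h0 (by omega) i1]
              exact AdjConn.single i0 i1 hi _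
        intro w hw
        induction hw with
        | refl => exact Or.inl (.refl _ _)
        | tail _ hs ih =>
          obtain ⟨i, i0, i1, hi, rfl⟩ := hs
          by_cases hib : i = b
          · subst hib
            rcases ih with h | h
            · exact Or.inr (comm _ _ h)
            · have := comm _ _ h
              rw [S.r_r i u i0 i1] at this
              exact Or.inl this
          · have hi' : i ∈ ({b - 1, b, b + 1}ᶜ : Set ℤ) := by
              simp only [Set.mem_compl_iff, Set.mem_insert_iff, Set.mem_singleton_iff,
                not_or] at hi ⊢
              exact ⟨hi.1, hib, hi.2⟩
            rcases ih with h | h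
            · exact Or.inl (h.trans (AdjConn.single i0 i1 hi' _))
            · exact Or.inr (h.trans (AdjConn.single i0 i1 hi' _))
      have hsub : ({b - 1, b, b + 1}ᶜ : Set ℤ) ⊆ {b}ᶜ := by
        intro x hx
        simp only [Set.mem_compl_iff, Set.mem_insert_iff, Set.mem_singleton_iff, not_or] at hx ⊢
        exact hx.2.1
      rw [hI1] at hIv
      rcases key v hc with h | h
      · exact Or.inl (hIv.trans (S.faceAt_eq_iff.2 ⟨rfl, S.conn_symm (h.mono hsub)⟩))
      · exact Or.inr (hIv.trans (S.faceAt_eq_iff.2 ⟨rfl, S.conn_symm (h.mono hsub)⟩))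
    · rintro (rfl | rfl)
      · obtain ⟨h1, h2⟩ := hbetween u hJ hK
        exact ⟨h1, h2, hb⟩
      · obtain ⟨h1, h2⟩ := hbetween (S.r b u)
          (by rw [S.faceAt_r_of_ne h0 hn (by omega)]; exact hJ)
          (by rw [S.faceAt_r_of_ne h0 hn (by omega)]; exact hK)
        exact ⟨h1, h2, hb⟩

end FlagSystem

/-! ### The intersection property in rank 4 -/

/-- In rank 4 the intersection property follows from three of its instances. The reason is that a
path without steps of rank `1` (or `2`) can be reordered so that the steps of rank `0` (or `3`) are
separated from the others; hence two conditions on `u` and `v` can be combined one at a time. -/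
theorem AdjConn.inter_of_rank_four {Ω : Type u} {r : ℤ → Ω → Ω}
    (hr : ∀ (i : ℤ) (u : Ω), 0 ≤ i → i < (4 : ℕ) → r i (r i u) = u)
    (hc : ∀ (i j : ℤ) (u : Ω), 0 ≤ i → i + 1 < j → j < (4 : ℕ) → r i (r j u) = r j (r i u))
    (hconn : ∀ u v, AdjConn 4 r {0, 1, 2, 3} u v)
    (h01 : ∀ u, r 0 u ≠ r 1 u) (h12 : ∀ u, r 1 u ≠ r 2 u) (h23 : ∀ u, r 2 u ≠ r 3 u)
    (hne : ∀ (i : ℤ) (u : Ω), 0 ≤ i → i < (4 : ℕ) → r i u ≠ u)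
    (ha : ∀ u v, AdjConn 4 r {0, 1, 2} u v → AdjConn 4 r {1, 2, 3} u v → AdjConn 4 r {1, 2} u v)
    (hb : ∀ u v, AdjConn 4 r {0, 1} u v → AdjConn 4 r {1, 2} u v → AdjConn 4 r {1} u v)
    (hd : ∀ u v, AdjConn 4 r {1, 2} u v → AdjConn 4 r {2, 3} u v → AdjConn 4 r {2} u v)
    (A : Set ℤ) (u v : Ω) (h : ∀ a ∈ A, AdjConn 4 r {a}ᶜ u v) : AdjConn 4 r Aᶜ u v := by
  have symm : ∀ {J u v}, AdjConn 4 r J u v → AdjConn 4 r J v u := fun h => h.symm hr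
  have sub : ∀ {J J' : Set ℤ} {u v}, (∀ i : ℤ, 0 ≤ i → i < 4 → i ∈ J → i ∈ J') →
      AdjConn 4 r J u v → AdjConn 4 r J' u v := fun hJ h => by
    refine Relation.ReflTransGen.mono ?_ _ _ h
    rintro x y ⟨i, h0, h4, hi, rfl⟩
    exact ⟨i, h0, h4, hJ i h0 h4 hi, rfl⟩
  have single : ∀ {i : ℤ} {u v}, AdjConn 4 r {i} u v → v = u ∨ v = r i u := by
    intro i u v h
    induction h with
    | refl => exact Or.inl rfl
    | tail _ hs ih =>
      obtain ⟨j, h0, h4, rfl, rfl⟩ := hs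
      rcases ih with rfl | rfl
      · exact Or.inr rfl
      · exact Or.inl (hr _ _ h0 h4)
  have n3 : ∀ u, ¬ AdjConn 4 r {0, 1, 2} u (r 3 u) := by
    intro u h
    have s3 : ∀ {J : Set ℤ}, 3 ∈ J → AdjConn 4 r J u (r 3 u) := fun h =>
      AdjConn.single (by norm_num) (by norm_num) h u
    rcases single (hd _ _ (ha _ _ h (s3 (by simp))) (s3 (by simp))) with h | h
    · exact hne 3 u (by norm_num) (by norm_num) h
    · exact h23 u h.symm
  have n0 : ∀ u, ¬ AdjConn 4 r {1, 2, 3} u (r 0 u) := by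
    intro u h
    have s0 : ∀ {J : Set ℤ}, 0 ∈ J → AdjConn 4 r J u (r 0 u) := fun h =>
      AdjConn.single (by norm_num) (by norm_num) h u
    rcases single (hb _ _ (s0 (by simp)) (ha _ _ (s0 (by simp)) h)) with h | h
    · exact hne 0 u (by norm_num) (by norm_num) h
    · exact h01 u h
  have f2 : ∀ {u v}, AdjConn 4 r {0, 1, 3} u v →
      ∃ w, AdjConn 4 r {3} u w ∧ AdjConn 4 r {0, 1} w v := by
    intro u v h
    obtain ⟨w, h1, h2⟩ := (sub (J' := {2}ᶜ) (by simp; omega) h).factor hc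
    exact ⟨w, sub (by simp; omega) h1, sub (by simp; omega) h2⟩
  have f1 : ∀ {u v}, AdjConn 4 r {0, 2, 3} u v →
      ∃ w, AdjConn 4 r {2, 3} u w ∧ AdjConn 4 r {0} w v := by
    intro u v h
    obtain ⟨w, h1, h2⟩ := (sub (J' := {1}ᶜ) (by simp; omega) h).factor hc
    exact ⟨w, sub (by simp; omega) h1, sub (by simp; omega) h2⟩
  -- intersections of two maximal parabolics
  have p23 : AdjConn 4 r {0, 1, 3} u v → AdjConn 4 r {0, 1, 2} u v → AdjConn 4 r {0, 1} u v := by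
    intro h2 h3
    obtain ⟨w, g1, g2⟩ := f2 h2
    rcases single g1 with rfl | rfl
    · exact g2
    · exact absurd (h3.trans (symm (g2.mono (by simp)))) (n3 u)
  have p01 : AdjConn 4 r {1, 2, 3} u v → AdjConn 4 r {0, 2, 3} u v → AdjConn 4 r {2, 3} u v := by
    intro h0 h1
    obtain ⟨w, g1, g2⟩ := f1 h1
    rcases single g2 with rfl | rfl
    · exact g1
    · exact absurd ((symm (g1.mono (by simp))).trans h0) (n0 w)
  have p02 : AdjConn 4 r {1, 2, 3} u v → AdjConn 4 r {0, 1, 3} u v → AdjConn 4 r {1, 3} u v := by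
    intro h0 h2
    obtain ⟨w, g1, g2⟩ := f2 h2
    have k0 := (symm (g1.mono (J' := {1, 2, 3}) (by simp))).trans h0
    have k1 := hb _ _ g2 (ha _ _ (g2.mono (by simp)) k0)
    exact (g1.mono (by simp)).trans (k1.mono (by simp))
  have p13 : AdjConn 4 r {0, 2, 3} u v → AdjConn 4 r {0, 1, 2} u v → AdjConn 4 r {0, 2} u v := by
    intro h1 h3
    obtain ⟨w, g1, g2⟩ := f1 h1
    have k0 := h3.trans (symm (g2.mono (J' := {0, 1, 2}) (by simp)))
    have k1 := hd _ _ (ha _ _ k0 (g1.mono (by simp))) g1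
    exact (k1.mono (by simp)).trans (g2.mono (by simp))
  have p12 : AdjConn 4 r {0, 2, 3} u v → AdjConn 4 r {0, 1, 3} u v →
      ∃ w, AdjConn 4 r {3} u w ∧ AdjConn 4 r {0} w v := by
    intro h1 h2
    obtain ⟨w, g1, g2⟩ := f2 h2
    obtain ⟨w', g1', g2'⟩ := f1 h1
    have k1 : AdjConn 4 r {0, 1} w w' := g2.trans (symm (g2'.mono (by grind)))
    have k2 : AdjConn 4 r {2, 3} w w' := (symm (g1.mono (by simp))).trans g1'
    have k3 := ha _ _ (k1.mono (by simp)) (k2.mono (by simp))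
    have : w' = w := by
      rcases single (hb _ _ k1 k3) with e | e
      · exact e
      · rcases single (hd _ _ k3 k2) with e' | e'
        · exact e'
        · exact absurd (e.symm.trans e') (h12 w)
    exact ⟨w, g1, this ▸ g2'⟩
  have t012 : AdjConn 4 r {1, 2, 3} u v → AdjConn 4 r {0, 2, 3} u v → AdjConn 4 r {0, 1, 3} u v →
      AdjConn 4 r {3} u v := by
    intro h0 h1 h2
    obtain ⟨w, g1, g2⟩ := p12 h1 h2
    rcases single g2 with rfl | rfl
    · exact g1
    · exact absurd ((symm (g1.mono (by simp))).trans h0) (n0 w)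
  have t123 : AdjConn 4 r {0, 2, 3} u v → AdjConn 4 r {0, 1, 3} u v → AdjConn 4 r {0, 1, 2} u v →
      AdjConn 4 r {0} u v := by
    intro h1 h2 h3
    obtain ⟨w, g1, g2⟩ := p12 h1 h2
    rcases single g1 with rfl | rfl
    · exact g2
    · exact absurd (h3.trans (symm (g2.mono (by simp)))) (n3 u)
  have m0 : 0 ∈ A → AdjConn 4 r {1, 2, 3} u v := fun hA => sub (by simp; omega) (h 0 hA)
  have m1 : 1 ∈ A → AdjConn 4 r {0, 2, 3} u v := fun hA => sub (by simp; omega) (h 1 hA)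
  have m2 : 2 ∈ A → AdjConn 4 r {0, 1, 3} u v := fun hA => sub (by simp; omega) (h 2 hA)
  have m3 : 3 ∈ A → AdjConn 4 r {0, 1, 2} u v := fun hA => sub (by simp; omega) (h 3 hA)
  by_cases a0 : 0 ∈ A <;> by_cases a1 : 1 ∈ A <;> by_cases a2 : 2 ∈ A <;> by_cases a3 : 3 ∈ A
  · have e1 := hd _ _ (ha _ _ (m3 a3) (m0 a0)) (p01 (m0 a0) (m1 a1))
    have e2 := hb _ _ (p23 (m2 a2) (m3 a3)) (ha _ _ (m3 a3) (m0 a0))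
    rcases single e1 with rfl | e
    · exact .refl _ _
    · rcases single e2 with rfl | e'
      · exact .refl _ _
      · exact absurd (e'.symm.trans e) (h12 u)
  · exact (t012 (m0 a0) (m1 a1) (m2 a2)).mono (Set.singleton_subset_iff.2 a3)
  · exact (hd _ _ (ha _ _ (m3 a3) (m0 a0)) (p01 (m0 a0) (m1 a1))).mono
      (Set.singleton_subset_iff.2 a2)
  · exact (p01 (m0 a0) (m1 a1)).mono (Set.insert_subset a2 (Set.singleton_subset_iff.2 a3))
  · exact (hb _ _ (p23 (m2 a2) (m3 a3)) (ha _ _ (m3 a3) (m0 a0))).mono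
      (Set.singleton_subset_iff.2 a1)
  · exact (p02 (m0 a0) (m2 a2)).mono (Set.insert_subset a1 (Set.singleton_subset_iff.2 a3))
  · exact (ha _ _ (m3 a3) (m0 a0)).mono (Set.insert_subset a1 (Set.singleton_subset_iff.2 a2))
  · exact (m0 a0).mono (Set.insert_subset a1 (Set.insert_subset a2 (Set.singleton_subset_iff.2 a3)))
  · exact (t123 (m1 a1) (m2 a2) (m3 a3)).mono (Set.singleton_subset_iff.2 a0)
  · obtain ⟨w, g1, g2⟩ := p12 (m1 a1) (m2 a2)
    exact (g1.mono (Set.singleton_subset_iff.2 a3)).trans (g2.mono (Set.singleton_subset_iff.2 a0))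
  · exact (p13 (m1 a1) (m3 a3)).mono (Set.insert_subset a0 (Set.singleton_subset_iff.2 a2))
  · exact (m1 a1).mono (Set.insert_subset a0 (Set.insert_subset a2 (Set.singleton_subset_iff.2 a3)))
  · exact (p23 (m2 a2) (m3 a3)).mono (Set.insert_subset a0 (Set.singleton_subset_iff.2 a1))
  · exact (m2 a2).mono (Set.insert_subset a0 (Set.insert_subset a1 (Set.singleton_subset_iff.2 a3)))
  · exact (m3 a3).mono (Set.insert_subset a0 (Set.insert_subset a1 (Set.singleton_subset_iff.2 a2)))
  · exact (hconn u v).mono (Set.insert_subset a0 (Set.insert_subset a1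
      (Set.insert_subset a2 (Set.singleton_subset_iff.2 a3))))

/-! ### Chiral polytopes from groups -/

/-- The data of a chiral polytope of rank 4 in terms of its group: `x = σ₁`, `y = σ₂` and the
involution `t = σ₂σ₃`, such that the intersection condition holds and no automorphism of the group
inverts the three elements. -/
structure IsChiralTriple {G : Type u} [Group G] (x y t : G) : Prop where
  t_mul_t : t * t = 1
  xy_mul_xy : x * y * (x * y) = 1
  xt_mul_xt : x * t * (x * t) = 1
  x_ne : x ≠ 1
  y_ne : y ≠ 1
  t_ne : t ≠ y
  inf_xy : Subgroup.zpowers x ⊓ Subgroup.zpowers y = ⊥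
  inf_yz : Subgroup.zpowers y ⊓ Subgroup.zpowers (y⁻¹ * t) = ⊥
  /-- the parabolic subgroups `⟨σ₁, σ₂⟩` and `⟨σ₂, σ₃⟩` intersect in `⟨σ₂⟩` -/
  inf_le : Subgroup.closure {x, y} ⊓ Subgroup.closure {y, t} ≤ Subgroup.zpowers y
  closure_eq : Subgroup.closure {x, y, t} = ⊤
  /-- there is no automorphism of the polytope that maps the base flag to its `1`-adjacent flag -/
  not_inverts : ∀ α : G ≃* G, ¬ (α x = x⁻¹ ∧ α y = y⁻¹ ∧ α t = t⁻¹)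

namespace IsChiralTriple

variable {G : Type u} [Group G]

/-- The elements `τᵢ` in terms of `x`, `y` and `t`. -/
def tauOf (x y t : G) (i : ℤ) : G :=
  if i = 0 then x else if i = 2 then y⁻¹ else if i = 3 then t else 1

@[simp] lemma tauOf_zero (x y t : G) : tauOf x y t 0 = x := rfl
@[simp] lemma tauOf_one (x y t : G) : tauOf x y t 1 = 1 := rfl
@[simp] lemma tauOf_two (x y t : G) : tauOf x y t 2 = y⁻¹ := rfl
@[simp] lemma tauOf_three (x y t : G) : tauOf x y t 3 = t := rfl

/-- The adjacencies of the flags `gΦ` (represented by `(g, false)`) and `gΦ¹` (represented by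
`(g, true)`). -/
def step (x y t : G) (i : ℤ) (u : G × Bool) : G × Bool :=
  (u.1 * bif u.2 then (tauOf x y t i)⁻¹ else tauOf x y t i, !u.2)

lemma step_false (x y t : G) (i : ℤ) (g : G) :
    step x y t i (g, false) = (g * tauOf x y t i, true) := rfl

lemma step_true (x y t : G) (i : ℤ) (g : G) :
    step x y t i (g, true) = (g * (tauOf x y t i)⁻¹, false) := rfl

lemma step_step (x y t : G) (i : ℤ) (u : G × Bool) : step x y t i (step x y t i u) = u := by
  rcases u with ⟨g, _ | _⟩
  · rw [step_false, step_true, mul_inv_cancel_right]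
  · rw [step_true, step_false, inv_mul_cancel_right]

lemma step_ne (x y t : G) (i : ℤ) (u : G × Bool) : step x y t i u ≠ u := by
  intro h
  have := congrArg Prod.snd h
  simp [step] at this

variable {x y t : G}

/-- Elements joined by steps with indices in `J` differ by an element of the subgroup generated by
the corresponding `τᵢ`. -/
lemma inv_mul_mem {J : Set ℤ} {H : Subgroup G} (hH : ∀ i : ℤ, 0 ≤ i → i < 4 → i ∈ J →
    tauOf x y t i ∈ H) {u v : G × Bool} (huv : AdjConn 4 (step x y t) J u v) :
    u.1⁻¹ * v.1 ∈ H := by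
  induction huv with
  | refl => rw [inv_mul_cancel]; exact H.one_mem
  | @tail v w _ hs ih =>
    obtain ⟨i, h0, h4, hi, rfl⟩ := hs
    have := hH i h0 h4 hi
    rcases v with ⟨g, _ | _⟩
    · rw [step_false, ← mul_assoc]
      exact H.mul_mem ih this
    · rw [step_true, ← mul_assoc]
      exact H.mul_mem ih (H.inv_mem this)

lemma conn_symm {J : Set ℤ} {u v : G × Bool} (huv : AdjConn 4 (step x y t) J u v) :
    AdjConn 4 (step x y t) J v u :=
  huv.symm fun i u _ _ => step_step x y t i u

lemma conn_snd {J : Set ℤ} (hJ : 1 ∈ J) (g : G) (s s' : Bool) :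
    AdjConn 4 (step x y t) J (g, s) (g, s') := by
  have h1 : AdjConn 4 (step x y t) J (g, false) (g, true) := by
    have := AdjConn.single (r := step x y t) (n := 4) (by norm_num) (by norm_num) hJ (g, false)
    simpa [step_false] using this
  rcases s with _ | _ <;> rcases s' with _ | _
  · exact .refl _ _
  · exact h1
  · exact conn_symm h1
  · exact .refl _ _

/-- For `1 ∈ J` the orbits of the steps with indices in `J` contain the cosets of the subgroup
generated by the corresponding `τᵢ`. -/
lemma conn_of_mem {J : Set ℤ} (hJ : 1 ∈ J) {g : G}
    (hg : g ∈ Subgroup.closure {a | ∃ i ∈ J, 0 ≤ i ∧ i < 4 ∧ a = tauOf x y t i})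
    (a : G) (s s' : Bool) :
    AdjConn 4 (step x y t) J (a, s) (a * g, s') := by
  induction hg using Subgroup.closure_induction generalizing a s s' with
  | mem g hg =>
    obtain ⟨i, hi, h0, h4, rfl⟩ := hg
    have := AdjConn.single (r := step x y t) (n := 4) h0 h4 hi (a, false)
    rw [step_false] at this
    exact (conn_snd hJ a s false).trans (this.trans (conn_snd hJ _ _ _))
  | one => rw [mul_one]; exact conn_snd hJ a s s'
  | mul g g' _ _ ih ih' => rw [← mul_assoc]; exact (ih a s s).trans (ih' _ _ _)
  | inv g _ ih =>
    have := conn_symm (ih (a * g⁻¹) s' s)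
    rwa [inv_mul_cancel_right] at this

lemma conn_one_of_fst_eq {u v : G × Bool} (huv : u.1 = v.1) :
    AdjConn 4 (step x y t) {1} u v := by
  rcases u with ⟨g, s⟩
  rcases v with ⟨g', s'⟩
  obtain rfl : g = g' := huv
  exact conn_snd (Set.mem_singleton 1) g s s'

variable (h : IsChiralTriple x y t)
include h

lemma step_comm (i j : ℤ) (u : G × Bool) (h0 : 0 ≤ i) (hij : i + 1 < j) (hj : j < (4 : ℕ)) :
    step x y t i (step x y t j u) = step x y t j (step x y t i u) := by
  have ht : t⁻¹ = t := inv_eq_of_mul_eq_one_right h.t_mul_t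
  have hxy : y⁻¹ * x⁻¹ = x * y := by
    rw [← mul_inv_rev]; exact inv_eq_of_mul_eq_one_right h.xy_mul_xy
  have hxt : t * x⁻¹ = x * t := by
    have : (x * t)⁻¹ = x * t := inv_eq_of_mul_eq_one_right h.xt_mul_xt
    rwa [mul_inv_rev, ht] at this
  have hyx : y * x = x⁻¹ * y⁻¹ := by
    rw [eq_inv_mul_iff_mul_eq, ← mul_assoc, ← hxy, mul_assoc, inv_mul_cancel, mul_one]
  have htx : t * x = x⁻¹ * t := by
    rw [eq_inv_mul_iff_mul_eq, ← mul_assoc, ← hxt, mul_assoc, inv_mul_cancel, mul_one]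
  have hcases : (i = 0 ∧ j = 2) ∨ (i = 0 ∧ j = 3) ∨ (i = 1 ∧ j = 3) := by
    push_cast at hj; omega
  rcases hcases with ⟨rfl, rfl⟩ | ⟨rfl, rfl⟩ | ⟨rfl, rfl⟩ <;> rcases u with ⟨g, _ | _⟩ <;>
    simp [step_false, step_true, mul_assoc, ht, hxy, hxt, hyx, htx]

lemma inter_facet_vertex {u v : G × Bool} (h1 : AdjConn 4 (step x y t) {0, 1, 2} u v)
    (h2 : AdjConn 4 (step x y t) {1, 2, 3} u v) : AdjConn 4 (step x y t) {1, 2} u v := by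
  have e1 : u.1⁻¹ * v.1 ∈ Subgroup.closure {x, y} := by
    refine inv_mul_mem (fun i _ _ hi => ?_) h1
    rcases hi with rfl | rfl | rfl
    · exact Subgroup.subset_closure (by simp)
    · exact Subgroup.one_mem _
    · exact Subgroup.inv_mem _ (Subgroup.subset_closure (by simp))
  have e2 : u.1⁻¹ * v.1 ∈ Subgroup.closure {y, t} := by
    refine inv_mul_mem (fun i _ _ hi => ?_) h2
    rcases hi with rfl | rfl | rfl
    · exact Subgroup.one_mem _
    · exact Subgroup.inv_mem _ (Subgroup.subset_closure (by simp))
    · exact Subgroup.subset_closure (by simp)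
  have e3 := h.inf_le ⟨e1, e2⟩
  have e4 : u.1⁻¹ * v.1 ∈ Subgroup.closure
      {a | ∃ i ∈ ({1, 2} : Set ℤ), 0 ≤ i ∧ i < 4 ∧ a = tauOf x y t i} := by
    refine (Subgroup.zpowers_le.2 ?_ : Subgroup.zpowers y ≤ _) e3
    exact (Subgroup.inv_mem_iff _).1
      (Subgroup.subset_closure ⟨2, by simp, by norm_num, by norm_num, rfl⟩)
  have := conn_of_mem (J := {1, 2}) (by simp) e4 u.1 u.2 v.2
  rwa [mul_inv_cancel_left] at this

lemma inter_vertex_edge {u v : G × Bool} (h1 : AdjConn 4 (step x y t) {0, 1} u v)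
    (h2 : AdjConn 4 (step x y t) {1, 2} u v) : AdjConn 4 (step x y t) {1} u v := by
  have e1 : u.1⁻¹ * v.1 ∈ Subgroup.zpowers x := by
    refine inv_mul_mem (fun i _ _ hi => ?_) h1
    rcases hi with rfl | rfl
    · exact Subgroup.mem_zpowers x
    · exact Subgroup.one_mem _
  have e2 : u.1⁻¹ * v.1 ∈ Subgroup.zpowers y := by
    refine inv_mul_mem (fun i _ _ hi => ?_) h2
    rcases hi with rfl | rfl
    · exact Subgroup.one_mem _
    · exact Subgroup.inv_mem _ (Subgroup.mem_zpowers y)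
  have e3 : u.1⁻¹ * v.1 ∈ (⊥ : Subgroup G) := h.inf_xy ▸ ⟨e1, e2⟩
  exact conn_one_of_fst_eq (inv_mul_eq_one.1 (Subgroup.mem_bot.1 e3))

lemma inter_edge_facet {u v : G × Bool} (h1 : AdjConn 4 (step x y t) {1, 2} u v)
    (h2 : AdjConn 4 (step x y t) {2, 3} u v) : AdjConn 4 (step x y t) {2} u v := by
  -- the steps `2` and `3` alone, starting from a flag `gΦ`, reach the flags `gσ₃ᵐΦ` and `gσ₃ᵐΦ²`
  have key : ∀ (g : G) (v : G × Bool), AdjConn 4 (step x y t) {2, 3} (g, false) v →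
      ∃ m : ℤ, v = (g * (y⁻¹ * t) ^ m, false) ∨ v = (g * (y⁻¹ * t) ^ m * y⁻¹, true) := by
    intro g v hv
    have ht : t⁻¹ = t := inv_eq_of_mul_eq_one_right h.t_mul_t
    induction hv with
    | refl => exact ⟨0, Or.inl (by simp)⟩
    | tail _ hs ih =>
      obtain ⟨i, -, -, hi, rfl⟩ := hs
      obtain ⟨m, rfl | rfl⟩ := ih
      · rcases hi with rfl | rfl
        · exact ⟨m, Or.inr rfl⟩
        · refine ⟨m - 1, Or.inr ?_⟩
          rw [step_false, tauOf_three, zpow_sub_one, mul_inv_rev, inv_inv, ht]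
          simp [mul_assoc]
      · rcases hi with rfl | rfl
        · exact ⟨m, Or.inl (by rw [step_true, tauOf_two, mul_assoc, inv_inv, inv_mul_cancel,
            mul_one])⟩
        · refine ⟨m + 1, Or.inl ?_⟩
          rw [step_true, tauOf_three, zpow_add_one, ht, mul_assoc, mul_assoc]
  have main : ∀ (g : G) (v : G × Bool), AdjConn 4 (step x y t) {1, 2} (g, false) v →
      AdjConn 4 (step x y t) {2, 3} (g, false) v → AdjConn 4 (step x y t) {2} (g, false) v := by
    intro g v h1 h2
    have e2 : g⁻¹ * v.1 ∈ Subgroup.zpowers y := by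
      refine inv_mul_mem (fun i _ _ hi => ?_) h1
      rcases hi with rfl | rfl
      · exact Subgroup.one_mem _
      · exact Subgroup.inv_mem _ (Subgroup.mem_zpowers y)
    obtain ⟨m, hm⟩ := key g v h2
    have e3 : (y⁻¹ * t) ^ m ∈ Subgroup.zpowers y := by
      rcases hm with rfl | rfl
      · simpa [mul_assoc] using e2
      · have := Subgroup.mul_mem _ e2 (Subgroup.mem_zpowers y)
        simpa [mul_assoc] using this
    have e4 : (y⁻¹ * t) ^ m ∈ (⊥ : Subgroup G) := h.inf_yz ▸ ⟨e3, m, rfl⟩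
    rw [Subgroup.mem_bot.1 e4, mul_one] at hm
    rcases hm with rfl | rfl
    · exact .refl _ _
    · exact AdjConn.single (r := step x y t) (n := 4) (i := 2) (by norm_num) (by norm_num)
        (by simp) (g, false)
  rcases u with ⟨g, _ | _⟩
  · exact main g v h1 h2
  · have s : ∀ {J : Set ℤ}, 2 ∈ J → AdjConn 4 (step x y t) J (g, true) (g * y⁻¹⁻¹, false) :=
      fun hJ => AdjConn.single (r := step x y t) (n := 4) (i := 2) (by norm_num) (by norm_num)
        hJ (g, true)
    exact (s (by simp)).trans (main _ v ((conn_symm (s (by simp))).trans h1)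
      ((conn_symm (s (by simp))).trans h2))

lemma conn (u v : G × Bool) : AdjConn 4 (step x y t) {0, 1, 2, 3} u v := by
  have : u.1⁻¹ * v.1 ∈ Subgroup.closure
      {a | ∃ i ∈ ({0, 1, 2, 3} : Set ℤ), 0 ≤ i ∧ i < 4 ∧ a = tauOf x y t i} := by
    have hle : Subgroup.closure {x, y, t} ≤ Subgroup.closure
        {a | ∃ i ∈ ({0, 1, 2, 3} : Set ℤ), 0 ≤ i ∧ i < 4 ∧ a = tauOf x y t i} := by
      rw [Subgroup.closure_le]
      rintro a (rfl | rfl | rfl)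
      · exact Subgroup.subset_closure ⟨0, by simp, by norm_num, by norm_num, rfl⟩
      · exact (Subgroup.inv_mem_iff _).1
          (Subgroup.subset_closure ⟨2, by simp, by norm_num, by norm_num, rfl⟩)
      · exact Subgroup.subset_closure ⟨3, by simp, by norm_num, by norm_num, rfl⟩
    exact hle (h.closure_eq ▸ Subgroup.mem_top _)
  have := conn_of_mem (J := {0, 1, 2, 3}) (by simp) this u.1 u.2 v.2
  rwa [mul_inv_cancel_left] at this

/-- The flag system of a chiral triple. -/
def flagSystem : FlagSystem 4 (G × Bool) where
  r := step x y t
  r_r i u _ _ := step_step x y t i u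
  r_comm i j u h0 hij hj := h.step_comm i j u h0 hij hj
  r_ne i u _ _ := step_ne x y t i u
  inter := by
    have inj : ∀ (i j : ℤ), tauOf x y t i ≠ tauOf x y t j →
        ∀ u, step x y t i u ≠ step x y t j u := by
      intro i j hij u he
      have := congrArg Prod.fst he
      rcases u with ⟨g, _ | _⟩
      · exact hij (mul_left_cancel this)
      · exact hij (inv_injective (mul_left_cancel this))
    refine AdjConn.inter_of_rank_four (fun i u _ _ => step_step x y t i u) h.step_comm h.conn
      (inj 0 1 h.x_ne) (inj 1 2 fun he => h.y_ne ?_) (inj 2 3 fun he => h.t_ne ?_)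
      (fun i u _ _ => step_ne x y t i u) (fun _ _ => h.inter_facet_vertex)
      (fun _ _ => h.inter_vertex_edge) (fun _ _ => h.inter_edge_facet)
    · exact inv_eq_one.1 (Eq.symm he)
    · have ht : t⁻¹ = t := inv_eq_of_mul_eq_one_right h.t_mul_t
      have he' : y⁻¹ = t := he
      rw [← ht, ← he', inv_inv]

end IsChiralTriple

namespace FlagSystem

variable {Ω : Type u} {n : ℕ} (S : FlagSystem n Ω) [Nonempty Ω]

/-- The flags of the polytope of a flag system are the elements of the flag system. -/
noncomputable def flagEquiv : Ω ≃ Flag S.polytope.Face :=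
  Equiv.ofBijective S.flagOf ⟨S.flagOf_injective, S.flagOf_surjective⟩

lemma adj_flagEquiv {i : ℤ} (h0 : 0 ≤ i) (hn : i < n) (u : Ω) :
    S.polytope.adj i (S.flagEquiv u) = S.flagEquiv (S.r i u) :=
  (AbstractPolytope.eq_adj_of_flagAdj (S.flagAdj_flagOf h0 hn u)).symm

/-- The symmetries of a flag system are automorphisms of the polytope. -/
lemma exists_aut (φ : Ω ≃ Ω) (hφ : ∀ (i : ℤ) (u : Ω), 0 ≤ i → i < n → φ (S.r i u) = S.r i (φ u)) :
    ∃ γ : S.polytope.Aut, ∀ u, γ • S.flagEquiv u = S.flagEquiv (φ u) := by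
  obtain ⟨e, he⟩ := AbstractPolytope.exists_iso_of_flagEquiv (P := S.polytope) (Q := S.polytope)
    ((S.flagEquiv.symm.trans φ).trans S.flagEquiv) (fun i Φ => by
      obtain ⟨u, rfl⟩ := S.flagEquiv.surjective Φ
      by_cases hi : 0 ≤ i ∧ i < n
      · simp [adj_flagEquiv S hi.1 hi.2, hφ i u hi.1 hi.2]
      · simp only [AbstractPolytope.adj, dif_neg hi])
  refine ⟨e, fun u => ?_⟩
  rw [AbstractPolytope.smul_flag_def, he]
  simp

end FlagSystem

namespace IsChiralTriple

open AbstractPolytope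

variable {G : Type u} [Group G] {x y t : G} (h : IsChiralTriple x y t)
include h

lemma exists_leftMul (g : G) : ∃ γ : h.flagSystem.polytope.Aut, ∀ u : G × Bool,
    γ • h.flagSystem.flagEquiv u = h.flagSystem.flagEquiv (g * u.1, u.2) := by
  refine h.flagSystem.exists_aut (Equiv.prodCongr (Equiv.mulLeft g) (Equiv.refl Bool)) ?_
  intro i u _ _
  exact Prod.ext (mul_assoc g _ _).symm rfl

/-- The automorphism of the polytope of a chiral triple given by a group element. -/
noncomputable def leftMul (g : G) : h.flagSystem.polytope.Aut := (h.exists_leftMul g).choose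

lemma leftMul_smul (g : G) (u : G × Bool) :
    h.leftMul g • h.flagSystem.flagEquiv u = h.flagSystem.flagEquiv (g * u.1, u.2) :=
  (h.exists_leftMul g).choose_spec u

/-- The polytope of a chiral triple has no automorphism that maps the base flag to its
`1`-adjacent flag: it would yield an automorphism of the group that inverts `x`, `y` and `t`. -/
lemma smul_flag_ne (γ : h.flagSystem.polytope.Aut) :
    γ • h.flagSystem.flagEquiv (1, false) ≠ h.flagSystem.flagEquiv (1, true) := by
  intro hγ
  let φ : G × Bool ≃ G × Bool :=
    (h.flagSystem.flagEquiv.trans (MulAction.toPerm γ)).trans h.flagSystem.flagEquiv.symm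
  have hφ : ∀ (i : ℤ) (u : G × Bool), 0 ≤ i → i < (4 : ℕ) →
      φ (step x y t i u) = step x y t i (φ u) := by
    intro i u h0 h4
    simp only [φ, Equiv.trans_apply, MulAction.toPerm_apply]
    rw [Equiv.symm_apply_eq]
    have e1 := h.flagSystem.adj_flagEquiv h0 h4 u
    change _ = h.flagSystem.flagEquiv (step x y t i u) at e1
    have e2 := h.flagSystem.adj_flagEquiv h0 h4
      (h.flagSystem.flagEquiv.symm (γ • h.flagSystem.flagEquiv u))
    rw [Equiv.apply_symm_apply] at e2
    rw [← e1, smul_adj, e2]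
    rfl
  have hφ1 : φ (1, false) = (1, true) := by
    simp only [φ, Equiv.trans_apply, MulAction.toPerm_apply]
    rw [hγ, Equiv.symm_apply_apply]
  -- steps change the second component, hence `φ` changes the second component throughout
  have hsnd : ∀ u, (φ u).2 = !u.2 := by
    intro u
    have := h.conn (1, false) u
    induction this with
    | refl => rw [hφ1]; rfl
    | tail _ hs ih =>
      obtain ⟨i, h0, h4, -, rfl⟩ := hs
      rw [hφ i _ h0 h4]
      simp [step, ih]
  let α : G → G := fun g => (φ (g, false)).1
  have hα : ∀ g, φ (g, false) = (α g, true) := fun g => Prod.ext rfl (hsnd _)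
  have hα' : ∀ g, φ (g, true) = (α g, false) := by
    intro g
    have := hφ 1 (g, false) (by norm_num) (by norm_num)
    rw [hα, step_false, step_true] at this
    simpa using this
  have hmul : ∀ (i : ℤ), 0 ≤ i → i < 4 → ∀ g,
      α (g * tauOf x y t i) = α g * (tauOf x y t i)⁻¹ := by
    intro i h0 h4 g
    have := hφ i (g, false) h0 h4
    rw [hα, step_false, step_true, hα'] at this
    exact congrArg Prod.fst this
  have hmul' : ∀ (i : ℤ), 0 ≤ i → i < 4 → ∀ g,
      α (g * (tauOf x y t i)⁻¹) = α g * tauOf x y t i := by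
    intro i h0 h4 g
    have := hφ i (g, true) h0 h4
    rw [hα', step_false, step_true, hα] at this
    exact congrArg Prod.fst this
  have h1 : α 1 = 1 := congrArg Prod.fst hφ1
  have hτ : ∀ (i : ℤ), 0 ≤ i → i < 4 → α (tauOf x y t i) = (tauOf x y t i)⁻¹ := by
    intro i h0 h4
    have := hmul i h0 h4 1
    rwa [one_mul, h1, one_mul] at this
  have ht : t⁻¹ = t := inv_eq_of_mul_eq_one_right h.t_mul_t
  have hτ' : α y = y⁻¹ := by
    have := hmul' 2 (by norm_num) (by norm_num) 1
    rwa [one_mul, h1, one_mul, tauOf_two, inv_inv] at this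
  have hhom : ∀ g g', α (g * g') = α g * α g' := by
    intro g g'
    have hg' : g' ∈ Subgroup.closure {x, y, t} := h.closure_eq ▸ Subgroup.mem_top _
    induction hg' using Subgroup.closure_induction_right generalizing g with
    | one => rw [h1, mul_one, mul_one]
    | mul_right a s ha hs ih =>
      rw [← mul_assoc]
      rcases hs with rfl | rfl | rfl
      · have e1 := hmul 0 (by norm_num) (by norm_num)
        simp only [tauOf_zero] at e1
        rw [e1, ih, e1, mul_assoc]
      · have e1 := hmul' 2 (by norm_num) (by norm_num)
        simp only [tauOf_two, inv_inv] at e1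
        rw [e1, ih, e1, mul_assoc]
      · have e1 := hmul 3 (by norm_num) (by norm_num)
        simp only [tauOf_three] at e1
        rw [e1, ih, e1, mul_assoc]
    | mul_inv_cancel a s ha hs ih =>
      rw [← mul_assoc]
      rcases hs with rfl | rfl | rfl
      · have e1 := hmul' 0 (by norm_num) (by norm_num)
        simp only [tauOf_zero] at e1
        rw [e1, ih, e1, mul_assoc]
      · have e1 := hmul 2 (by norm_num) (by norm_num)
        simp only [tauOf_two, inv_inv] at e1
        rw [e1, ih, e1, mul_assoc]
      · have e1 := hmul' 3 (by norm_num) (by norm_num)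
        simp only [tauOf_three] at e1
        rw [e1, ih, e1, mul_assoc]
  have hbij : Function.Bijective α := by
    constructor
    · intro g g' hg
      have : φ (g, false) = φ (g', false) := by rw [hα, hα, hg]
      exact congrArg Prod.fst (φ.injective this)
    · intro g
      obtain ⟨⟨g', s⟩, hg'⟩ := φ.surjective (g, true)
      have hs := hsnd (g', s)
      rw [hg'] at hs
      have : s = false := by cases s <;> simp_all
      subst this
      exact ⟨g', congrArg Prod.fst hg'⟩
  refine h.not_inverts (MulEquiv.ofBijective (MonoidHom.mk' α hhom) hbij)
    ⟨hτ 0 (by norm_num) (by norm_num), hτ', hτ 3 (by norm_num) (by norm_num)⟩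

lemma exists_smul_or (Φ : Flag h.flagSystem.polytope.Face) :
    ∃ g : G, Φ = h.leftMul g • h.flagSystem.flagEquiv (1, false) ∨
      Φ = h.leftMul g • h.flagSystem.flagEquiv (1, true) := by
  obtain ⟨⟨g, s⟩, rfl⟩ := h.flagSystem.flagEquiv.surjective Φ
  refine ⟨g, ?_⟩
  rw [h.leftMul_smul, h.leftMul_smul]
  cases s <;> simp

lemma isChiral : h.flagSystem.polytope.IsChiral := by
  refine ⟨?_, ?_⟩
  · rw [Nat.card_eq_two_iff]
    refine ⟨Quotient.mk _ (h.flagSystem.flagEquiv (1, false)),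
      Quotient.mk _ (h.flagSystem.flagEquiv (1, true)), fun he => ?_, ?_⟩
    · obtain ⟨γ, hγ⟩ := MulAction.orbitRel_apply.1 (Quotient.exact he.symm)
      exact h.smul_flag_ne γ hγ
    · refine Set.eq_univ_of_forall fun q => ?_
      obtain ⟨Φ, rfl⟩ := Quotient.exists_rep q
      obtain ⟨g, rfl | rfl⟩ := h.exists_smul_or Φ
      · exact Or.inl (Quotient.sound (MulAction.orbitRel_apply.2 ⟨_, rfl⟩))
      · exact Or.inr (Quotient.sound (MulAction.orbitRel_apply.2 ⟨_, rfl⟩))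
  · rintro i Φ Ψ hadj ⟨γ, rfl⟩
    obtain ⟨h0, h4⟩ := mem_Ico_of_flagAdj hadj
    have hγ := eq_adj_of_flagAdj hadj
    dsimp only at hγ
    obtain ⟨⟨g, s⟩, rfl⟩ := h.flagSystem.flagEquiv.surjective Φ
    rw [h.flagSystem.adj_flagEquiv h0 h4] at hγ
    change _ = h.flagSystem.flagEquiv (step x y t i (g, s)) at hγ
    have e : ∀ (g : G) (s : Bool), h.flagSystem.flagEquiv (g, s) =
        h.leftMul g • h.flagSystem.flagEquiv (1, s) := by
      intro g s
      rw [h.leftMul_smul, mul_one]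
    cases s with
    | false =>
      rw [step_false, e g, e _ true, smul_smul] at hγ
      refine h.smul_flag_ne ((h.leftMul (g * tauOf x y t i))⁻¹ * (γ * h.leftMul g)) ?_
      rw [mul_smul, hγ, inv_smul_smul]
    | true =>
      rw [step_true, e g, e _ false, smul_smul] at hγ
      refine h.smul_flag_ne ((γ * h.leftMul g)⁻¹ * h.leftMul (g * (tauOf x y t i)⁻¹)) ?_
      rw [mul_smul, ← hγ, inv_smul_smul]

/-- The automorphism group of the polytope of a chiral triple. -/
noncomputable def autEquiv : G ≃* h.flagSystem.polytope.Aut :=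
  MulEquiv.ofBijective (MonoidHom.mk' h.leftMul fun g g' => by
      refine smul_flag_cancel (Φ := h.flagSystem.flagEquiv (1, false)) ?_
      rw [mul_smul, h.leftMul_smul, h.leftMul_smul, h.leftMul_smul, mul_assoc]) (by
    constructor
    · intro g g' hg
      have : h.leftMul g • h.flagSystem.flagEquiv (1, false) =
          h.leftMul g' • h.flagSystem.flagEquiv (1, false) := by
        change h.leftMul g = h.leftMul g' at hg
        rw [hg]
      rw [h.leftMul_smul, h.leftMul_smul] at this
      simpa using congrArg Prod.fst (h.flagSystem.flagEquiv.injective this)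
    · intro γ
      obtain ⟨g, hg | hg⟩ := h.exists_smul_or (γ • h.flagSystem.flagEquiv (1, false))
      · exact ⟨g, (smul_flag_cancel hg).symm⟩
      · refine absurd ?_ (h.smul_flag_ne ((h.leftMul g)⁻¹ * γ))
        rw [mul_smul, hg, inv_smul_smul])

lemma autEquiv_tauOf {i : ℤ} (h0 : 0 ≤ i) (h4 : i < 4) :
    h.autEquiv (tauOf x y t i) = tau (h.flagSystem.flagEquiv (1, false)) i := by
  refine h.isChiral.eq_tau _ h0 h4 ?_
  rw [h.flagSystem.adj_flagEquiv (by norm_num) (by norm_num),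
    h.flagSystem.adj_flagEquiv h0 h4]
  change h.leftMul _ • h.flagSystem.flagEquiv (step x y t 1 (1, false)) =
    h.flagSystem.flagEquiv (step x y t i (1, false))
  rw [step_false, step_false, h.leftMul_smul]
  simp

/-- Every chiral triple comes from a chiral polytope of rank 4. -/
theorem exists_polytope : ∃ (P : AbstractPolytope.{u} 4) (Φ : Flag P.Face) (f : P.Aut ≃* G),
    P.IsChiral ∧ f (tau Φ 0) = x ∧ f (tau Φ 2) = y⁻¹ ∧ f (tau Φ 3) = t := by
  refine ⟨h.flagSystem.polytope, h.flagSystem.flagEquiv (1, false), h.autEquiv.symm, h.isChiral,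
    ?_, ?_, ?_⟩
  · rw [← h.autEquiv_tauOf (by norm_num) (by norm_num), MulEquiv.symm_apply_apply, tauOf_zero]
  · rw [← h.autEquiv_tauOf (by norm_num) (by norm_num), MulEquiv.symm_apply_apply, tauOf_two]
  · rw [← h.autEquiv_tauOf (by norm_num) (by norm_num), MulEquiv.symm_apply_apply, tauOf_three]

end IsChiralTriple

/-- Chiral triples are invariant under isomorphisms. -/
lemma IsChiralTriple.map {G : Type u} {H : Type v} [Group G] [Group H] {x y t : G}
    (h : IsChiralTriple x y t) (e : G ≃* H) : IsChiralTriple (e x) (e y) (e t) := by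
  have hz : ∀ a : G, Subgroup.zpowers (e a) = (Subgroup.zpowers a).map e.toMonoidHom := fun a =>
    (MonoidHom.map_zpowers e.toMonoidHom a).symm
  have hc : ∀ s : Set G, Subgroup.closure (e '' s) = (Subgroup.closure s).map e.toMonoidHom :=
    fun s => (MonoidHom.map_closure e.toMonoidHom s).symm
  have inj : Function.Injective e.toMonoidHom := e.injective
  exact
    { t_mul_t := by rw [← map_mul, h.t_mul_t, map_one]
      xy_mul_xy := by rw [← map_mul, ← map_mul, h.xy_mul_xy, map_one]
      xt_mul_xt := by rw [← map_mul, ← map_mul, h.xt_mul_xt, map_one]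
      x_ne := by simpa using h.x_ne
      y_ne := by simpa using h.y_ne
      t_ne := fun he => h.t_ne (e.injective he)
      inf_xy := by rw [hz, hz, ← Subgroup.map_inf _ _ _ inj, h.inf_xy, Subgroup.map_bot]
      inf_yz := by
        rw [← map_inv, ← map_mul, hz, hz, ← Subgroup.map_inf _ _ _ inj, h.inf_yz,
          Subgroup.map_bot]
      inf_le := by
        rw [← Set.image_pair, ← Set.image_pair, hz, hc, hc, ← Subgroup.map_inf _ _ _ inj]
        exact Subgroup.map_mono h.inf_le
      closure_eq := by
        rw [← Set.image_pair, ← Set.image_insert_eq, hc, h.closure_eq,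
          Subgroup.map_top_of_surjective]
        exact e.surjective
      not_inverts := fun α hα => h.not_inverts ((e.trans α).trans e.symm) (by
        simpa [MulEquiv.symm_apply_eq] using hα) }

/-! ### Elements of `PSL(2, K)` -/

namespace PSL2

variable {K : Type v} [Field K]

/-- The group `PSL(2, K)`. -/
abbrev PSL (K : Type v) [Field K] : Type v := Matrix.ProjectiveSpecialLinearGroup (Fin 2) K

/-- The element `g` of `PSL(2, K)` is the class of a scalar multiple of the matrix with rows
`(a, b)` and `(c, d)`. The determinant of that matrix is a nonzero
square, but not necessarily `1`. -/
def Rep (g : PSL K) (a b c d : K) : Prop :=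
  ∃ (A : Matrix.SpecialLinearGroup (Fin 2) K) (s : K), s ≠ 0 ∧ (A : PSL K) = g ∧
    A 0 0 = s * a ∧ A 0 1 = s * b ∧ A 1 0 = s * c ∧ A 1 1 = s * d

lemma det_eq (A : Matrix.SpecialLinearGroup (Fin 2) K) : A 0 0 * A 1 1 - A 0 1 * A 1 0 = 1 := by
  have := A.2
  rwa [Matrix.det_fin_two] at this

lemma exists_rep (g : PSL K) : ∃ a b c d, Rep g a b c d := by
  obtain ⟨A, rfl⟩ := QuotientGroup.mk_surjective g
  exact ⟨_, _, _, _, A, 1, one_ne_zero, rfl, (one_mul _).symm, (one_mul _).symm,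
    (one_mul _).symm, (one_mul _).symm⟩

lemma exists_of_isSquare {a b c d : K} (h0 : a * d - b * c ≠ 0) (h : IsSquare (a * d - b * c)) :
    ∃ g : PSL K, Rep g a b c d := by
  obtain ⟨r, hr⟩ := h
  have hr0 : r ≠ 0 := by rintro rfl; exact h0 (by rw [hr, mul_zero])
  let A : Matrix.SpecialLinearGroup (Fin 2) K :=
    ⟨!![r⁻¹ * a, r⁻¹ * b; r⁻¹ * c, r⁻¹ * d], by
      rw [Matrix.det_fin_two_of]
      have : r⁻¹ * a * (r⁻¹ * d) - r⁻¹ * b * (r⁻¹ * c) = r⁻¹ * r⁻¹ * (a * d - b * c) := by ring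
      rw [this, hr]
      field_simp⟩
  exact ⟨A, A, r⁻¹, inv_ne_zero hr0, rfl, rfl, rfl, rfl, rfl⟩

namespace Rep

variable {g h : PSL K} {a b c d a' b' c' d' : K}

lemma congr (hg : Rep g a b c d) (ha : a = a') (hb : b = b') (hc : c = c') (hd : d = d') :
    Rep g a' b' c' d' := by
  subst ha hb hc hd; exact hg

lemma det_ne_zero (hg : Rep g a b c d) : a * d - b * c ≠ 0 := by
  obtain ⟨A, s, hs, -, h1, h2, h3, h4⟩ := hg
  have := det_eq A
  rw [h1, h2, h3, h4] at this
  intro h0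
  have h5 : s * a * (s * d) - s * b * (s * c) = s * s * (a * d - b * c) := by ring
  rw [h5, h0, mul_zero] at this
  exact zero_ne_one this

lemma isSquare_det (hg : Rep g a b c d) : IsSquare (a * d - b * c) := by
  obtain ⟨A, s, hs, -, h1, h2, h3, h4⟩ := hg
  have := det_eq A
  rw [h1, h2, h3, h4] at this
  refine ⟨s⁻¹, ?_⟩
  field_simp
  linear_combination this

lemma scale (hg : Rep g a b c d) {s : K} (hs : s ≠ 0) : Rep g (s * a) (s * b) (s * c) (s * d) := by
  obtain ⟨A, r, hr, hA, h1, h2, h3, h4⟩ := hg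
  refine ⟨A, r * s⁻¹, mul_ne_zero hr (inv_ne_zero hs), hA, ?_, ?_, ?_, ?_⟩ <;>
    simp [*, mul_assoc]

/-- Rescaling so that the lower right entry becomes `1`. -/
lemma normalize (hg : Rep g a b c d) (hd : d ≠ 0) : Rep g (a / d) (b / d) (c / d) 1 :=
  (hg.scale (inv_ne_zero hd)).congr (by field_simp) (by field_simp) (by field_simp)
    (by field_simp)

lemma one : Rep (1 : PSL K) 1 0 0 1 :=
  ⟨1, 1, one_ne_zero, rfl, by simp, by simp, by simp, by simp⟩

lemma mul (hg : Rep g a b c d) (hh : Rep h a' b' c' d') :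
    Rep (g * h) (a * a' + b * c') (a * b' + b * d') (c * a' + d * c') (c * b' + d * d') := by
  obtain ⟨A, s, hs, rfl, h1, h2, h3, h4⟩ := hg
  obtain ⟨B, r, hr, rfl, k1, k2, k3, k4⟩ := hh
  refine ⟨A * B, s * r, mul_ne_zero hs hr, rfl, ?_, ?_, ?_, ?_⟩ <;>
    rw [Matrix.SpecialLinearGroup.coe_mul, Matrix.mul_apply, Fin.sum_univ_two] <;>
    simp only [h1, h2, h3, h4, k1, k2, k3, k4] <;> ring

lemma inv (hg : Rep g a b c d) : Rep g⁻¹ d (-b) (-c) a := by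
  obtain ⟨A, s, hs, rfl, h1, h2, h3, h4⟩ := hg
  refine ⟨A⁻¹, s, hs, rfl, ?_, ?_, ?_, ?_⟩ <;>
    rw [Matrix.SpecialLinearGroup.coe_inv, Matrix.adjugate_fin_two] <;> simp [*]

/-- The entries of a matrix that represents an element are unique up to a common factor. -/
lemma unique (hg : Rep g a b c d) (hg' : Rep g a' b' c' d') :
    ∃ s : K, s ≠ 0 ∧ a' = s * a ∧ b' = s * b ∧ c' = s * c ∧ d' = s * d := by
  obtain ⟨A, s, hs, hA, h1, h2, h3, h4⟩ := hg
  obtain ⟨B, r, hr, hB, k1, k2, k3, k4⟩ := hg'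
  obtain ⟨z, hz, hAB⟩ := Matrix.SpecialLinearGroup.mem_center_iff.1
    (QuotientGroup.eq.1 (hA.trans hB.symm))
  have hz0 : z ≠ 0 := by rintro rfl; simp at hz
  have key : (B : Matrix (Fin 2) (Fin 2) K) = z • (A : Matrix (Fin 2) (Fin 2) K) := by
    have : B = A * (A⁻¹ * B) := by rw [mul_inv_cancel_left]
    rw [this, Matrix.SpecialLinearGroup.coe_mul, ← hAB, Matrix.scalar_apply,
      ← Matrix.smul_one_eq_diagonal]
    simp
  have hk : ∀ i j, B i j = z * A i j := fun i j => by rw [key]; rfl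
  have hent : ∀ i j e e', A i j = s * e → B i j = r * e' → e' = r⁻¹ * z * s * e := by
    intro i j e e' h h'
    apply mul_left_cancel₀ hr
    rw [← h', hk, h]
    field_simp
  exact ⟨r⁻¹ * z * s, mul_ne_zero (mul_ne_zero (inv_ne_zero hr) hz0) hs,
    hent _ _ _ _ h1 k1, hent _ _ _ _ h2 k2, hent _ _ _ _ h3 k3, hent _ _ _ _ h4 k4⟩

/-- A matrix determines the element that it represents. -/
lemma eq (hg : Rep g a b c d) (hh : Rep h a b c d) : g = h := by
  obtain ⟨A, s, hs, rfl, h1, h2, h3, h4⟩ := hg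
  obtain ⟨B, r, hr, rfl, k1, k2, k3, k4⟩ := hh
  have hA := det_eq A
  have hB := det_eq B
  rw [h1, h2, h3, h4] at hA
  rw [k1, k2, k3, k4] at hB
  have hsr : r ^ 2 = s ^ 2 := by
    linear_combination s ^ 2 * hB - r ^ 2 * hA
  have hz : (r / s) ^ Fintype.card (Fin 2) = 1 := by
    rw [Fintype.card_fin, div_pow, hsr, div_self (pow_ne_zero 2 hs)]
  refine QuotientGroup.eq.2 (Matrix.SpecialLinearGroup.mem_center_iff.2 ⟨r / s, hz, ?_⟩)
  have key : (B : Matrix (Fin 2) (Fin 2) K) = (r / s) • (A : Matrix (Fin 2) (Fin 2) K) := by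
    ext i j
    fin_cases i <;> fin_cases j <;> simp [*] <;> field_simp
  rw [Matrix.SpecialLinearGroup.coe_mul, key, Matrix.mul_smul,
    ← Matrix.SpecialLinearGroup.coe_mul, inv_mul_cancel, Matrix.scalar_apply,
    ← Matrix.smul_one_eq_diagonal, Matrix.SpecialLinearGroup.coe_one]

lemma eq_scale (hg : Rep g a b c d) (hh : Rep h a' b' c' d') {s : K} (hs : s ≠ 0) (ha : a' = s * a)
    (hb : b' = s * b) (hc : c' = s * c) (hd : d' = s * d) : g = h :=
  (hg.scale hs).eq (hh.congr ha hb hc hd)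

lemma upper_of_smul (hg : Rep g a b c d)
    (h : g • Projectivization.mk K (![1, 0] : Fin 2 → K) (by simp) =
      Projectivization.mk K (![1, 0] : Fin 2 → K) (by simp)) : c = 0 := by
  obtain ⟨A, s, hs, rfl, h1, h2, h3, h4⟩ := hg
  rw [Matrix.ProjectiveSpecialLinearGroup.smul_proj_mk, Projectivization.smul_mk,
    Projectivization.mk_eq_mk_iff'] at h
  obtain ⟨z, hz⟩ := h
  have := congr_fun hz 1
  simp [Matrix.SpecialLinearGroup.smul_def, Matrix.mulVec, dotProduct, Fin.sum_univ_two, h3] at this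
  tauto

lemma lower_of_smul (hg : Rep g a b c d)
    (h : g • Projectivization.mk K (![0, 1] : Fin 2 → K) (by simp) =
      Projectivization.mk K (![0, 1] : Fin 2 → K) (by simp)) : b = 0 := by
  obtain ⟨A, s, hs, rfl, h1, h2, h3, h4⟩ := hg
  rw [Matrix.ProjectiveSpecialLinearGroup.smul_proj_mk, Projectivization.smul_mk,
    Projectivization.mk_eq_mk_iff'] at h
  obtain ⟨z, hz⟩ := h
  have := congr_fun hz 0
  simp [Matrix.SpecialLinearGroup.smul_def, Matrix.mulVec, dotProduct, Fin.sum_univ_two, h2] at this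
  tauto

lemma smul_of_upper (hg : Rep g a b 0 d) : g • Projectivization.mk K (![1, 0] : Fin 2 → K)
    (by simp) = Projectivization.mk K (![1, 0] : Fin 2 → K) (by simp) := by
  obtain ⟨A, s, hs, rfl, h1, h2, h3, h4⟩ := hg
  rw [Matrix.ProjectiveSpecialLinearGroup.smul_proj_mk, Projectivization.smul_mk,
    Projectivization.mk_eq_mk_iff']
  refine ⟨s * a, ?_⟩
  ext i
  fin_cases i <;>
    simp [Matrix.SpecialLinearGroup.smul_def, Matrix.mulVec, dotProduct, Fin.sum_univ_two, h1, h3]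

lemma smul_of_lower (hg : Rep g a 0 c d) : g • Projectivization.mk K (![0, 1] : Fin 2 → K)
    (by simp) = Projectivization.mk K (![0, 1] : Fin 2 → K) (by simp) := by
  obtain ⟨A, s, hs, rfl, h1, h2, h3, h4⟩ := hg
  rw [Matrix.ProjectiveSpecialLinearGroup.smul_proj_mk, Projectivization.smul_mk,
    Projectivization.mk_eq_mk_iff']
  refine ⟨s * d, ?_⟩
  ext i
  fin_cases i <;>
    simp [Matrix.SpecialLinearGroup.smul_def, Matrix.mulVec, dotProduct, Fin.sum_univ_two, h2, h4]

end Rep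

/-- Any two points of the projective line can be moved to `[1, 0]` and `[0, 1]`. -/
lemma exists_smul_eq {p q : ℙ K (Fin 2 → K)} (hpq : p ≠ q) : ∃ g : PSL K,
    g • p = Projectivization.mk K (![1, 0] : Fin 2 → K) (by simp) ∧
    g • q = Projectivization.mk K (![0, 1] : Fin 2 → K) (by simp) := by
  obtain ⟨A, h⟩ := (MulAction.is_two_pretransitive_iff (G := Matrix.SpecialLinearGroup (Fin 2) K)
    (α := ℙ K (Fin 2 → K))).1 inferInstance
    (c := Projectivization.mk K (![1, 0] : Fin 2 → K) (by simp))
    (d := Projectivization.mk K (![0, 1] : Fin 2 → K) (by simp)) hpq (by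
      rw [Ne, Projectivization.mk_eq_mk_iff']
      rintro ⟨z, hz⟩
      simpa using congr_fun hz 0)
  exact ⟨A, h⟩

/-- An automorphism of `SL(2, K)` induces one of `PSL(2, K)`. -/
lemma exists_mulEquiv_of_SL (e : Matrix.SpecialLinearGroup (Fin 2) K ≃*
    Matrix.SpecialLinearGroup (Fin 2) K) :
    ∃ α : PSL K ≃* PSL K, ∀ A : Matrix.SpecialLinearGroup (Fin 2) K,
      α (A : PSL K) = ((e A : Matrix.SpecialLinearGroup (Fin 2) K) : PSL K) :=
  ⟨QuotientGroup.congr _ _ e (Subgroup.characteristic_iff_map_eq.1 inferInstance e),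
    fun _ => rfl⟩

/-- A field automorphism, applied to the entries, gives an automorphism of `PSL(2, K)`. -/
lemma exists_fieldAut (φ : K ≃+* K) : ∃ α : PSL K ≃* PSL K, ∀ g a b c d, Rep g a b c d →
    Rep (α g) (φ a) (φ b) (φ c) (φ d) := by
  obtain ⟨α, hα⟩ := exists_mulEquiv_of_SL (K := K)
    { toFun := Matrix.SpecialLinearGroup.map (φ : K →+* K)
      invFun := Matrix.SpecialLinearGroup.map (φ.symm : K →+* K)
      left_inv := fun A => by ext; simp
      right_inv := fun A => by ext; simp
      map_mul' := map_mul _ }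
  refine ⟨α, ?_⟩
  rintro _ a b c d ⟨A, s, hs, rfl, h1, h2, h3, h4⟩
  refine ⟨_, φ s, by simpa, (hα A).symm, ?_⟩
  simp [h1, h2, h3, h4]

/-- Conjugation by the diagonal matrix with entries `s` and `1`. -/
def scaleSL (s : K) (hs : s ≠ 0) (A : Matrix.SpecialLinearGroup (Fin 2) K) :
    Matrix.SpecialLinearGroup (Fin 2) K :=
  ⟨!![A 0 0, s * A 0 1; s⁻¹ * A 1 0, A 1 1], by
    have h := det_eq A
    rw [Matrix.det_fin_two_of]
    field_simp
    exact h⟩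

lemma coe_scaleSL (s : K) (hs : s ≠ 0) (A : Matrix.SpecialLinearGroup (Fin 2) K) :
    (scaleSL s hs A : Matrix (Fin 2) (Fin 2) K) = !![A 0 0, s * A 0 1; s⁻¹ * A 1 0, A 1 1] :=
  rfl

/-- Conjugation by the diagonal matrix with entries `s` and `1` is an automorphism of `PSL(2, K)`,
also when `s` is not a square. -/
lemma exists_scaling {s : K} (hs : s ≠ 0) : ∃ α : PSL K ≃* PSL K, ∀ g a b c d, Rep g a b c d →
    Rep (α g) a (s * b) (s⁻¹ * c) d := by
  obtain ⟨α, hα⟩ := exists_mulEquiv_of_SL (K := K)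
    { toFun := scaleSL s hs
      invFun := scaleSL s⁻¹ (inv_ne_zero hs)
      left_inv := fun A => by
        ext i j; fin_cases i <;> fin_cases j <;> simp [coe_scaleSL, hs]
      right_inv := fun A => by
        ext i j; fin_cases i <;> fin_cases j <;> simp [coe_scaleSL, hs]
      map_mul' := fun A B => by
        ext i j
        fin_cases i <;> fin_cases j <;>
          simp [coe_scaleSL, Matrix.mul_apply, Fin.sum_univ_two] <;> field_simp }
  refine ⟨α, ?_⟩
  rintro _ a b c d ⟨A, r, hr, rfl, h1, h2, h3, h4⟩
  refine ⟨scaleSL s hs A, r, hr, (hα A).symm, ?_⟩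
  simp [coe_scaleSL, h1, h2, h3, h4, mul_left_comm]

/-- The group `PSL(2, K)` is generated by the classes of the elementary matrices. -/
lemma eq_top_of_elementary {H : Subgroup (PSL K)} (h₁ : ∀ g b, Rep g 1 b 0 1 → g ∈ H)
    (h₂ : ∀ g c, Rep g 1 0 c 1 → g ∈ H) : H = ⊤ := by
  rw [eq_top_iff]
  intro g _
  obtain ⟨A, rfl⟩ := QuotientGroup.mk_surjective g
  refine Matrix.SL2.transvection_induction (fun A => (A : PSL K) ∈ H) ?_ ?_ A
  · intro i j hij c
    fin_cases i <;> fin_cases j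
    · simp at hij
    · exact h₁ _ c ⟨_, 1, one_ne_zero, rfl, by simp [Matrix.SpecialLinearGroup.transvection_coe]⟩
    · exact h₂ _ c ⟨_, 1, one_ne_zero, rfl, by simp [Matrix.SpecialLinearGroup.transvection_coe]⟩
    · simp at hij
  · intro A B hA hB
    exact H.mul_mem hA hB

lemma exists_upper {a : K} (ha : a ≠ 0) (h : IsSquare a) (b : K) : ∃ g : PSL K, Rep g a b 0 1 :=
  exists_of_isSquare (by simpa) (by simpa)

end PSL2

namespace PSL2

variable {K : Type v} [Field K]

namespace Rep

variable {g h : PSL K} {a b c d : K}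

lemma eq_of_one (h : Rep (1 : PSL K) a b c d) : b = 0 ∧ c = 0 ∧ a = d := by
  obtain ⟨s, -, ha, hb, hc, hd⟩ := Rep.one.unique h
  exact ⟨by simpa using hb, by simpa using hc, ha.trans hd.symm⟩

lemma unique_of_one {a' b' c' : K} (hg : Rep g a b c 1) (hg' : Rep g a' b' c' 1) :
    a = a' ∧ b = b' ∧ c = c' := by
  obtain ⟨s, -, h1, h2, h3, h4⟩ := hg.unique hg'
  obtain rfl : s = 1 := by simpa using h4.symm
  simp only [one_mul] at h1 h2 h3
  exact ⟨h1.symm, h2.symm, h3.symm⟩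

lemma diag_zpow (hg : Rep g a 0 0 1) (n : ℤ) : Rep (g ^ n) (a ^ n) 0 0 1 := by
  have ha : a ≠ 0 := by simpa using hg.det_ne_zero
  induction n using Int.induction_on with
  | zero => simpa using Rep.one
  | succ n ih =>
    rw [zpow_add_one, zpow_add_one₀ ha]
    exact (ih.mul hg).congr (by ring) (by ring) (by ring) (by ring)
  | pred n ih =>
    rw [zpow_sub_one, zpow_sub_one₀ ha]
    exact ((ih.mul hg.inv).scale (inv_ne_zero ha)).congr (by simp [mul_comm]) (by simp) (by simp)
      (by simp [ha])

/-- Powers of triangular matrices. -/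
lemma pow (hg : Rep g a b c 1) (hbc : b * c = 0) (n : ℕ) :
    Rep (g ^ n) (a ^ n) (b * ∑ i ∈ Finset.range n, a ^ i) (c * ∑ i ∈ Finset.range n, a ^ i) 1 := by
  induction n with
  | zero => simpa using Rep.one
  | succ n ih =>
    rw [pow_succ]
    refine (ih.mul hg).congr ?_ ?_ ?_ ?_
    · linear_combination (∑ i ∈ Finset.range n, a ^ i) * hbc
    · rw [Finset.sum_range_succ]; ring
    · rw [geom_sum_succ]; ring
    · linear_combination (∑ i ∈ Finset.range n, a ^ i) * hbc

/-- The order of a triangular element that is not a translation is the order of its multiplier. -/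
lemma orderOf_eq (hg : Rep g a b c 1) (hbc : b * c = 0) (ha : a ≠ 1) : orderOf g = orderOf a := by
  refine orderOf_eq_orderOf_iff.2 fun n => ⟨fun h => ?_, fun h => ?_⟩
  · have := hg.pow hbc n
    rw [h] at this
    exact this.eq_of_one.2.2
  · have h0 : ∑ i ∈ Finset.range n, a ^ i = 0 := by
      have := geom_sum_mul a n
      rw [h, sub_self] at this
      exact (mul_eq_zero.1 this).resolve_right (sub_ne_zero.2 ha)
    exact (hg.pow hbc n).eq (Rep.one.congr h.symm (by simp [h0]) (by simp [h0]) rfl)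

end Rep

/-- No point of the projective line is fixed by the whole group. -/
lemma not_forall_smul_eq (p : ℙ K (Fin 2 → K)) : ¬ ∀ g : PSL K, g • p = p := by
  intro h
  obtain ⟨e1, e2, he⟩ : ∃ e1 e2 : ℙ K (Fin 2 → K), e1 ≠ e2 := by
    refine ⟨Projectivization.mk K (![1, 0] : Fin 2 → K) (by simp),
      Projectivization.mk K (![0, 1] : Fin 2 → K) (by simp), ?_⟩
    rw [Ne, Projectivization.mk_eq_mk_iff']
    rintro ⟨z, hz⟩
    simpa using congr_fun hz 0
  obtain ⟨q, hq⟩ : ∃ q, q ≠ p := by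
    by_cases h1 : e1 = p
    · exact ⟨e2, h1 ▸ he.symm⟩
    · exact ⟨e1, h1⟩
  obtain ⟨g, hg, hg'⟩ := exists_smul_eq hq
  obtain ⟨k, hk, hk'⟩ := exists_smul_eq hq.symm
  rw [h] at hg' hk
  apply hq
  rw [← h g] at hk
  exact smul_left_cancel g (hg.trans hk.symm)

/-! ### The normal form of the generators -/

/-- Three generators of a group of linear fractional transformations in normal form: `w ↦ λw`,
a transformation that fixes `∞` and maps `0` to `1`, and one that fixes `0`. -/
structure NormalForm (l : K) (x y t : PSL K) : Prop where
  x_rep : Rep x (-l⁻¹) 1 0 1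
  y_rep : Rep y l 0 0 1
  t_rep : Rep t 1 0 (1 + l⁻¹) (-1)

lemma NormalForm.ne_zero {l : K} {x y t : PSL K} (h : NormalForm l x y t) : l ≠ 0 := by
  simpa using h.y_rep.det_ne_zero

/-- If three generators satisfy the relations that hold in the rotation group of a `4`-polytope
and the two subgroups `⟨x, y⟩` and `⟨y, t⟩` each fix a point, then the generators can be brought
into normal form: the two points are distinct and can be moved to `[1, 0]` and `[0, 1]`. Then `y`
becomes diagonal, and the relations determine `x` and `t` up to conjugation by diagonal
matrices. -/
lemma exists_normalForm {x y t : PSL K} (htt : t * t = 1) (hxy : x * y * (x * y) = 1)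
    (hxt : x * t * (x * t) = 1) (htop : Subgroup.closure {x, y, t} = ⊤) {p q : ℙ K (Fin 2 → K)}
    (hpx : x • p = p) (hpy : y • p = p) (hqy : y • q = q) (hqt : t • q = q) :
    ∃ (α : PSL K ≃* PSL K) (l : K), NormalForm l (α x) (α y) (α t) := by
  have hfix : ∀ {x y t : PSL K} (r : ℙ K (Fin 2 → K)), Subgroup.closure {x, y, t} = ⊤ →
      x • r = r → y • r = r → t • r = r → False := by
    intro x y t r htop h1 h2 h3
    refine not_forall_smul_eq r fun g => ?_
    have : Subgroup.closure {x, y, t} ≤ MulAction.stabilizer (PSL K) r := by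
      rw [Subgroup.closure_le]
      rintro _ (rfl | rfl | rfl) <;> assumption
    exact this (htop ▸ Subgroup.mem_top g)
  have hpq : p ≠ q := by
    rintro rfl
    exact hfix p htop hpx hpy hqt
  obtain ⟨g, hgp, hgq⟩ := exists_smul_eq hpq
  have hconj : ∀ (k : PSL K) (r : ℙ K (Fin 2 → K)), k • r = r →
      MulAut.conj g k • (g • r) = g • r := by
    intro k r hk
    rw [MulAut.conj_apply, ← mul_smul, inv_mul_cancel_right, mul_smul, hk]
  have hpx := hgp ▸ hconj x p hpx
  have hpy := hgp ▸ hconj y p hpy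
  have hqy := hgq ▸ hconj y q hqy
  have hqt := hgq ▸ hconj t q hqt
  have htop' : Subgroup.closure {MulAut.conj g x, MulAut.conj g y, MulAut.conj g t} = ⊤ := by
    have := congr_arg (Subgroup.map (MulAut.conj g).toMonoidHom) htop
    rw [MonoidHom.map_closure, ← MonoidHom.range_eq_map,
      MonoidHom.range_eq_top.2 (MulAut.conj g).surjective] at this
    simpa [Set.image_insert_eq] using this
  have htt' : MulAut.conj g t * MulAut.conj g t = 1 := by rw [← map_mul, htt, map_one]
  have hxy' : MulAut.conj g x * MulAut.conj g y * (MulAut.conj g x * MulAut.conj g y) = 1 := by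
    rw [← map_mul, ← map_mul, hxy, map_one]
  have hxt' : MulAut.conj g x * MulAut.conj g t * (MulAut.conj g x * MulAut.conj g t) = 1 := by
    rw [← map_mul, ← map_mul, hxt, map_one]
  suffices ∃ (α : PSL K ≃* PSL K) (l : K), NormalForm l (α (MulAut.conj g x))
      (α (MulAut.conj g y)) (α (MulAut.conj g t)) by
    obtain ⟨α, l, h⟩ := this
    exact ⟨(MulAut.conj g).trans α, l, h⟩
  generalize MulAut.conj g x = x at *
  generalize MulAut.conj g y = y at *
  generalize MulAut.conj g t = t at *
  -- the shape of the three matrices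
  obtain ⟨ν, β, hx⟩ : ∃ ν β, Rep x ν β 0 1 := by
    obtain ⟨a, b, c, d, h⟩ := exists_rep x
    obtain rfl := h.upper_of_smul hpx
    have hd : d ≠ 0 := fun hd => h.det_ne_zero (by simp [hd])
    exact ⟨_, _, (h.normalize hd).congr rfl rfl (zero_div _) rfl⟩
  obtain ⟨l, hy⟩ : ∃ l, Rep y l 0 0 1 := by
    obtain ⟨a, b, c, d, h⟩ := exists_rep y
    obtain rfl := h.upper_of_smul hpy
    obtain rfl := h.lower_of_smul hqy
    have hd : d ≠ 0 := fun hd => h.det_ne_zero (by simp [hd])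
    exact ⟨_, (h.normalize hd).congr rfl (zero_div _) (zero_div _) rfl⟩
  have hl : l ≠ 0 := by simpa using hy.det_ne_zero
  obtain ⟨γ, ht⟩ : ∃ γ, Rep t 1 0 γ (-1) := by
    obtain ⟨a, b, c, d, h⟩ := exists_rep t
    obtain rfl := h.lower_of_smul hqt
    have hdet := h.det_ne_zero
    have h2 := h.mul h
    rw [htt'] at h2
    obtain ⟨-, hc, had⟩ := h2.eq_of_one
    -- `t` has trace zero, since otherwise `t = 1` and everything fixes `[1, 0]`
    by_cases hadd : a + d = 0
    · obtain rfl := eq_neg_of_add_eq_zero_right hadd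
      have ha : a ≠ 0 := by rintro rfl; simp at hdet
      exact ⟨c / a, (h.scale (inv_ne_zero ha)).congr (by simp [ha]) (by simp)
        (by field_simp) (by simp [ha])⟩
    · have hc0 : c = 0 := by
        have : c * (a + d) = 0 := by linear_combination hc
        exact (mul_eq_zero.1 this).resolve_right hadd
      subst hc0
      exact (hfix _ htop' hpx hpy h.smul_of_upper).elim
  -- for `β = 0` everything would fix `[0, 1]`
  have hβ : β ≠ 0 := by
    rintro rfl
    exact hfix _ htop' hx.smul_of_lower hqy hqt
  have hν : ν = -l⁻¹ := by
    have h := (hx.mul hy).mul (hx.mul hy)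
    rw [hxy'] at h
    have h1 : β * (ν * l + 1) = 0 := by linear_combination h.eq_of_one.1
    have h2 := (mul_eq_zero.1 h1).resolve_left hβ
    field_simp
    linear_combination h2
  have hβγ : β * γ = 1 + l⁻¹ := by
    have h := (hx.mul ht).mul (hx.mul ht)
    rw [hxt'] at h
    have h1 : β * (β * γ + ν - 1) = 0 := by linear_combination -h.eq_of_one.1
    have h2 := (mul_eq_zero.1 h1).resolve_left hβ
    rw [hν] at h2
    linear_combination h2
  obtain ⟨α, hα⟩ := exists_scaling (inv_ne_zero hβ)
  exact ⟨α, l, ⟨(hα _ _ _ _ _ hx).congr hν (by simp [hβ]) (by simp) rfl,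
    (hα _ _ _ _ _ hy).congr rfl (by simp) (by simp) rfl,
    (hα _ _ _ _ _ ht).congr rfl (by simp) (by simp [hβγ]) rfl⟩⟩

/-- If `l` and `-1` are nonzero squares, then there are elements in normal form. -/
lemma exists_normalForm_of_isSquare {l : K} (hl : l ≠ 0) (h : IsSquare l)
    (h1 : IsSquare (-1 : K)) : ∃ x y t : PSL K, NormalForm l x y t := by
  have h2 : IsSquare (-l⁻¹) := by
    rw [neg_eq_neg_one_mul]
    exact h1.mul h.inv
  obtain ⟨x, hx⟩ := exists_upper (neg_ne_zero.2 (inv_ne_zero hl)) h2 1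
  obtain ⟨y, hy⟩ := exists_upper hl h 0
  obtain ⟨t, ht⟩ := exists_of_isSquare (a := 1) (b := 0) (c := 1 + l⁻¹) (d := (-1 : K))
    (by simp) (by simpa using h1)
  exact ⟨x, y, t, hx, hy, ht⟩

namespace NormalForm

variable {l : K} {x y t : PSL K}

lemma isSquare (h : NormalForm l x y t) : IsSquare l := by
  simpa using h.y_rep.isSquare_det

lemma t_mul_t (h : NormalForm l x y t) : t * t = 1 :=
  (h.t_rep.mul h.t_rep).eq (Rep.one.congr (by ring) (by ring) (by ring) (by ring))

lemma xy_mul_xy (h : NormalForm l x y t) : x * y * (x * y) = 1 := by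
  have hl := h.ne_zero
  exact ((h.x_rep.mul h.y_rep).mul (h.x_rep.mul h.y_rep)).eq
    (Rep.one.congr (by field_simp; ring) (by field_simp; ring) (by ring) (by ring))

lemma xt_mul_xt (h : NormalForm l x y t) : x * t * (x * t) = 1 := by
  have hl := h.ne_zero
  exact Eq.symm <| Rep.one.eq_scale ((h.x_rep.mul h.t_rep).mul (h.x_rep.mul h.t_rep))
    (neg_ne_zero.2 (inv_ne_zero hl)) (by ring) (by ring) (by ring) (by ring)

lemma yt_rep (h : NormalForm l x y t) : Rep (y⁻¹ * t) (-l⁻¹) 0 (-(1 + l⁻¹)) 1 := by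
  have hl := h.ne_zero
  exact ((h.y_rep.inv.mul h.t_rep).scale (neg_ne_zero.2 (inv_ne_zero hl))).congr (by simp)
    (by simp) (by field_simp; ring) (by field_simp; ring)

/-- If `1 + l⁻¹ = 0`, then all three elements fix `[1, 0]`. -/
lemma one_add_inv_ne_zero (h : NormalForm l x y t) (htop : Subgroup.closure {x, y, t} = ⊤) :
    1 + l⁻¹ ≠ 0 := by
  intro h0
  refine not_forall_smul_eq (Projectivization.mk K (![1, 0] : Fin 2 → K) (by simp)) fun g => ?_
  have : Subgroup.closure {x, y, t} ≤ MulAction.stabilizer (PSL K)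
      (Projectivization.mk K (![1, 0] : Fin 2 → K) (by simp)) := by
    rw [Subgroup.closure_le]
    rintro _ (rfl | rfl | rfl)
    · exact h.x_rep.smul_of_upper
    · exact h.y_rep.smul_of_upper
    · exact (h.t_rep.congr rfl rfl h0 rfl).smul_of_upper
  exact this (htop ▸ Subgroup.mem_top g)

/-- The field of definition of the group generated by a triple in normal form is generated by
the parameter. -/
lemma subfield_eq_top (h : NormalForm l x y t) (htop : Subgroup.closure {x, y, t} = ⊤)
    (F : Subfield K) (hF : l ∈ F) : F = ⊤ := by
  let S : Subgroup (PSL K) :=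
    { carrier := {g | ∃ a ∈ F, ∃ b ∈ F, ∃ c ∈ F, ∃ d ∈ F, Rep g a b c d}
      one_mem' := ⟨1, F.one_mem, 0, F.zero_mem, 0, F.zero_mem, 1, F.one_mem, Rep.one⟩
      mul_mem' := by
        rintro g k ⟨a, ha, b, hb, c, hc, d, hd, hg⟩ ⟨a', ha', b', hb', c', hc', d', hd', hk⟩
        exact ⟨_, F.add_mem (F.mul_mem ha ha') (F.mul_mem hb hc'),
          _, F.add_mem (F.mul_mem ha hb') (F.mul_mem hb hd'),
          _, F.add_mem (F.mul_mem hc ha') (F.mul_mem hd hc'),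
          _, F.add_mem (F.mul_mem hc hb') (F.mul_mem hd hd'), hg.mul hk⟩
      inv_mem' := by
        rintro g ⟨a, ha, b, hb, c, hc, d, hd, hg⟩
        exact ⟨_, hd, _, F.neg_mem hb, _, F.neg_mem hc, _, ha, hg.inv⟩ }
  have hS : S = ⊤ := by
    rw [eq_top_iff, ← htop, Subgroup.closure_le]
    have hl := F.inv_mem hF
    rintro _ (rfl | rfl | rfl)
    · exact ⟨_, F.neg_mem hl, _, F.one_mem, _, F.zero_mem, _, F.one_mem, h.x_rep⟩
    · exact ⟨_, hF, _, F.zero_mem, _, F.zero_mem, _, F.one_mem, h.y_rep⟩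
    · exact ⟨_, F.one_mem, _, F.zero_mem, _, F.add_mem F.one_mem hl, _, F.neg_mem F.one_mem,
        h.t_rep⟩
  rw [eq_top_iff]
  intro β _
  obtain ⟨g, hg⟩ := exists_upper one_ne_zero IsSquare.one β
  obtain ⟨a, ha, b, hb, c, hc, d, hd, hk⟩ : g ∈ S := hS ▸ Subgroup.mem_top g
  obtain ⟨s, hs, h1, h2, -⟩ := hg.unique hk
  rw [mul_one] at h1
  have : β = b / a := by rw [h1, h2]; field_simp
  rw [this]
  exact F.div_mem hb ha

end NormalForm

end PSL2

namespace PSL2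

variable {K : Type v} [Field K]

/-! ### Subgroups generated by elements in normal form -/

/-- An additive subgroup that is closed under multiplication by a field generator is everything. -/
lemma addSubgroup_eq_top [Finite K] {l : K} (hl : ∀ F : Subfield K, l ∈ F → F = ⊤)
    (B : AddSubgroup K) (hlB : ∀ b ∈ B, l * b ∈ B) {b : K} (hb : b ∈ B) (hb0 : b ≠ 0) (c : K) :
    c ∈ B := by
  have := Fintype.ofFinite K
  let F : Subfield K :=
    { carrier := {m | ∀ b ∈ B, m * b ∈ B}
      mul_mem' := fun {m n} hm hn b hb => by rw [mul_assoc]; exact hm _ (hn _ hb)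
      one_mem' := fun b hb => by rwa [one_mul]
      add_mem' := fun {m n} hm hn b hb => by rw [add_mul]; exact B.add_mem (hm _ hb) (hn _ hb)
      zero_mem' := fun b _ => by rw [zero_mul]; exact B.zero_mem
      neg_mem' := fun {m} hm b hb => by rw [neg_mul]; exact B.neg_mem (hm _ hb)
      inv_mem' := fun m hm b hb => by
        by_cases hm0 : m = 0
        · rw [hm0, inv_zero, zero_mul]; exact B.zero_mem
        · have hpow : ∀ n : ℕ, m ^ n * b ∈ B := by
            intro n
            induction n with
            | zero => simpa
            | succ n ih => rw [pow_succ', mul_assoc]; exact hm _ ih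
          obtain ⟨n, hn⟩ := Nat.exists_eq_add_of_lt (Fintype.one_lt_card (α := K))
          have h1 := FiniteField.pow_card_sub_one_eq_one m hm0
          rw [hn, show 1 + n + 1 - 1 = n + 1 by omega, pow_succ] at h1
          rw [inv_eq_of_mul_eq_one_left h1]
          exact hpow n }
  have hc : c / b ∈ F := (hl F hlB) ▸ Subfield.mem_top _
  have := hc b hb
  rwa [div_mul_cancel₀ _ hb0] at this

section Generation

variable [Finite K] {l : K} {y : PSL K} {H : Subgroup (PSL K)}

/-- If a subgroup contains `w ↦ l w`, where `l` generates the field, and some translation, then it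
contains all translations. -/
lemma upper_mem (hl : ∀ F : Subfield K, l ∈ F → F = ⊤) (hy : Rep y l 0 0 1) (hyH : y ∈ H)
    {g : PSL K} {b : K} (hg : Rep g 1 b 0 1) (hb : b ≠ 0) (hgH : g ∈ H) :
    ∀ (k : PSL K) (c : K), Rep k 1 c 0 1 → k ∈ H := by
  have hl0 : l ≠ 0 := by simpa using hy.det_ne_zero
  let B : AddSubgroup K :=
    { carrier := {c | ∃ k ∈ H, Rep k 1 c 0 1}
      add_mem' := by
        rintro c c' ⟨k, hk, hc⟩ ⟨k', hk', hc'⟩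
        exact ⟨_, H.mul_mem hk hk', (hc.mul hc').congr (by ring) (by ring) (by ring) (by ring)⟩
      zero_mem' := ⟨1, H.one_mem, Rep.one⟩
      neg_mem' := by
        rintro c ⟨k, hk, hc⟩
        exact ⟨_, H.inv_mem hk, hc.inv.congr rfl rfl neg_zero rfl⟩ }
  have hB : ∀ c ∈ B, l * c ∈ B := by
    rintro c ⟨k, hk, hc⟩
    exact ⟨y * k * y⁻¹, H.mul_mem (H.mul_mem hyH hk) (H.inv_mem hyH),
      (((hy.mul hc).mul hy.inv).scale (inv_ne_zero hl0)).congr (by field_simp; ring)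
        (by field_simp; ring) (by ring) (by field_simp; ring)⟩
  intro k c hk
  obtain ⟨k', hk', hc'⟩ := addSubgroup_eq_top hl B hB ⟨g, hgH, hg⟩ hb c
  rwa [hk.eq hc']

/-- The analogue of `upper_mem` for lower triangular matrices. -/
lemma lower_mem (hl : ∀ F : Subfield K, l ∈ F → F = ⊤) (hy : Rep y l 0 0 1) (hyH : y ∈ H)
    {g : PSL K} {b : K} (hg : Rep g 1 0 b 1) (hb : b ≠ 0) (hgH : g ∈ H) :
    ∀ (k : PSL K) (c : K), Rep k 1 0 c 1 → k ∈ H := by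
  have hl0 : l ≠ 0 := by simpa using hy.det_ne_zero
  let B : AddSubgroup K :=
    { carrier := {c | ∃ k ∈ H, Rep k 1 0 c 1}
      add_mem' := by
        rintro c c' ⟨k, hk, hc⟩ ⟨k', hk', hc'⟩
        exact ⟨_, H.mul_mem hk hk', (hc.mul hc').congr (by ring) (by ring) (by ring) (by ring)⟩
      zero_mem' := ⟨1, H.one_mem, Rep.one⟩
      neg_mem' := by
        rintro c ⟨k, hk, hc⟩
        exact ⟨_, H.inv_mem hk, hc.inv.congr rfl neg_zero rfl rfl⟩ }
  have hB : ∀ c ∈ B, l * c ∈ B := by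
    rintro c ⟨k, hk, hc⟩
    exact ⟨y⁻¹ * k * y, H.mul_mem (H.mul_mem (H.inv_mem hyH) hk) hyH,
      (((hy.inv.mul hc).mul hy).scale (inv_ne_zero hl0)).congr (by field_simp; ring)
        (by ring) (by field_simp; ring) (by field_simp; ring)⟩
  intro k c hk
  obtain ⟨k', hk', hc'⟩ := addSubgroup_eq_top hl B hB ⟨g, hgH, hg⟩ hb c
  rwa [hk.eq hc']

end Generation

namespace NormalForm

variable {l : K} {x y t : PSL K}

/-- The group `⟨x, y⟩` contains all translations: it contains the commutator of `x` and `y`. -/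
lemma upper_mem [Finite K] (h : NormalForm l x y t) (hl : ∀ F : Subfield K, l ∈ F → F = ⊤)
    (hl1 : l ≠ 1) (k : PSL K) (c : K) (hk : Rep k 1 c 0 1) : k ∈ Subgroup.closure {x, y} := by
  have hl0 := h.ne_zero
  have hx : x ∈ Subgroup.closure {x, y} := Subgroup.subset_closure (by simp)
  have hy : y ∈ Subgroup.closure {x, y} := Subgroup.subset_closure (by simp)
  refine PSL2.upper_mem hl h.y_rep hy (g := x * y * x⁻¹ * y⁻¹) (b := 1 - l) ?_
    (sub_ne_zero.2 hl1.symm) ?_ k c hk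
  · exact ((((h.x_rep.mul h.y_rep).mul h.x_rep.inv).mul h.y_rep.inv).scale
      (neg_ne_zero.2 one_ne_zero)).congr (by field_simp; ring) (by field_simp; ring) (by ring)
      (by field_simp; ring)
  · exact mul_mem (mul_mem (mul_mem hx hy) (inv_mem hx)) (inv_mem hy)

/-- The group `⟨y, t⟩` contains all lower unitriangular elements: it contains the commutator of `y`
and `t`. -/
lemma lower_mem [Finite K] (h : NormalForm l x y t) (hl : ∀ F : Subfield K, l ∈ F → F = ⊤)
    (hl1 : l ≠ 1) (hl' : 1 + l⁻¹ ≠ 0) (k : PSL K) (c : K) (hk : Rep k 1 0 c 1) :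
    k ∈ Subgroup.closure {y, t} := by
  have hl0 := h.ne_zero
  have ht : t ∈ Subgroup.closure {y, t} := Subgroup.subset_closure (by simp)
  have hy : y ∈ Subgroup.closure {y, t} := Subgroup.subset_closure (by simp)
  refine PSL2.lower_mem hl h.y_rep hy (g := y * t * y⁻¹ * t) (b := (1 + l⁻¹) * (l⁻¹ - 1)) ?_
    (mul_ne_zero hl' (sub_ne_zero.2 ?_)) ?_ k c hk
  · exact ((((h.y_rep.mul h.t_rep).mul h.y_rep.inv).mul h.t_rep).scale
      (inv_ne_zero hl0)).congr (by field_simp; ring) (by field_simp; ring)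
      (by field_simp; ring) (by field_simp; ring)
  · rwa [Ne, inv_eq_one]
  · exact mul_mem (mul_mem (mul_mem hy ht) (inv_mem hy)) ht

lemma closure_eq_top [Finite K] (h : NormalForm l x y t) (hl : ∀ F : Subfield K, l ∈ F → F = ⊤)
    (hl1 : l ≠ 1) (hl' : 1 + l⁻¹ ≠ 0) : Subgroup.closure {x, y, t} = ⊤ :=
  eq_top_of_elementary
    (fun k c hk => Subgroup.closure_mono (by simp [Set.insert_subset_iff])
      (h.upper_mem hl hl1 k c hk))
    (fun k c hk => Subgroup.closure_mono (by simp)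
      (h.lower_mem hl hl1 hl' k c hk))

/-- The element `w ↦ -w` belongs to both parabolic subgroups. -/
lemma neg_mem [Finite K] (h : NormalForm l x y t) (hl : ∀ F : Subfield K, l ∈ F → F = ⊤)
    (hl1 : l ≠ 1) (hl' : 1 + l⁻¹ ≠ 0) {g : PSL K} (hg : Rep g (-1) 0 0 1) :
    g ∈ Subgroup.closure {x, y} ⊓ Subgroup.closure {y, t} := by
  have hl0 := h.ne_zero
  constructor
  · have h1 : g * (x * y)⁻¹ ∈ Subgroup.closure {x, y} :=
      h.upper_mem hl hl1 _ (-1) (((hg.mul (h.x_rep.mul h.y_rep).inv).scale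
        (neg_ne_zero.2 one_ne_zero)).congr (by ring) (by ring) (by ring) (by field_simp; ring))
    have h2 : x * y ∈ Subgroup.closure {x, y} :=
      mul_mem (Subgroup.subset_closure (by simp)) (Subgroup.subset_closure (by simp))
    have := mul_mem h1 h2
    rwa [inv_mul_cancel_right] at this
  · have h1 : g * t ∈ Subgroup.closure {y, t} :=
      h.lower_mem hl hl1 hl' _ (-(1 + l⁻¹)) (((hg.mul h.t_rep).scale
        (neg_ne_zero.2 one_ne_zero)).congr (by ring) (by ring) (by ring) (by ring))
    have h2 : t ∈ Subgroup.closure {y, t} := Subgroup.subset_closure (by simp)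
    have := mul_mem h1 h2
    rwa [mul_assoc, h.t_mul_t, mul_one] at this

/-- An element of both parabolic subgroups is a diagonal matrix with an entry in `⟨l⟩`, because
`-l⁻¹`, the entry of `x`, belongs to `⟨l⟩`. -/
lemma inf_le (h : NormalForm l x y t) {m : ℤ} (hm : l ^ m = -1) :
    Subgroup.closure {x, y} ⊓ Subgroup.closure {y, t} ≤ Subgroup.zpowers y := by
  have hl0 := h.ne_zero
  let S : Subgroup (PSL K) :=
    { carrier := {g | ∃ (n : ℤ) (b : K), Rep g (l ^ n) b 0 1}
      one_mem' := ⟨0, 0, by simpa using Rep.one⟩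
      mul_mem' := by
        rintro g k ⟨n, b, hg⟩ ⟨n', b', hk⟩
        exact ⟨n + n', _, (hg.mul hk).congr (by rw [zpow_add₀ hl0]; ring) rfl (by ring) (by ring)⟩
      inv_mem' := by
        rintro g ⟨n, b, hg⟩
        have := zpow_ne_zero n hl0
        exact ⟨-n, _, (hg.inv.scale (inv_ne_zero this)).congr (by simp) rfl (by simp)
          (inv_mul_cancel₀ this)⟩ }
  have hS : Subgroup.closure {x, y} ≤ S := by
    rw [Subgroup.closure_le]
    rintro _ (rfl | rfl)
    · exact ⟨m - 1, _, h.x_rep.congr (by rw [zpow_sub_one₀ hl0, hm]; ring) rfl rfl rfl⟩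
    · exact ⟨1, _, h.y_rep.congr (by simp) rfl rfl rfl⟩
  let T : Subgroup (PSL K) :=
    { carrier := {g | ∃ a c d : K, Rep g a 0 c d}
      one_mem' := ⟨_, _, _, Rep.one⟩
      mul_mem' := by
        rintro g k ⟨a, c, d, hg⟩ ⟨a', c', d', hk⟩
        exact ⟨_, _, _, (hg.mul hk).congr rfl (by ring) rfl rfl⟩
      inv_mem' := by
        rintro g ⟨a, c, d, hg⟩
        exact ⟨_, _, _, hg.inv.congr rfl neg_zero rfl rfl⟩ }
  have hT : Subgroup.closure {y, t} ≤ T := by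
    rw [Subgroup.closure_le]
    rintro _ (rfl | rfl)
    · exact ⟨_, _, _, h.y_rep⟩
    · exact ⟨_, _, _, h.t_rep⟩
  rintro g ⟨hg1, hg2⟩
  obtain ⟨n, b, hg⟩ := hS hg1
  obtain ⟨a, c, d, hg'⟩ := hT hg2
  obtain ⟨s, hs, -, hb, -⟩ := hg.unique hg'
  obtain rfl : b = 0 := (mul_eq_zero.1 hb.symm).resolve_left hs
  exact ⟨n, (h.y_rep.diag_zpow n).eq hg⟩

/-- An element of `⟨x⟩ ∩ ⟨y⟩` is diagonal and commutes with `x`, hence is trivial. -/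
lemma inf_xy (h : NormalForm l x y t) : Subgroup.zpowers x ⊓ Subgroup.zpowers y = ⊥ := by
  rw [eq_bot_iff]
  rintro _ ⟨⟨m, rfl⟩, ⟨n, hn⟩⟩
  have h1 := (h.y_rep.diag_zpow n).mul h.x_rep
  have h2 := h.x_rep.mul (h.y_rep.diag_zpow n)
  simp only at hn
  rw [hn] at h1 h2
  rw [((Commute.refl x).zpow_left m).eq] at h1
  have h3 : l ^ n = 1 := by
    have := ((h1.congr rfl rfl rfl (by ring)).unique_of_one
      (h2.congr rfl rfl rfl (by ring))).2.1
    linear_combination this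
  change x ^ m = 1
  rw [← hn]
  exact (h.y_rep.diag_zpow n).eq (Rep.one.congr h3.symm rfl rfl rfl)

lemma inf_yz (h : NormalForm l x y t) (hl' : 1 + l⁻¹ ≠ 0) :
    Subgroup.zpowers y ⊓ Subgroup.zpowers (y⁻¹ * t) = ⊥ := by
  rw [eq_bot_iff]
  rintro _ ⟨⟨m, rfl⟩, ⟨n, hn⟩⟩
  have h1 := (h.y_rep.diag_zpow m).mul h.yt_rep
  have h2 := h.yt_rep.mul (h.y_rep.diag_zpow m)
  simp only at hn
  rw [← hn] at h1 h2
  rw [((Commute.refl (y⁻¹ * t)).zpow_left n).eq] at h1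
  have h3 : l ^ m = 1 := by
    have := ((h1.congr rfl rfl rfl (by ring)).unique_of_one
      (h2.congr rfl rfl rfl (by ring))).2.2
    refine mul_left_cancel₀ hl' ?_
    linear_combination this
  exact (h.y_rep.diag_zpow m).eq (Rep.one.congr h3.symm rfl rfl rfl)

end NormalForm

end PSL2

namespace PSL2

variable {K : Type v} [Field K] {p d : ℕ}

/-! ### Powers of the Frobenius automorphism -/

section FiniteField

variable [Fact p.Prime] [CharP K p] [Fintype K]

/-- The endomorphisms of a finite field are the powers of the Frobenius automorphism. -/
lemma exists_pow_eq_of_ringHom (hK : Fintype.card K = p ^ d) (ψ : K →+* K) :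
    ∃ e < d, ∀ a, ψ a = a ^ p ^ e := by
  let _ := ZMod.algebra K p
  let ψ' : K →ₐ[ZMod p] K :=
    { ψ with
      commutes' := fun r => RingHom.congr_fun
        (Subsingleton.elim (ψ.comp (algebraMap (ZMod p) K)) (algebraMap (ZMod p) K)) r }
  obtain ⟨e, he⟩ := (FiniteField.bijective_frobeniusAlgHom_pow (ZMod p) K).2 ψ'
  have hd : Module.finrank (ZMod p) K = d := by
    have := Module.card_eq_pow_finrank (K := ZMod p) (V := K)
    rw [hK, ZMod.card] at this
    exact (Nat.pow_right_injective (Fact.out : p.Prime).two_le this).symm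
  refine ⟨e, e.2.trans_eq hd, fun a => ?_⟩
  have h : ∀ n : ℕ, (FiniteField.frobeniusAlgHom (ZMod p) K ^ n) a = a ^ p ^ n := by
    intro n
    rw [AlgHom.coe_pow]
    simp [FiniteField.coe_frobeniusAlgHom, pow_iterate, ZMod.card]
  rw [← h]
  exact (DFunLike.congr_fun he a).symm

/-- A finite field is generated by an element that is moved by the proper powers of the Frobenius
automorphism. -/
lemma subfield_eq_top_of_pow_ne (hK : Fintype.card K = p ^ d) {l : K}
    (hl : ∀ e, 1 ≤ e → e < d → l ^ p ^ e ≠ l) (F : Subfield K) (hF : l ∈ F) : F = ⊤ := by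
  classical
  have := Fintype.ofFinite F
  obtain ⟨n, -, hn⟩ := FiniteField.card F p
  have h1 : l ^ p ^ (n : ℕ) = l := by
    have := FiniteField.pow_card (⟨l, hF⟩ : F)
    rw [hn] at this
    exact congr_arg Subtype.val this
  have h2 : d ≤ n := by
    by_contra h
    exact hl n n.2 (not_le.1 h) h1
  have h3 : Nat.card K ≤ Nat.card F := by
    rw [Nat.card_eq_fintype_card, Nat.card_eq_fintype_card, hK, hn]
    exact Nat.pow_le_pow_right (Fact.out : p.Prime).pos h2
  rw [eq_top_iff]
  intro a _
  have : a ∈ F.toAddSubgroup := AddSubgroup.eq_top_of_le_card F.toAddSubgroup h3 ▸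
    AddSubgroup.mem_top a
  exact this

/-- A field generator is moved by the proper powers of the Frobenius automorphism, because otherwise
such a power would be the identity on `K`, in particular on a generator of `Kˣ`. -/
lemma pow_ne_of_subfield_eq_top (hK : Fintype.card K = p ^ d) {l : K}
    (hl : ∀ F : Subfield K, l ∈ F → F = ⊤) {e : ℕ} (h1 : 1 ≤ e) (he : e < d) : l ^ p ^ e ≠ l := by
  intro h
  have hp := (Fact.out : p.Prime)
  have htop := hl (RingHom.eqLocusField (iterateFrobenius K p e) (RingHom.id K)) h
  obtain ⟨g, hg⟩ := IsCyclic.exists_generator (α := Kˣ)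
  have hgo := orderOf_eq_card_of_forall_mem_zpowers hg
  have hge : g ^ p ^ e = g := Units.ext (by
    have : (g : K) ∈ RingHom.eqLocusField (iterateFrobenius K p e) (RingHom.id K) :=
      htop ▸ Subfield.mem_top _
    exact this)
  have hlt : p ^ e < p ^ d := Nat.pow_lt_pow_right hp.one_lt he
  have hp1 : 1 < p ^ e := Nat.one_lt_pow (by omega) hp.one_lt
  have h2 : g ^ (p ^ e - 1) = 1 := by
    rw [← mul_left_inj g, ← pow_succ, Nat.sub_add_cancel hp1.le, hge, one_mul]
  have h3 := Nat.le_of_dvd (by omega) (orderOf_dvd_of_pow_eq_one h2)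
  rw [hgo, Nat.card_units, Nat.card_eq_fintype_card, hK] at h3
  omega

end FiniteField

lemma orderOf_dvd_sub_one {l : K} (hl : l ≠ 0) {n : ℕ} (hn : 1 ≤ n) :
    orderOf l ∣ n - 1 ↔ l ^ n = l := by
  rw [orderOf_dvd_iff_pow_eq_one]
  conv_rhs => rw [← Nat.sub_add_cancel hn, pow_succ, mul_eq_right₀ hl]

lemma orderOf_dvd_add_one {l : K} (hl : l ≠ 0) {n : ℕ} : orderOf l ∣ n + 1 ↔ l ^ n = l⁻¹ := by
  rw [orderOf_dvd_iff_pow_eq_one, pow_succ]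
  refine ⟨eq_inv_of_mul_eq_one_left, fun h => ?_⟩
  rw [h, inv_mul_cancel₀ hl]

namespace NormalForm

variable [Fact p.Prime] [CharP K p] [Fintype K] {l : K} {x y t : PSL K}

/-- Suppose that an automorphism maps `x` to an upper triangular and `y` to a diagonal element.
Then it maps translations to translations, because these are the upper triangular elements of order
`p`. The map that is so induced on the translation lengths is, up to a factor, a field
automorphism. -/
lemma exists_pow_eq (hK : Fintype.card K = p ^ d) (h : NormalForm l x y t)
    (hl : ∀ F : Subfield K, l ∈ F → F = ⊤) (hl1 : l ≠ 1) (α : PSL K ≃* PSL K) {a b c m : K}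
    (hx : Rep (α x) a b 0 c) (hy : Rep (α y) m 0 0 1) : ∃ e < d, m = l ^ p ^ e := by
  have hl0 := h.ne_zero
  have hm0 : m ≠ 0 := by simpa using hy.det_ne_zero
  let U : Subgroup (PSL K) :=
    { carrier := {g | ∃ a b c : K, Rep g a b 0 c}
      one_mem' := ⟨_, _, _, Rep.one⟩
      mul_mem' := by
        rintro g k ⟨a, b, c, hg⟩ ⟨a', b', c', hk⟩
        exact ⟨_, _, _, (hg.mul hk).congr rfl rfl (by ring) rfl⟩
      inv_mem' := by
        rintro g ⟨a, b, c, hg⟩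
        exact ⟨_, _, _, hg.inv.congr rfl rfl neg_zero rfl⟩ }
  have hU : Subgroup.closure {x, y} ≤ U.comap α.toMonoidHom := by
    rw [Subgroup.closure_le]
    rintro _ (rfl | rfl)
    · exact ⟨_, _, _, hx⟩
    · exact ⟨_, _, _, hy⟩
  have hφ : ∀ β : K, ∃ β' : K, ∀ g : PSL K, Rep g 1 β 0 1 → Rep (α g) 1 β' 0 1 := by
    intro β
    obtain ⟨g, hg⟩ := exists_upper one_ne_zero IsSquare.one β
    obtain ⟨a, b, c, hk⟩ := hU (h.upper_mem hl hl1 g β hg)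
    have hc : c ≠ 0 := fun hc => hk.det_ne_zero (by simp [hc])
    have hk' := (hk.normalize hc).congr rfl rfl (zero_div _) rfl
    have hgp : g ^ p = 1 := by
      refine (hg.pow (mul_zero _) p).eq (Rep.one.congr ?_ ?_ ?_ rfl) <;> simp
    have hkp : α g ^ p = 1 := by rw [← map_pow, hgp, map_one]
    have h1 := hk'.pow (mul_zero _) p
    have h2 : (a / c) ^ p = 1 := (Rep.eq_of_one (by
      have h3 := h1
      rw [show α.toMonoidHom g ^ p = 1 from hkp] at h3
      exact h3)).2.2
    have h3 : a / c = 1 := by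
      apply frobenius_inj K p
      rw [frobenius_def, frobenius_def, h2, one_pow]
    refine ⟨b / c, fun g' hg' => ?_⟩
    rw [hg'.eq hg]
    exact hk'.congr h3 rfl rfl rfl
  choose φ hφ using hφ
  have hu : ∀ β : K, ∃ g : PSL K, Rep g 1 β 0 1 :=
    fun β => exists_upper one_ne_zero IsSquare.one β
  choose τ hτ using hu
  have hadd : ∀ β γ, φ (β + γ) = φ β + φ γ := by
    intro β γ
    have h1 := hφ (β + γ) (τ β * τ γ)
      (((hτ β).mul (hτ γ)).congr (by ring) (by ring) (by ring) (by ring))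
    rw [map_mul] at h1
    refine (h1.unique_of_one (((hφ β _ (hτ β)).mul (hφ γ _ (hτ γ))).congr (a' := 1)
      (c' := 0) (b' := φ β + φ γ) ?_ ?_ ?_ ?_)).2.1 <;> ring
  have hmul : ∀ β, φ (l * β) = m * φ β := by
    intro β
    have h1 := hφ (l * β) (y * τ β * y⁻¹)
      ((((h.y_rep.mul (hτ β)).mul h.y_rep.inv).scale (inv_ne_zero hl0)).congr (by field_simp; ring)
        (by field_simp; ring) (by ring) (by field_simp; ring))
    rw [map_mul, map_mul, map_inv] at h1
    refine (h1.unique_of_one ((((hy.mul (hφ β _ (hτ β))).mul hy.inv).scale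
      (inv_ne_zero hm0)).congr (a' := 1) (b' := m * φ β) (c' := 0) ?_ ?_ ?_ ?_)).2.1 <;>
      field_simp <;> ring
  have h10 : φ 1 ≠ 0 := by
    intro h0
    have h1 := (hφ 1 _ (hτ 1)).eq (Rep.one.congr rfl h0.symm rfl rfl)
    have h2 := hτ 1
    rw [EmbeddingLike.map_eq_one_iff.1 h1] at h2
    exact one_ne_zero h2.eq_of_one.1
  -- normalised, the map is additive and takes `1` to `1`
  have hψadd : ∀ β γ, φ (β + γ) / φ 1 = φ β / φ 1 + φ γ / φ 1 := by
    intro β γ; rw [hadd, add_div]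
  generalize hψ : (fun β => φ β / φ 1) = ψ
  have hψ' : ∀ β, ψ β = φ β / φ 1 := fun β => by rw [← hψ]
  have ψadd : ∀ β γ, ψ (β + γ) = ψ β + ψ γ := by simpa only [hψ'] using hψadd
  have ψone : ψ 1 = 1 := by rw [hψ', div_self h10]
  have ψl : ψ l = m := by rw [hψ', ← mul_one l, hmul, mul_div_cancel_right₀ _ h10]
  have ψmul_l : ∀ β, ψ (l * β) = ψ l * ψ β := by
    intro β; rw [ψl, hψ', hψ', hmul, mul_div_assoc]
  have ψzero : ψ 0 = 0 := by simpa using ψadd 0 0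
  have ψneg : ∀ β, ψ (-β) = -ψ β := by
    intro β
    apply eq_neg_of_add_eq_zero_left
    rw [← ψadd, neg_add_cancel, ψzero]
  let F : Subfield K :=
    { carrier := {a | ∀ β, ψ (a * β) = ψ a * ψ β}
      mul_mem' := fun {a b} ha hb β => by rw [mul_assoc, ha, hb, ha, mul_assoc]
      one_mem' := fun β => by rw [one_mul, ψone, one_mul]
      add_mem' := fun {a b} ha hb β => by rw [add_mul, ψadd, ha, hb, ψadd, add_mul]
      zero_mem' := fun β => by rw [zero_mul, ψzero, zero_mul]
      neg_mem' := fun {a} ha β => by rw [neg_mul, ψneg, ha, ψneg, neg_mul]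
      inv_mem' := fun a ha β => by
        by_cases ha0 : a = 0
        · rw [ha0, inv_zero, zero_mul, ψzero, zero_mul]
        · have h1 : ψ a * ψ a⁻¹ = 1 := by rw [← ha, mul_inv_cancel₀ ha0, ψone]
          have h2 : ψ β = ψ a * ψ (a⁻¹ * β) := by rw [← ha, mul_inv_cancel_left₀ ha0]
          rw [h2, ← mul_assoc, mul_comm (ψ a⁻¹), h1, one_mul] }
  have hF : ∀ a β, ψ (a * β) = ψ a * ψ β := fun a => by
    have : a ∈ F := hl F ψmul_l ▸ Subfield.mem_top a
    exact this
  obtain ⟨e, he, hψe⟩ := exists_pow_eq_of_ringHom hK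
    { toFun := ψ, map_one' := ψone, map_mul' := hF, map_zero' := ψzero, map_add' := ψadd }
  exact ⟨e, he, ψl.symm.trans (hψe l)⟩

/-- The powers of the Frobenius automorphism act on the parameters of normal forms. -/
lemma exists_frobenius (h : NormalForm l x y t) (e : ℕ) :
    ∃ α : PSL K ≃* PSL K, NormalForm (l ^ p ^ e) (α x) (α y) (α t) := by
  obtain ⟨α, hα⟩ := exists_fieldAut (iterateFrobeniusEquiv K p e)
  have hl : l ^ p ^ e = iterateFrobeniusEquiv K p e l := (iterateFrobenius_def p e l).symm
  rw [hl]
  refine ⟨α, (hα _ _ _ _ _ h.x_rep).congr ?_ ?_ ?_ ?_, (hα _ _ _ _ _ h.y_rep).congr ?_ ?_ ?_ ?_,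
    (hα _ _ _ _ _ h.t_rep).congr ?_ ?_ ?_ ?_⟩ <;> simp

/-- If a power of the Frobenius automorphism inverts the parameter, then the three generators
are inverted by an automorphism. -/
lemma exists_inverts (h : NormalForm l x y t) {e : ℕ} (he : l ^ p ^ e = l⁻¹) :
    ∃ α : PSL K ≃* PSL K, α x = x⁻¹ ∧ α y = y⁻¹ ∧ α t = t⁻¹ := by
  have hl := h.ne_zero
  obtain ⟨α, hα⟩ := h.exists_frobenius (p := p) e
  rw [he] at hα
  obtain ⟨β, hβ⟩ := exists_scaling hl
  have hx := hβ _ _ _ _ _ hα.x_rep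
  have hy := hβ _ _ _ _ _ hα.y_rep
  have ht := hβ _ _ _ _ _ hα.t_rep
  refine ⟨α.trans β, ?_, ?_, ?_⟩
  · exact (hx.scale (neg_ne_zero.2 (inv_ne_zero hl))).eq (h.x_rep.inv.congr
      (by simp [hl]) (by simp [hl]) (by simp) (by simp))
  · exact (hy.scale hl).eq (h.y_rep.inv.congr
      (by simp [hl]) (by simp) (by simp) (by simp))
  · exact (ht.scale (neg_ne_zero.2 one_ne_zero)).eq (h.t_rep.inv.congr
      (by simp) (by simp) (by field_simp; ring) (by simp))

end NormalForm

end PSL2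

namespace PSL2

variable {K : Type v} [Field K] {p d : ℕ}

/-! ### Admissible parameters -/

namespace NormalForm

variable [Fact p.Prime] [CharP K p] [Fintype K] {l : K} {x y t : PSL K}

/-- The intersection condition puts `w ↦ -w` into `⟨y⟩`, so that `-1` is a power of `l`. -/
lemma even_orderOf (h : NormalForm l x y t) (hl : ∀ F : Subfield K, l ∈ F → F = ⊤)
    (hl1 : l ≠ 1) (hl' : 1 + l⁻¹ ≠ 0) (h2 : (1 : K) ≠ -1) (hsq : IsSquare (-1 : K))
    (hinf : Subgroup.closure {x, y} ⊓ Subgroup.closure {y, t} ≤ Subgroup.zpowers y) :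
    Even (orderOf l) := by
  obtain ⟨g, hg⟩ := exists_upper (neg_ne_zero.2 one_ne_zero) hsq (0 : K)
  obtain ⟨n, hn⟩ := hinf (h.neg_mem hl hl1 hl' hg)
  have h1 := h.y_rep.diag_zpow n
  rw [show y ^ n = g from hn] at h1
  have h3 : l ^ n = -1 := (h1.unique_of_one hg).1
  have h4 : (-1 : K) ^ orderOf l = 1 := by
    rw [← h3, ← zpow_natCast, zpow_comm, zpow_natCast, pow_orderOf_eq_one, one_zpow]
  by_contra h5
  rw [(Nat.not_even_iff_odd.1 h5).neg_one_pow] at h4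
  exact h2 h4.symm

/-- Triples in normal form that come from chiral polytopes have an admissible parameter. -/
lemma isAdmissible (hK : Fintype.card K = p ^ d) (hq : p ^ d % 4 = 1) (h : NormalForm l x y t)
    (htop : Subgroup.closure {x, y, t} = ⊤)
    (hninv : ∀ α : PSL K ≃* PSL K, ¬ (α x = x⁻¹ ∧ α y = y⁻¹ ∧ α t = t⁻¹)) :
    IsAdmissible p d (orderOf l) := by
  have hl0 := h.ne_zero
  have hgen := h.subfield_eq_top htop
  have hinv : ∀ e, l ^ p ^ e ≠ l⁻¹ := by
    intro e he
    obtain ⟨α, hα⟩ := h.exists_inverts he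
    exact hninv α hα
  refine ⟨?_, ?_, fun e h1 he => ⟨?_, ?_⟩⟩
  · by_contra h3
    -- an element of order at most `2` is inverted by the trivial Frobenius power
    have h1 : orderOf l ∣ p ^ 0 + 1 := by
      have := (isOfFinOrder_iff_pow_eq_one.2 ⟨Fintype.card K - 1,
        by have := Fintype.one_lt_card (α := K); omega,
        FiniteField.pow_card_sub_one_eq_one l hl0⟩).orderOf_pos
      have h2 : orderOf l = 1 ∨ orderOf l = 2 := by omega
      rcases h2 with h2 | h2 <;> rw [h2] <;> simp
    exact hinv 0 ((orderOf_dvd_add_one hl0).1 h1)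
  · have h2 : ringChar K ≠ 2 := by
      intro h2
      have := FiniteField.even_card_iff_char_two.1 h2
      omega
    have := (FiniteField.isSquare_iff h2 hl0).1 h.isSquare
    rw [hK] at this
    rw [show (p ^ d - 1) / 2 = p ^ d / 2 by omega]
    exact orderOf_dvd_of_pow_eq_one this
  · rw [orderOf_dvd_sub_one hl0 (Nat.one_le_pow _ _ (Fact.out : p.Prime).pos)]
    exact pow_ne_of_subfield_eq_top hK hgen h1 he
  · rw [orderOf_dvd_add_one hl0]
    exact hinv e

end NormalForm

lemma pow_half_orderOf {l : K} (h0 : orderOf l ≠ 0) (h : Even (orderOf l)) :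
    l ^ (orderOf l / 2) = -1 := by
  obtain ⟨m, hm⟩ := h
  have h1 : (l ^ m) * (l ^ m) = 1 := by rw [← pow_add, ← hm, pow_orderOf_eq_one]
  rw [hm, show (m + m) / 2 = m by omega]
  refine (mul_self_eq_one_iff.1 h1).resolve_left fun h2 => ?_
  have := Nat.le_of_dvd (by omega) (orderOf_dvd_of_pow_eq_one h2)
  omega

lemma orderOf_neg_inv {l : K} (h0 : orderOf l ≠ 0) (h : Even (orderOf l)) :
    (orderOf l % 4 = 0 → orderOf (-l⁻¹) = orderOf l) ∧
      (orderOf l % 4 = 2 → orderOf (-l⁻¹) = orderOf l / 2) := by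
  have h1 : -l⁻¹ = l ^ (orderOf l / 2 + (orderOf l - 1)) := by
    have h2 : l⁻¹ = l ^ (orderOf l - 1) := by
      refine inv_eq_of_mul_eq_one_left ?_
      rw [← pow_succ, Nat.sub_add_cancel (by omega), pow_orderOf_eq_one]
    rw [pow_add, pow_half_orderOf h0 h, h2, neg_one_mul]
  -- `gcd (k, E)` divides `3 * k - 2 * E = 2`
  have h2 : ∀ k E : ℕ, k ≠ 0 → k % 2 = 0 → E = k / 2 + (k - 1) →
      (k % 4 = 0 → k.gcd E = 1) ∧ (k % 4 = 2 → k.gcd E = 2) := by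
    intro k E hk hk2 hE
    have h3 : k.gcd E ∣ 2 := by
      have := Nat.dvd_sub (Dvd.dvd.mul_left (Nat.gcd_dvd_left k E) 3)
        (Dvd.dvd.mul_left (Nat.gcd_dvd_right k E) 2)
      rwa [show 3 * k - 2 * E = 2 by omega] at this
    constructor
    · intro h4
      rcases (Nat.dvd_prime Nat.prime_two).1 h3 with h5 | h5
      · exact h5
      · have := Nat.gcd_dvd_right k E
        rw [h5] at this
        omega
    · intro h4
      exact Nat.dvd_antisymm h3 (Nat.dvd_gcd (by omega) (by omega))
  have h3 := h2 (orderOf l) _ h0 (Nat.even_iff.1 h) rfl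
  have h4 : orderOf l / 2 + (orderOf l - 1) ≠ 0 := by
    have := Nat.even_iff.1 h
    omega
  rw [h1, orderOf_pow' _ h4]
  constructor
  · intro h4; rw [h3.1 h4, Nat.div_one]
  · intro h4; rw [h3.2 h4]

/-- Triples in normal form with an admissible parameter of even order are generators of
the rotation groups of chiral polytopes. -/
lemma NormalForm.isChiralTriple [Fact p.Prime] [CharP K p] [Fintype K] {l : K} {x y t : PSL K}
    (hK : Fintype.card K = p ^ d) (h : NormalForm l x y t)
    (hadm : IsAdmissible p d (orderOf l)) (heven : Even (orderOf l)) : IsChiralTriple x y t := by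
  have hl0 := h.ne_zero
  obtain ⟨h2, -, hadm⟩ := hadm
  have hl1 : l ≠ 1 := by rintro rfl; rw [orderOf_one] at h2; omega
  have hl' : 1 + l⁻¹ ≠ 0 := by
    intro h0
    have h1 : l = -1 := by
      field_simp at h0
      linear_combination h0
    have := orderOf_le_of_pow_eq_one (x := l) two_pos (by rw [h1]; simp)
    omega
  have hgen : ∀ F : Subfield K, l ∈ F → F = ⊤ := by
    refine subfield_eq_top_of_pow_ne hK fun e h1 he h3 => (hadm e h1 he).1 ?_
    rwa [orderOf_dvd_sub_one hl0 (Nat.one_le_pow _ _ (Fact.out : p.Prime).pos)]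
  have hpow : l ^ ((orderOf l / 2 : ℕ) : ℤ) = -1 := by
    rw [zpow_natCast]; exact pow_half_orderOf (by omega) heven
  refine ⟨h.t_mul_t, h.xy_mul_xy, h.xt_mul_xt, ?_, ?_, ?_, h.inf_xy, h.inf_yz hl', h.inf_le hpow,
    h.closure_eq_top hgen hl1 hl', ?_⟩
  · rintro rfl
    exact one_ne_zero h.x_rep.eq_of_one.1
  · rintro rfl
    exact hl1 h.y_rep.eq_of_one.2.2
  · rintro rfl
    obtain ⟨s, hs, -, -, h3, -⟩ := h.y_rep.unique h.t_rep
    exact hl' (by rw [h3, mul_zero])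
  -- an automorphism that inverts the generators maps the parameter `l` to `l⁻¹`
  · rintro α ⟨hx, hy, -⟩
    obtain ⟨e, he, h3⟩ := h.exists_pow_eq hK hgen hl1 α (m := l⁻¹)
      (hx ▸ h.x_rep.inv.congr rfl rfl neg_zero rfl)
      (hy ▸ (h.y_rep.inv.scale (inv_ne_zero hl0)).congr (by simp) (by simp) (by simp)
        (by simp [hl0]))
    have h4 := (orderOf_dvd_add_one hl0).2 h3.symm
    rcases Nat.eq_zero_or_pos e with rfl | h5
    · have := Nat.le_of_dvd (by simp) h4
      simp only [pow_zero] at this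
      omega
    · exact (hadm e h5 he).2 h4

end PSL2

/-! ### The rotation group of a chiral polytope of rank 4 -/

namespace AbstractPolytope.IsChiral

variable {P : AbstractPolytope.{u} 4} (hP : P.IsChiral) (Φ : Flag P.Face)

include hP

lemma isRotation_one : P.IsRotation Φ 1 (tau Φ 0) :=
  (hP.isRotation_iff Φ le_rfl (by norm_num)).2 (by simp [hP.tau_one])

lemma isRotation_two : P.IsRotation Φ 2 (tau Φ 2)⁻¹ :=
  (hP.isRotation_iff Φ (by norm_num) (by norm_num)).2 (by
    rw [show (2 : ℤ) - 1 = 1 by norm_num, hP.tau_one, one_mul])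

lemma isRotation_three : P.IsRotation Φ 3 (tau Φ 2 * (tau Φ 3)⁻¹) :=
  (hP.isRotation_iff Φ (by norm_num) (by norm_num)).2 (by norm_num)

lemma tau_three_mul_self : tau Φ 3 * tau Φ 3 = 1 := by
  have := hP.tau_mul_tau_inv_sq Φ (i := 1) (j := 3) (by norm_num) (by norm_num) (by norm_num)
  rw [hP.tau_one, one_mul, inv_one, mul_one] at this
  nth_rewrite 2 [← this]
  exact mul_inv_cancel _

lemma tau_three_inv : (tau Φ 3)⁻¹ = tau Φ 3 :=
  inv_eq_of_mul_eq_one_left (hP.tau_three_mul_self Φ)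

lemma closure_tau : Subgroup.closure {tau Φ 0, (tau Φ 2)⁻¹, tau Φ 3} = ⊤ := by
  refine hP.eq_top_of_tau_mem Φ _ fun i h0 h4 => ?_
  have h2 := Subgroup.inv_mem (Subgroup.closure {tau Φ 0, (tau Φ 2)⁻¹, tau Φ 3})
    (Subgroup.subset_closure (by simp) : (tau Φ 2)⁻¹ ∈ _)
  rw [inv_inv] at h2
  interval_cases i
  · exact Subgroup.subset_closure (by simp)
  · rw [hP.tau_one]; exact Subgroup.one_mem _
  · exact h2
  · exact Subgroup.subset_closure (by simp)

lemma xy_mul_xy : tau Φ 0 * (tau Φ 2)⁻¹ * (tau Φ 0 * (tau Φ 2)⁻¹) = 1 := by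
  nth_rewrite 1 [hP.tau_mul_tau_inv_sq Φ (by norm_num) (by norm_num) (by norm_num)]
  group

lemma xt_mul_xt : tau Φ 0 * tau Φ 3 * (tau Φ 0 * tau Φ 3) = 1 := by
  have := hP.tau_mul_tau_inv_sq Φ (i := 0) (j := 3) (by norm_num) (by norm_num) (by norm_num)
  rw [hP.tau_three_inv] at this
  nth_rewrite 1 [this]
  rw [mul_assoc, inv_mul_cancel_left, hP.tau_three_mul_self]

lemma closure_inf : Subgroup.closure {tau Φ 0, (tau Φ 2)⁻¹} ⊓
    Subgroup.closure {(tau Φ 2)⁻¹, tau Φ 3} ≤ Subgroup.zpowers (tau Φ 2)⁻¹ := by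
  refine le_trans (inf_le_inf_left _ ?_) (hP.closure_inf_closure_le Φ (hP.isRotation_one Φ)
    (hP.isRotation_two Φ) (hP.isRotation_three Φ))
  rw [Subgroup.closure_le]
  have h2 : (tau Φ 2)⁻¹ ∈ Subgroup.closure {(tau Φ 2)⁻¹, tau Φ 2 * (tau Φ 3)⁻¹} :=
    Subgroup.subset_closure (by simp)
  rintro _ (rfl | rfl)
  · exact h2
  · have h3 : tau Φ 2 * (tau Φ 3)⁻¹ ∈ Subgroup.closure {(tau Φ 2)⁻¹, tau Φ 2 * (tau Φ 3)⁻¹} :=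
      Subgroup.subset_closure (by simp)
    have := Subgroup.mul_mem _ h2 h3
    rw [inv_mul_cancel_left] at this
    rwa [hP.tau_three_inv] at this ⊢

lemma not_inverts_tau (α : P.Aut ≃* P.Aut) : ¬ (α (tau Φ 0) = (tau Φ 0)⁻¹ ∧
    α (tau Φ 2)⁻¹ = (tau Φ 2)⁻¹⁻¹ ∧ α (tau Φ 3) = (tau Φ 3)⁻¹) := by
  rintro ⟨h0, h2, h3⟩
  refine hP.not_inverts Φ α fun i hi hi4 => ?_
  interval_cases i
  · exact h0
  · rw [hP.tau_one, map_one, inv_one]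
  · rw [map_inv] at h2; exact inv_injective h2
  · exact h3

end AbstractPolytope.IsChiral

open AbstractPolytope

lemma MulEquiv.map_closure {G H : Type*} [Group G] [Group H] (f : G ≃* H) (s : Set G) :
    (Subgroup.closure s).map f.toMonoidHom = Subgroup.closure (f '' s) :=
  MonoidHom.map_closure _ _

namespace PSL2

/-! ### The parameter of a chiral polytope -/

variable {K : Type v} [Field K] {p d : ℕ}

/-- The rotations of the based polytope `X` have the normal form with parameter `l`, for some
identification of the automorphism group of `X` with `PSL(2, K)`. -/
def HasParameter (X : BasedPolytope.{u} 4) (l : K) : Prop :=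
  X.polytope.IsChiral ∧ ∃ f : X.polytope.Aut ≃* PSL K,
    NormalForm l (f (tau X.base 0)) (f (tau X.base 2)⁻¹) (f (tau X.base 3))

lemma closure_map_tau {P : AbstractPolytope.{u} 4} (hP : P.IsChiral) (Φ : Flag P.Face)
    (f : P.Aut ≃* PSL K) :
    Subgroup.closure {f (tau Φ 0), f (tau Φ 2)⁻¹, f (tau Φ 3)} = ⊤ := by
  have := f.map_closure {tau Φ 0, (tau Φ 2)⁻¹, tau Φ 3}
  rw [hP.closure_tau, ← MonoidHom.range_eq_map, MonoidHom.range_eq_top.2 f.surjective] at this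
  simpa [Set.image_insert_eq] using this.symm

lemma exists_hasParameter {X : BasedPolytope.{u} 4} (hX : X.IsChiralPSL K) :
    ∃ l : K, HasParameter X l := by
  obtain ⟨hP, f, σ₁, σ₂, σ₃, h1, h2, h3, ⟨a, ha⟩, ⟨b, hb⟩⟩ := hX
  set Φ := X.base
  have h1' := (hP.isRotation_iff Φ le_rfl (by norm_num)).1 h1
  have h2' := (hP.isRotation_iff Φ (by norm_num) (by norm_num)).1 h2
  have h3' := (hP.isRotation_iff Φ (by norm_num) (by norm_num)).1 h3
  norm_num [hP.tau_one] at h1' h2' h3'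
  have ht : σ₂ * σ₃ = tau Φ 3 := by
    rw [h2', h3', inv_mul_cancel_left, hP.tau_three_inv]
  obtain ⟨α, l, h⟩ := exists_normalForm (p := a) (q := b)
    (by rw [← map_mul, hP.tau_three_mul_self, map_one])
    (by rw [← map_mul, ← map_mul, hP.xy_mul_xy, map_one])
    (by rw [← map_mul, ← map_mul, hP.xt_mul_xt, map_one]) (closure_map_tau hP Φ f)
    (h1' ▸ ha σ₁ (Subgroup.subset_closure (by simp)))
    (h2' ▸ ha σ₂ (Subgroup.subset_closure (by simp)))
    (h2' ▸ hb σ₂ (Subgroup.subset_closure (by simp)))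
    (ht ▸ hb (σ₂ * σ₃) (Subgroup.mul_mem _ (Subgroup.subset_closure (by simp))
      (Subgroup.subset_closure (by simp))))
  exact ⟨l, hP, f.trans α, h⟩

namespace HasParameter

variable {X Y : BasedPolytope.{u} 4} {l m : K}

lemma isChiralPSL (h : HasParameter X l) : X.IsChiralPSL K := by
  obtain ⟨hP, f, hf⟩ := h
  refine ⟨hP, f, _, _, _, hP.isRotation_one _, hP.isRotation_two _, hP.isRotation_three _,
    ⟨Projectivization.mk K (![1, 0] : Fin 2 → K) (by simp), fun g hg => ?_⟩,
    ⟨Projectivization.mk K (![0, 1] : Fin 2 → K) (by simp), fun g hg => ?_⟩⟩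
  · have : Subgroup.closure {tau X.base 0, (tau X.base 2)⁻¹} ≤ (MulAction.stabilizer (PSL K)
        (Projectivization.mk K (![1, 0] : Fin 2 → K) (by simp))).comap f.toMonoidHom := by
      rw [Subgroup.closure_le]
      rintro _ (rfl | rfl)
      · exact hf.x_rep.smul_of_upper
      · exact hf.y_rep.smul_of_upper
    exact this hg
  · have : Subgroup.closure {(tau X.base 2)⁻¹, tau X.base 2 * (tau X.base 3)⁻¹} ≤
        (MulAction.stabilizer (PSL K)
          (Projectivization.mk K (![0, 1] : Fin 2 → K) (by simp))).comap f.toMonoidHom := by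
      rw [Subgroup.closure_le]
      rintro _ (rfl | rfl)
      · exact hf.y_rep.smul_of_lower
      · have h3 := hf.yt_rep
        rw [← map_inv, ← map_mul, inv_inv, ← hP.tau_three_inv] at h3
        exact h3.smul_of_lower
    exact this hg

lemma hasType (h : HasParameter X l) (h1 : -l⁻¹ ≠ 1) (h2 : l ≠ 1) :
    X.polytope.HasType (orderOf (-l⁻¹)) (orderOf l) (orderOf (-l⁻¹)) := by
  obtain ⟨hP, f, hf⟩ := h
  have hx := hP.sectionsArePolygons X.base le_rfl (by norm_num) (hP.isRotation_one X.base)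
  have hy := hP.sectionsArePolygons X.base (by norm_num) (by norm_num) (hP.isRotation_two X.base)
  have hz := hP.sectionsArePolygons X.base (by norm_num) (by norm_num) (hP.isRotation_three X.base)
  rw [← f.orderOf_eq, hf.x_rep.orderOf_eq (mul_zero _) h1] at hx
  rw [← f.orderOf_eq, hf.y_rep.orderOf_eq (mul_zero _) h2] at hy
  have h3 := hf.yt_rep
  rw [← map_inv, ← map_mul, inv_inv, ← hP.tau_three_inv] at h3
  rw [← f.orderOf_eq, h3.orderOf_eq (zero_mul _) h1] at hz
  exact ⟨hx, hy, hz⟩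

lemma hasType_of_mod_four (h : HasParameter X l) (h2 : 2 < orderOf l) (heven : Even (orderOf l)) :
    (orderOf l % 4 = 0 → X.polytope.HasType (orderOf l) (orderOf l) (orderOf l)) ∧
      (orderOf l % 4 = 2 → X.polytope.HasType (orderOf l / 2) (orderOf l) (orderOf l / 2)) := by
  have hl1 : l ≠ 1 := by rintro rfl; rw [orderOf_one] at h2; omega
  have h1 : -l⁻¹ ≠ 1 := by
    intro h3
    have h1 : l = -1 := by
      rw [neg_eq_iff_eq_neg] at h3
      rw [← inv_inv l, h3, inv_neg, inv_one]
    have := orderOf_le_of_pow_eq_one (x := l) two_pos (by rw [h1]; simp)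
    omega
  have h3 := orderOf_neg_inv (by omega) heven
  have h4 := h.hasType h1 hl1
  constructor
  · intro h5; rwa [h3.1 h5] at h4
  · intro h5; rwa [h3.2 h5] at h4

variable [Fact p.Prime] [CharP K p] [Fintype K]

lemma isAdmissible (hK : Fintype.card K = p ^ d) (hq : p ^ d % 4 = 1) (h : HasParameter X l) :
    IsAdmissible p d (orderOf l) ∧ Even (orderOf l) := by
  obtain ⟨hP, f, hf⟩ := h
  have htop := closure_map_tau hP X.base f
  have hadm := hf.isAdmissible hK hq htop (by
    rintro α ⟨h0, h2, h3⟩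
    exact hP.not_inverts_tau X.base ((f.trans α).trans f.symm)
      ⟨f.symm_apply_eq.2 (h0.trans (map_inv f _).symm),
        f.symm_apply_eq.2 (h2.trans (map_inv f _).symm),
        f.symm_apply_eq.2 (h3.trans (map_inv f _).symm)⟩)
  refine ⟨hadm, hf.even_orderOf (hf.subfield_eq_top htop) ?_ (hf.one_add_inv_ne_zero htop) ?_ ?_ ?_⟩
  · rintro rfl
    have := hadm.1
    rw [orderOf_one] at this
    omega
  · intro h
    have h2 : ringChar K = 2 := by
      by_contra h3
      exact Ring.neg_one_ne_one_of_char_ne_two h3 h.symm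
    have := FiniteField.even_card_iff_char_two.1 h2
    omega
  · rw [FiniteField.isSquare_neg_one_iff]
    omega
  · have h1 := f.map_closure {tau X.base 0, (tau X.base 2)⁻¹}
    have h2 := f.map_closure {(tau X.base 2)⁻¹, tau X.base 3}
    rw [Set.image_pair] at h1 h2
    rw [← h1, ← h2, ← Subgroup.map_inf _ _ _ f.injective]
    refine (Subgroup.map_mono (hP.closure_inf X.base)).trans_eq ?_
    exact MonoidHom.map_zpowers _ _

/-- Polytopes with the same parameter, up to a power of the Frobenius automorphism, are
isomorphic. -/
lemma equiv_of_pow (h : HasParameter X l) {e : ℕ} (h' : HasParameter Y (l ^ p ^ e)) : X ≈ Y := by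
  obtain ⟨hP, f, hf⟩ := h
  obtain ⟨hQ, g, hg⟩ := h'
  obtain ⟨α, hα⟩ := hf.exists_frobenius (p := p) e
  refine hP.exists_iso hQ X.base Y.base ((f.trans α).trans g.symm) fun i h0 h4 => ?_
  simp only [MulEquiv.trans_apply, MulEquiv.symm_apply_eq]
  interval_cases i
  · exact hα.x_rep.eq hg.x_rep
  · rw [hP.tau_one, hQ.tau_one, map_one, map_one, map_one]
  · have := hα.y_rep.eq hg.y_rep
    rw [map_inv, map_inv, map_inv] at this
    exact inv_injective this
  · exact hα.t_rep.eq hg.t_rep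

/-- The parameters of isomorphic polytopes agree up to a power of the Frobenius automorphism. -/
lemma exists_pow_of_equiv (hK : Fintype.card K = p ^ d) (h : HasParameter X l)
    (hl1 : l ≠ 1) (h' : HasParameter Y m) (hXY : X ≈ Y) : ∃ e < d, m = l ^ p ^ e := by
  obtain ⟨hP, f, hf⟩ := h
  obtain ⟨hQ, g, hg⟩ := h'
  obtain ⟨e, he⟩ := hXY
  obtain ⟨α, hα⟩ := hP.exists_mulEquiv hQ e he
  refine hf.exists_pow_eq hK (hf.subfield_eq_top (closure_map_tau hP X.base f)) hl1
    ((f.symm.trans α).trans g) (a := -m⁻¹) (b := 1) (c := 1) ?_ ?_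
  · simp only [MulEquiv.trans_apply, MulEquiv.symm_apply_apply]
    rw [hα 0 le_rfl (by norm_num)]
    exact hg.x_rep
  · simp only [MulEquiv.trans_apply, MulEquiv.symm_apply_apply]
    rw [map_inv, hα 2 (by norm_num) (by norm_num)]
    exact hg.y_rep

/-- Every admissible parameter of even order occurs. The polytope can be found in any universe,
because `PSL(2, K)` is finite. -/
lemma exists_of_isAdmissible (hK : Fintype.card K = p ^ d) (hq : p ^ d % 4 = 1)
    (hadm : IsAdmissible p d (orderOf l)) (heven : Even (orderOf l)) :
    ∃ X : BasedPolytope.{u} 4, HasParameter X l := by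
  have hl0 : l ≠ 0 := by
    rintro rfl
    have := hadm.1
    rw [orderOf_zero] at this
    omega
  have hsq : IsSquare l := by
    have h2 : ringChar K ≠ 2 := by
      intro h2
      have := FiniteField.even_card_iff_char_two.1 h2
      omega
    rw [FiniteField.isSquare_iff h2 hl0, hK, ← orderOf_dvd_iff_pow_eq_one,
      show p ^ d / 2 = (p ^ d - 1) / 2 by omega]
    exact hadm.2.1
  obtain ⟨x, y, t, h⟩ := exists_normalForm_of_isSquare hl0 hsq (by
    rw [FiniteField.isSquare_neg_one_iff]
    omega)
  let e : Shrink.{u} (PSL K) ≃* PSL K := Shrink.mulEquiv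
  obtain ⟨P, Φ, f, hP, hx, hy, ht⟩ :=
    ((h.isChiralTriple hK hadm heven).map e.symm).exists_polytope
  refine ⟨⟨P, Φ⟩, hP, f.trans e, ?_⟩
  simp only [MulEquiv.trans_apply, map_inv, hx, hy, ht, inv_inv, MulEquiv.apply_symm_apply]
  exact h

end HasParameter

lemma orderOf_pow_frobenius [Fact p.Prime] [CharP K p] (l : K) (e : ℕ) :
    orderOf (l ^ p ^ e) = orderOf l :=
  orderOf_injective (iterateFrobenius K p e).toMonoidHom (iterateFrobenius K p e).injective l

/-! ### Counting -/

lemma card_orderOf_eq [Fintype K] [DecidableEq K] {k : ℕ} (hk0 : 0 < k)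
    (hk : k ∣ Fintype.card K - 1) : (Finset.univ.filter fun l : K => orderOf l = k).card =
      k.totient := by
  obtain ⟨g, hg⟩ := IsCyclic.exists_ofOrder_eq_natCard (α := Kˣ)
  rw [Nat.card_units, Nat.card_eq_fintype_card] at hg
  obtain ⟨m, hm⟩ := hk
  have hpos : 0 < Fintype.card K - 1 := by have := Fintype.one_lt_card (α := K); omega
  have hm0 : m ≠ 0 := by rintro rfl; omega
  have h1 : orderOf ((g ^ m : Kˣ) : K) = k := by
    rw [orderOf_units, orderOf_pow_of_dvd hm0 (by rw [hg, hm]; exact dvd_mul_left _ _), hg, hm,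
      Nat.mul_div_cancel _ (Nat.pos_of_ne_zero hm0)]
  have h2 : IsPrimitiveRoot ((g ^ m : Kˣ) : K) k := h1 ▸ IsPrimitiveRoot.orderOf _
  rw [← h2.card_primitiveRoots]
  congr 1
  ext l
  rw [mem_primitiveRoots hk0, Finset.mem_filter, IsPrimitiveRoot.iff_orderOf]
  simp

/-- The `φ(k)` elements of order `k` parametrise the polytopes, and the orbits of the Frobenius
automorphism on them, which have `d` elements each, correspond to the isomorphism classes. -/
lemma mul_numChiralPSL [Fact p.Prime] [CharP K p] [Fintype K] (hK : Fintype.card K = p ^ d)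
    (hq : p ^ d % 4 = 1) {a k c : ℕ} (hadm : IsAdmissible p d k) (heven : Even k)
    (htype : ∀ (X : BasedPolytope.{u} 4) (l : K), orderOf l = k → HasParameter X l →
      X.polytope.HasType a k c) :
    d * BasedPolytope.numChiralPSL.{u} K a k c = k.totient := by
  classical
  have h2 := hadm.1
  set T : Finset K := Finset.univ.filter fun l : K => orderOf l = k with hTdef
  have hmem : ∀ l, l ∈ T ↔ orderOf l = k := by simp [hTdef]
  have hT : T.card = k.totient :=
    card_orderOf_eq (by omega) (hK ▸ (hadm.2.1.trans (Nat.div_dvd_of_dvd (by omega))))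
  have hX : ∀ l : K, orderOf l = k → ∃ X : BasedPolytope.{u} 4, HasParameter X l := by
    rintro l rfl
    exact HasParameter.exists_of_isAdmissible hK hq hadm heven
  have hne : Nonempty (BasedPolytope.{u} 4) := by
    obtain ⟨l, hl⟩ := Finset.card_pos.1 (hT ▸ Nat.totient_pos.2 (by omega) : 0 < T.card)
    exact ⟨(hX l ((hmem l).1 hl)).choose⟩
  choose! X hX using hX
  let F : K → Quotient (BasedPolytope.setoid.{u} 4) := fun l => Quotient.mk _ (X l)
  have himage : ((fun X : BasedPolytope.{u} 4 => Quotient.mk (BasedPolytope.setoid 4) X) ''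
      {X | X.IsChiralPSL K ∧ X.polytope.HasType a k c}) = (T.image F : Finset _) := by
    ext q
    simp only [Set.mem_image, Set.mem_ofPred_eq, Finset.coe_image, Finset.mem_coe, hmem]
    constructor
    · rintro ⟨Y, ⟨hY, hYt⟩, rfl⟩
      obtain ⟨l, hl⟩ := exists_hasParameter hY
      obtain ⟨hladm, hleven⟩ := hl.isAdmissible hK hq
      have hlk : orderOf l = k := by
        have h3 := hl.hasType_of_mod_four hladm.1 hleven
        have h4 : Y.polytope.SectionsArePolygons 2 (orderOf l) := by
          have := Nat.even_iff.1 hleven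
          rcases (by omega : orderOf l % 4 = 0 ∨ orderOf l % 4 = 2) with h5 | h5
          · exact (h3.1 h5).2.1
          · exact (h3.2 h5).2.1
        exact h4.unique (by norm_num) (by norm_num) Y.base hYt.2.1
      exact ⟨l, hlk, Quotient.sound ((hX l hlk).equiv_of_pow (p := p) (e := 0)
        (by simpa using hl))⟩
    · rintro ⟨l, hl, rfl⟩
      exact ⟨X l, ⟨(hX l hl).isChiralPSL, htype _ l hl (hX l hl)⟩, rfl⟩
  have hfib : ∀ q ∈ T.image F, (T.filter fun l => F l = q).card = d := by
    intro q hq'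
    obtain ⟨l, hl, rfl⟩ := Finset.mem_image.1 hq'
    rw [hmem] at hl
    have hl0 : l ≠ 0 := by
      rintro rfl
      rw [orderOf_zero] at hl
      omega
    have hl1 : l ≠ 1 := by
      rintro rfl
      rw [orderOf_one] at hl
      omega
    have h3 : (T.filter fun m => F m = F l) = (Finset.range d).image fun e => l ^ p ^ e := by
      ext m
      simp only [Finset.mem_filter, hmem, Finset.mem_image, Finset.mem_range]
      constructor
      · rintro ⟨hm, hF⟩
        obtain ⟨e, he, h4⟩ := (hX l hl).exists_pow_of_equiv hK hl1 (hX m hm)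
          (Quotient.exact hF.symm)
        exact ⟨e, he, h4.symm⟩
      · rintro ⟨e, -, rfl⟩
        have h4 := (orderOf_pow_frobenius (p := p) l e).trans hl
        exact ⟨h4, (Quotient.sound ((hX l hl).equiv_of_pow (hX _ h4))).symm⟩
    rw [h3, Finset.card_image_of_injOn, Finset.card_range]
    have hlt : ∀ i j, i < j → j < d → l ^ p ^ i ≠ l ^ p ^ j := by
      intro i j hij hj h4
      have h5 : l ^ p ^ (j - i) = l := by
        apply (iterateFrobenius K p i).injective
        rw [iterateFrobenius_def, iterateFrobenius_def, ← pow_mul, ← pow_add,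
          Nat.sub_add_cancel hij.le, h4]
      refine (hadm.2.2 (j - i) (by omega) (by omega)).1 ?_
      rw [← hl, orderOf_dvd_sub_one hl0 (Nat.one_le_pow _ _ (Fact.out : p.Prime).pos)]
      exact h5
    intro i hi j hj hij
    rw [Finset.coe_range, Set.mem_Iio] at hi hj
    rcases lt_trichotomy i j with h4 | h4 | h4
    · exact (hlt i j h4 hj hij).elim
    · exact h4
    · exact (hlt j i h4 hi hij.symm).elim
  have hcard := Finset.card_eq_sum_card_image F T
  rw [Finset.sum_congr rfl hfib, Finset.sum_const, smul_eq_mul, mul_comm, hT] at hcard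
  rw [BasedPolytope.numChiralPSL, himage, Set.ncard_coe_finset, hcard]

end PSL2

theorem mainTheorem3 (p d : ℕ) (hp : p.Prime) (hq : p ^ d % 4 = 1)
    (K : Type v) [Field K] (hK : Nat.card K = p ^ d) :
    (∀ X : BasedPolytope.{u} 4, X.IsChiralPSL K →
      ∃ k : ℕ, IsAdmissible p d k ∧
        ((k % 4 = 0 ∧ X.polytope.HasType k k k) ∨
          (k % 4 = 2 ∧ X.polytope.HasType (k / 2) k (k / 2)))) ∧
    (∀ k : ℕ, IsAdmissible p d k →
      (k % 4 = 0 → d * BasedPolytope.numChiralPSL.{u} K k k k = Nat.totient k) ∧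
      (k % 4 = 2 → d * BasedPolytope.numChiralPSL.{u} K (k / 2) k (k / 2) = Nat.totient k)) := by
  have : Fact p.Prime := ⟨hp⟩
  have : Finite K := Nat.finite_of_card_ne_zero (by rw [hK]; exact pow_ne_zero _ hp.ne_zero)
  have := Fintype.ofFinite K
  rw [Nat.card_eq_fintype_card] at hK
  have : CharP K p := charP_of_card_eq_prime_pow hK
  refine ⟨fun X hX => ?_, fun k hk => ⟨fun h4 => ?_, fun h4 => ?_⟩⟩
  · obtain ⟨l, hl⟩ := PSL2.exists_hasParameter hX
    obtain ⟨hadm, heven⟩ := hl.isAdmissible hK hq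
    have h := hl.hasType_of_mod_four hadm.1 heven
    have := Nat.even_iff.1 heven
    refine ⟨_, hadm, ?_⟩
    rcases (by omega : orderOf l % 4 = 0 ∨ orderOf l % 4 = 2) with h5 | h5
    · exact Or.inl ⟨h5, h.1 h5⟩
    · exact Or.inr ⟨h5, h.2 h5⟩
  · have heven : Even k := Nat.even_iff.2 (by omega)
    refine PSL2.mul_numChiralPSL hK hq hk heven ?_
    rintro X l rfl hX
    exact (hX.hasType_of_mod_four hk.1 heven).1 h4
  · have heven : Even k := Nat.even_iff.2 (by omega)
    refine PSL2.mul_numChiralPSL hK hq hk heven ?_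
    rintro X l rfl hX
    exact (hX.hasType_of_mod_four hk.1 heven).2 h4
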